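/- **Setting.** Let $t,d\in\mathbb C[[z]]$ be such that the discriminant $t^2-4d$ has a simple zero at $z=0$, and let $\tilde X\to X=\operatorname{Spf}\mathbb C[[z]]$ be the smooth ramified spectral curve $\xi^2-t\xi+d=0$ in the cotangent bundle of the formal disc. Put $O=\mathbb C[[z]][\xi]/(\xi^2-t\xi+d)$, $K=\mathbb C((z))[\xi]/(\xi^2-t\xi+d)$ and $\tilde z=2\xi-t\in O$. Thus $\tilde z^2=t^2-4d$, $\tilde z$ is a formal coordinate on $\tilde X$, $O=\mathbb C[[\tilde z]]$ and $K=\mathbb C((\tilde z))$. Let $\mu=\xi\,dz$ be the canonical $1$-form on $\tilde X$. For a $\lambda$-connection $\nabla$ on a module $M$ over power series in $\lambda$, that is, a $\mathbb C[[\lambda]]$-linear map with values in $1$-forms such that $\nabla(fs)=f\nabla s+\lambda\,df\cdot s$, write $\nabla_0$ for the induced (linear) map on $M/\lambda M$. Consider the following groupoids, in which the morphisms are the isomorphisms compatible with all the structure. * $\mathrm{Conn}(\tilde X)$: pairs $(L,\nabla)$, where $L$ is a free $\mathbb C[[z,\lambda]]$-module of rank $2$ and $\nabla:L\to L\,dz$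 is a $\lambda$-connection with $\operatorname{tr}\nabla_0=t\,dz$ and $\det\nabla_0=d\,(dz)^2$. * $\mathrm{CC}(\tilde X)$: triples $(L_u,\nabla,L_0)$, where $L_u$ is a free $\mathbb C((z))[[\lambda]]$-module of rank $2$, $\nabla:L_u\to L_u\,dz$ is a $\lambda$-connection with $\operatorname{tr}\nabla_0=t\,dz$ and $\det\nabla_0=d\,(dz)^2$, and $L_0\subset L_u/\lambda L_u$ is a $\mathbb C[[z]]$-lattice with $\nabla_0(L_0)\subset L_0\,dz$. * $\widetilde{\mathrm{Conn}}(\tilde X)$: pairs $(l,\delta)$, where $l$ is a free $\mathbb C[[\tilde z,\lambda]]$-module of rank $1$ and $\delta:l\to\tilde z^{-1}l\,d\tilde z$ is a $\lambda$-connection whose residue $l/\tilde z l\to(\tilde z^{-1}l/l)\,d\tilde z$ equals $-\lambda/2$ and for which $\delta_0$ is multiplication by $\mu$. * $\widetilde{\mathrm{CC}}(\tilde X)$: triples $(l_u,\delta,l_0)$, where $l_u$ is a free $\mathbb C((\tilde z))[[\lambda]]$-module of rank $1$, $\delta:l_u\to l_u\,d\tilde z$ is a $\lambda$-connection for which $\delta_0$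 is multiplication by $\mu$, and $l_0\subset l_u/\lambda l_u$ is a $\mathbb C[[\tilde z]]$-lattice. There are natural functors $\mathrm{Conn}(\tilde X)\to\mathrm{CC}(\tilde X)$, $(L,\nabla)\mapsto(\mathbb C((z))[[\lambda]]\otimes_{\mathbb C[[z,\lambda]]}L,\ \nabla,\ L/\lambda L)$, and $\widetilde{\mathrm{Conn}}(\tilde X)\to\widetilde{\mathrm{CC}}(\tilde X)$, $(l,\delta)\mapsto(\mathbb C((\tilde z))[[\lambda]]\otimes_{\mathbb C[[\tilde z,\lambda]]}l,\ \delta,\ l/\lambda l)$. There is also the direct image functor $\widetilde{\mathrm{CC}}(\tilde X)\to\mathrm{CC}(\tilde X)$, which sends $(l_u,\delta,l_0)$ to the same triple considered over $\mathbb C((z))[[\lambda]]$ and $\mathbb C[[z]]$, where $l_u\,d\tilde z=l_u\,dz$. **Theorem.** 1. The functor $\mathrm{Conn}(\tilde X)\to\mathrm{CC}(\tilde X)$ is fully faithful. 2. The functor $\widetilde{\mathrm{Conn}}(\tilde X)\to\widetilde{\mathrm{CC}}(\tilde X)$ is fully faithful. 3. The direct image functor $\widetilde{\mathrm{CC}}(\tilde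 X)\to\mathrm{CC}(\tilde X)$ is an equivalence of groupoids. Under the resulting bijection $[\widetilde{\mathrm{CC}}(\tilde X)]\cong[\mathrm{CC}(\tilde X)]$ of sets of isomorphism classes, the set of classes coming from $\widetilde{\mathrm{Conn}}(\tilde X)$ corresponds exactly to the set of classes coming from $\mathrm{Conn}(\tilde X)$. -/

import Mathlib

open CategoryTheory
open scoped PowerSeries LaurentSeries TensorProduct

noncomputable section

namespace LambdaConn

/-! ### Families of `λ`-connections over `A⟦λ⟧`

Throughout, for a commutative ring `A` the ring `A⟦X⟧` is read as `A⟦λ⟧`; that is, the variable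
`PowerSeries.X : A⟦X⟧` is the deformation parameter `λ`. -/

/-- A derivation of a commutative ring: an additive map with the Leibniz rule. -/
structure Der (A : Type) [CommRing A] where
  toAddMonoidHom : A →+ A
  leibniz' : ∀ a b, toAddMonoidHom (a * b) = a * toAddMonoidHom b + b * toAddMonoidHom a

namespace Der

variable {A : Type} [CommRing A]

instance : FunLike (Der A) A A where
  coe D := D.toAddMonoidHom
  coe_injective D D' h := by
    cases D; cases D'; congr; exact DFunLike.coe_injective h

instance : AddMonoidHomClass (Der A) A A where
  map_add D := D.toAddMonoidHom.map_add
  map_zero D := D.toAddMonoidHom.map_zero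

theorem leibniz (D : Der A) (a b : A) : D (a * b) = a * D b + b * D a := D.leibniz' a b

@[simp] theorem map_one (D : Der A) : D 1 = 0 := by
  have := D.leibniz 1 1
  simpa using this

@[simp] theorem map_natCast (D : Der A) (n : ℕ) : D n = 0 := by
  induction n with
  | zero => simp
  | succ k ih => simp [ih]

@[simp] theorem map_ofNat (D : Der A) (n : ℕ) [n.AtLeastTwo] : D ofNat(n) = 0 :=
  D.map_natCast n

/-- The multiple `c D` of a derivation. -/
def mul (c : A) (D : Der A) : Der A :=
  ⟨(AddMonoidHom.mulLeft c).comp D.toAddMonoidHom, fun a b => by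
    have := D.leibniz' a b
    simp only [AddMonoidHom.comp_apply, AddMonoidHom.coe_mulLeft, this]
    ring⟩

@[simp] theorem mul_apply (c : A) (D : Der A) (a : A) : D.mul c a = c * D a := rfl

end Der

section Generic

variable {A : Type} [CommRing A]

/-- The `λ`-linear extension of a derivation of `A` to `A⟦λ⟧`, acting on each coefficient. -/
def coeffDeriv (D : Der A) : A⟦X⟧ →+ A⟦X⟧ where
  toFun f := PowerSeries.mk fun n => D (PowerSeries.coeff n f)
  map_zero' := by ext n; simp
  map_add' f g := by ext n; simp

@[simp] theorem coeff_coeffDeriv (D : Der A) (f : A⟦X⟧) (n : ℕ) :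
    PowerSeries.coeff n (coeffDeriv D f) = D (PowerSeries.coeff n f) := by
  simp [coeffDeriv]

theorem coeffDeriv_mul (D : Der A) (f g : A⟦X⟧) :
    coeffDeriv D (f * g) = f * coeffDeriv D g + coeffDeriv D f * g := by
  ext n
  simp only [coeff_coeffDeriv, PowerSeries.coeff_mul, map_sum, map_add, Der.leibniz,
    Finset.sum_add_distrib]
  congr 1
  exact Finset.sum_congr rfl fun _ _ => mul_comm _ _

@[simp] theorem coeffDeriv_X (D : Der A) :
    coeffDeriv D (PowerSeries.X : A⟦X⟧) = 0 := by
  ext n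
  simp only [coeff_coeffDeriv, PowerSeries.coeff_X, map_zero]
  split_ifs <;> simp

@[simp] theorem coeffDeriv_one (D : Der A) : coeffDeriv D (1 : A⟦X⟧) = 0 := by
  ext n
  simp only [coeff_coeffDeriv, PowerSeries.coeff_one, map_zero]
  split_ifs <;> simp

/-- A `λ`-connection on an `A⟦λ⟧`-module `M` along the derivation `D` of `A`: an additive map
`∇ : M → M` with `∇ (f s) = f ∇ s + λ (D f) s` for all `f ∈ A⟦λ⟧`. (It is automatically linear over
the power series in `λ` whose coefficients are killed by `D`.)

When `D` is dual to a generator `ω` of a free rank one module of differentials, `∇` stands for the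
`λ`-connection `s ↦ ∇ s ⊗ ω`. -/
structure LambdaConnection (D : Der A) (M : Type) [AddCommGroup M]
    [Module A⟦X⟧ M] where
  toFun : M →+ M
  leibniz : ∀ (f : A⟦X⟧) (s : M),
    toFun (f • s) = f • toFun s + ((PowerSeries.X : A⟦X⟧) * coeffDeriv D f) • s

variable (A) in
/-- The reduction `M / λ M` of an `A⟦λ⟧`-module. -/
def Red (M : Type) [AddCommGroup M] [Module A⟦X⟧ M] : Type :=
  M ⧸ LinearMap.range (LinearMap.lsmul A⟦X⟧ M (PowerSeries.X : A⟦X⟧))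

namespace Red

variable (M : Type) [AddCommGroup M] [Module A⟦X⟧ M]

instance : AddCommGroup (Red A M) :=
  inferInstanceAs (AddCommGroup (M ⧸ LinearMap.range (LinearMap.lsmul A⟦X⟧ M
    (PowerSeries.X : A⟦X⟧))))

/-- `M / λ M` is a module over every `A`-coefficient ring `R → A`, through constant series. -/
instance (R : Type) [CommRing R] [Algebra R A] : Module R (Red A M) :=
  letI : Module A⟦X⟧ (Red A M) :=
    inferInstanceAs (Module A⟦X⟧ (M ⧸ LinearMap.range (LinearMap.lsmul A⟦X⟧ M
      (PowerSeries.X : A⟦X⟧))))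
  Module.compHom (Red A M) ((PowerSeries.C (R := A)).comp (algebraMap R A))

variable (A) in
/-- The class modulo `λ`. -/
def mk : M →+ Red A M :=
  (LinearMap.range (LinearMap.lsmul A⟦X⟧ M (PowerSeries.X : A⟦X⟧))).mkQ.toAddMonoidHom

variable {M}

theorem mk_surjective : Function.Surjective (mk A M) := Submodule.mkQ_surjective _

theorem mk_eq_zero {m : M} : mk A M m = 0 ↔ ∃ m', (PowerSeries.X : A⟦X⟧) • m' = m := by
  simp only [mk]
  exact (Submodule.Quotient.mk_eq_zero _).trans Iff.rfl

theorem smul_mk {R : Type} [CommRing R] [Algebra R A] (r : R) (m : M) :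
    r • mk A M m = mk A M (PowerSeries.C (algebraMap R A r) • m) := rfl

theorem mk_smul (f : A⟦X⟧) (m : M) :
    mk A M (f • m) = PowerSeries.constantCoeff f • mk A M m := by
  rw [smul_mk, ← sub_eq_zero, ← map_sub, mk_eq_zero]
  obtain ⟨g, hg⟩ : (PowerSeries.X : A⟦X⟧) ∣ f - PowerSeries.C (PowerSeries.constantCoeff f) := by
    rw [PowerSeries.X_dvd_iff]; simp
  refine ⟨g • m, ?_⟩
  rw [smul_smul, ← hg, sub_smul]; rfl

instance (R R' : Type) [CommRing R] [CommRing R'] [Algebra R A] [Algebra R' A] [Algebra R R']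
    [IsScalarTower R R' A] : IsScalarTower R R' (Red A M) where
  smul_assoc r a x := by
    obtain ⟨m, rfl⟩ := mk_surjective x
    rw [smul_mk, smul_mk, smul_mk, smul_smul, Algebra.smul_def, map_mul, map_mul,
      ← IsScalarTower.algebraMap_apply]

/-- Descent of an additive map that preserves `λ M` and is `R`-linear modulo `λ`. -/
def desc {B : Type} [CommRing B] (R : Type) [CommRing R] [Algebra R A] [Algebra R B]
    {N : Type} [AddCommGroup N] [Module B⟦X⟧ N] (g : M →+ N)
    (hX : ∀ m, mk B N (g ((PowerSeries.X : A⟦X⟧) • m)) = 0)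
    (hR : ∀ (r : R) (m : M),
      mk B N (g (PowerSeries.C (algebraMap R A r) • m)) = r • mk B N (g m)) :
    Red A M →ₗ[R] Red B N where
  toFun := QuotientAddGroup.lift _ ((mk B N).comp g) (by rintro _ ⟨m, rfl⟩; exact hX m)
  map_add' := map_add _
  map_smul' r x := by
    obtain ⟨m, rfl⟩ := mk_surjective x
    exact hR r m

@[simp] theorem desc_mk {B : Type} [CommRing B] {R : Type} [CommRing R] [Algebra R A]
    [Algebra R B] {N : Type} [AddCommGroup N] [Module B⟦X⟧ N] {g : M →+ N} {hX hR} (m : M) :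
    desc (A := A) (B := B) R g hX hR (mk A M m) = mk B N (g m) := rfl

/-- The map induced modulo `λ` by an `A⟦λ⟧`-linear map. -/
def map (R : Type) [CommRing R] [Algebra R A] {N : Type} [AddCommGroup N] [Module A⟦X⟧ N]
    (e : M →ₗ[A⟦X⟧] N) : Red A M →ₗ[R] Red A N :=
  desc R e.toAddMonoidHom
    (fun m => mk_eq_zero.2 ⟨e m, by simp⟩)
    (fun r m => by rw [smul_mk]; simp)

@[simp] theorem map_mk {R : Type} [CommRing R] [Algebra R A] {N : Type} [AddCommGroup N]
    [Module A⟦X⟧ N] (e : M →ₗ[A⟦X⟧] N) (m : M) :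
    map R e (mk A M m) = mk A N (e m) := rfl

end Red

namespace LambdaConnection

variable {D : Der A} {M : Type} [AddCommGroup M] [Module A⟦X⟧ M]

instance : CoeFun (LambdaConnection D M) fun _ => M → M := ⟨fun n => n.toFun⟩

theorem map_X_smul (n : LambdaConnection D M) (s : M) :
    n ((PowerSeries.X : A⟦X⟧) • s) = (PowerSeries.X : A⟦X⟧) • n s := by
  rw [n.leibniz]; simp

/-- The Higgs field `∇₀` on `M / λ M` induced by a `λ`-connection `∇`. -/
def red (R : Type) [CommRing R] [Algebra R A] (n : LambdaConnection D M) :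
    Red A M →ₗ[R] Red A M :=
  Red.desc R n.toFun
    (fun m => Red.mk_eq_zero.2 ⟨n m, (n.map_X_smul m).symm⟩)
    (fun r m => by
      rw [n.leibniz, map_add, Red.smul_mk, mul_smul, Red.mk_eq_zero.2 ⟨_, rfl⟩, add_zero])

@[simp] theorem red_mk {R : Type} [CommRing R] [Algebra R A] (n : LambdaConnection D M) (m : M) :
    n.red R (Red.mk A M m) = Red.mk A M (n m) := rfl

end LambdaConnection

/-! ### The groupoids of `λ`-connections, with or without a lattice modulo `λ` -/

/-- A free `A⟦λ⟧`-module of rank `n` with a `λ`-connection along `D`. -/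
structure LamMod (D : Der A) (n : ℕ) where
  carrier : Type
  [addCommGroup : AddCommGroup carrier]
  [module : Module A⟦X⟧ carrier]
  free : Nonempty (Module.Basis (Fin n) A⟦X⟧ carrier)
  conn : LambdaConnection D carrier

attribute [instance] LamMod.addCommGroup LamMod.module

namespace LamMod

variable {D : Der A} {n : ℕ}

/-- Isomorphisms of `A⟦λ⟧`-modules compatible with the `λ`-connections. -/
@[ext] structure Hom (M N : LamMod D n) where
  equiv : M.carrier ≃ₗ[A⟦X⟧] N.carrier
  comm : ∀ s, equiv (M.conn s) = N.conn (equiv s)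

instance : Groupoid (LamMod D n) where
  Hom := Hom
  id M := ⟨LinearEquiv.refl _ _, fun _ => rfl⟩
  comp f g := ⟨f.equiv.trans g.equiv, fun s => by simp [f.comm, g.comm]⟩
  inv f := ⟨f.equiv.symm, fun s => by
    rw [LinearEquiv.symm_apply_eq, f.comm, LinearEquiv.apply_symm_apply]⟩
  inv_comp f := by apply Hom.ext; ext s; simp
  comp_inv f := by apply Hom.ext; ext s; simp

end LamMod

/-- A free `A⟦λ⟧`-module `M` of rank `n` with a `λ`-connection along `D`, together with an
`R`-lattice in the `A`-module `M / λ M`: a finitely generated `R`-submodule that spans `M / λ M`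
over `A`. -/
structure LatMod (R : Type) [CommRing R] [Algebra R A] (D : Der A) (n : ℕ) extends
    LamMod D n where
  lattice : Submodule R (Red A carrier)
  isLattice : Submodule.IsLattice A lattice

namespace LatMod

variable {R : Type} [CommRing R] [Algebra R A] {D : Der A} {n : ℕ}

/-- Isomorphisms compatible with the `λ`-connections and with the lattices modulo `λ`. -/
@[ext] structure Hom (M N : LatMod R D n) extends LamMod.Hom M.toLamMod N.toLamMod where
  map_lattice : M.lattice.map (Red.map R equiv.toLinearMap) = N.lattice

theorem map_symm {M N : LatMod R D n} (f : Hom M N) :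
    N.lattice.map (Red.map R f.equiv.symm.toLinearMap) = M.lattice := by
  rw [← f.map_lattice, ← Submodule.map_comp]
  convert Submodule.map_id _
  ext x
  obtain ⟨m, rfl⟩ := Red.mk_surjective x
  simp

instance : Groupoid (LatMod R D n) where
  Hom := Hom
  id M := ⟨⟨LinearEquiv.refl _ _, fun _ => rfl⟩, by
    convert Submodule.map_id _
    ext x
    obtain ⟨m, rfl⟩ := Red.mk_surjective x
    rfl⟩
  comp f g := ⟨⟨f.equiv.trans g.equiv, fun s => by simp [f.comm, g.comm]⟩, by
    rw [← g.map_lattice, ← f.map_lattice, ← Submodule.map_comp]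
    congr 1
    ext x
    obtain ⟨m, rfl⟩ := Red.mk_surjective x
    rfl⟩
  inv f := ⟨⟨f.equiv.symm, fun s => by
    rw [LinearEquiv.symm_apply_eq, f.comm, LinearEquiv.apply_symm_apply]⟩, map_symm f⟩
  inv_comp f := by apply Hom.ext; ext s; simp
  comp_inv f := by apply Hom.ext; ext s; simp

end LatMod

end Generic

/-! ### Bases modulo `λ` -/

section Basis

variable {A : Type} [CommRing A] {M : Type} [AddCommGroup M] [Module A⟦X⟧ M]

/-- A basis of `M` over `A⟦λ⟧` induces a basis of `M / λ M` over `A`. -/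
def Red.basis {ι : Type} [Finite ι] (b : Module.Basis ι A⟦X⟧ M) : Module.Basis ι A (Red A M) :=
  haveI := Fintype.ofFinite ι
  Module.Basis.mk (v := fun i => Red.mk A M (b i))
    (by
      rw [Fintype.linearIndependent_iff]
      intro g hg i
      simp only [Red.smul_mk, ← map_sum] at hg
      obtain ⟨m, hm⟩ := Red.mk_eq_zero.1 hg
      have h := congrArg (fun x => PowerSeries.constantCoeff (b.repr x i)) hm
      classical
      simpa [Finsupp.single_apply, apply_ite] using h.symm)
    (by
      rintro x -
      obtain ⟨m, rfl⟩ := Red.mk_surjective x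
      rw [← b.sum_repr m, map_sum]
      refine Submodule.sum_mem _ fun i _ => ?_
      rw [Red.mk_smul]
      exact Submodule.smul_mem _ _ (Submodule.subset_span ⟨i, rfl⟩))

@[simp] theorem Red.basis_apply {ι : Type} [Finite ι] (b : Module.Basis ι A⟦X⟧ M) (i : ι) :
    Red.basis b i = Red.mk A M (b i) := by
  simp [Red.basis]

theorem Red.basis_repr_mk {ι : Type} [Finite ι] (b : Module.Basis ι A⟦X⟧ M) (m : M) (i : ι) :
    (Red.basis b).repr (Red.mk A M m) i = PowerSeries.constantCoeff (b.repr m i) := by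
  have := Fintype.ofFinite ι
  conv_lhs => rw [← b.sum_repr m]
  rw [map_sum, map_sum, Finsupp.finsetSum_apply]
  simp only [Red.mk_smul, ← Red.basis_apply, map_smul, Module.Basis.repr_self]
  classical
  simp [Finsupp.single_apply]

end Basis

/-! ### Extension of scalars -/

section Extend

variable {R A : Type} [CommRing R] [CommRing A] [Algebra R A]
  {DR : Der R} {DA : Der A}

theorem coeffDeriv_algebraMap {u : A}
    (h : ∀ r, DA (algebraMap R A r) = u * algebraMap R A (DR r)) (f : R⟦X⟧) :
    coeffDeriv DA (algebraMap R⟦X⟧ A⟦X⟧ f)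
      = PowerSeries.C u * algebraMap R⟦X⟧ A⟦X⟧ (coeffDeriv DR f) := by
  ext n
  simp [RingHom.algebraMap_toAlgebra, h]

/-- The extension of a `λ`-connection to `A⟦λ⟧ ⊗ M`, where `R⟦λ⟧` acts on `M`:
`∇ (a ⊗ s) = u a ⊗ ∇ s + λ (D a) ⊗ s`. Here the derivation of `A` restricts to `u` times the
derivation of `R`; that is, `u` is the factor that changes the generator of the differentials
used over `R` to the one used over `A`. -/
def extendConn (u : A) (h : ∀ r, DA (algebraMap R A r) = u * algebraMap R A (DR r))
    {M : Type} [AddCommGroup M] [Module R⟦X⟧ M] (c : LambdaConnection DR M) :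
    LambdaConnection DA (A⟦X⟧ ⊗[R⟦X⟧] M) where
  toFun := TensorProduct.liftAddHom
    (AddMonoidHom.mk' (fun a => AddMonoidHom.mk'
        (fun s => (PowerSeries.C u * a) ⊗ₜ[R⟦X⟧] c s
          + ((PowerSeries.X : A⟦X⟧) * coeffDeriv DA a) ⊗ₜ[R⟦X⟧] s)
        (fun s s' => by
          simp only [map_add, TensorProduct.tmul_add]; abel))
      (fun a a' => by
        ext s
        simp only [map_add, mul_add, TensorProduct.add_tmul, AddMonoidHom.mk'_apply,
          AddMonoidHom.add_apply]
        abel))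
    (fun f a s => by
      simp only [AddMonoidHom.mk'_apply]
      rw [c.leibniz, TensorProduct.tmul_add, ← TensorProduct.smul_tmul,
        ← TensorProduct.smul_tmul (R := R⟦X⟧) (_ * _), ← TensorProduct.smul_tmul, add_assoc,
        ← TensorProduct.add_tmul]
      simp only [Algebra.smul_def, coeffDeriv_mul, coeffDeriv_algebraMap h, map_mul]
      have hX : algebraMap R⟦X⟧ A⟦X⟧ PowerSeries.X = PowerSeries.X := by
        simp [RingHom.algebraMap_toAlgebra]
      rw [hX]
      congr 2 <;> ring)
  leibniz f s := by
    induction s using TensorProduct.induction_on with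
    | zero => simp
    | add s t hs ht =>
      simp only [smul_add, map_add, hs, ht]
      abel
    | tmul a s =>
      simp only [TensorProduct.smul_tmul', TensorProduct.liftAddHom_tmul, AddMonoidHom.mk'_apply,
        smul_add, smul_eq_mul, coeffDeriv_mul, mul_add, TensorProduct.add_tmul]
      rw [add_assoc, mul_left_comm f (PowerSeries.C u) a,
        mul_left_comm f PowerSeries.X (coeffDeriv DA a), mul_assoc PowerSeries.X _ a]

theorem extendConn_tmul (u : A) (h : ∀ r, DA (algebraMap R A r) = u * algebraMap R A (DR r))
    {M : Type} [AddCommGroup M] [Module R⟦X⟧ M] (c : LambdaConnection DR M) (a : A⟦X⟧) (s : M) :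
    extendConn u h c (a ⊗ₜ[R⟦X⟧] s) = (PowerSeries.C u * a) ⊗ₜ[R⟦X⟧] c s
      + ((PowerSeries.X : A⟦X⟧) * coeffDeriv DA a) ⊗ₜ[R⟦X⟧] s := rfl

variable (R A) in
/-- The natural map `M / λ M → (A⟦λ⟧ ⊗ M) / λ (A⟦λ⟧ ⊗ M)`. -/
def redExtend (M : Type) [AddCommGroup M] [Module R⟦X⟧ M] :
    Red R M →ₗ[R] Red A (A⟦X⟧ ⊗[R⟦X⟧] M) :=
  Red.desc R (TensorProduct.mk R⟦X⟧ A⟦X⟧ M 1).toAddMonoidHom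
    (fun m => Red.mk_eq_zero.2 ⟨1 ⊗ₜ m, by
      simp only [TensorProduct.smul_tmul', LinearMap.toAddMonoidHom_coe, TensorProduct.mk_apply,
        ← TensorProduct.smul_tmul]
      congr 1
      simp [Algebra.smul_def, RingHom.algebraMap_toAlgebra]⟩)
    (fun r m => by
      rw [Red.smul_mk]
      simp only [TensorProduct.smul_tmul', LinearMap.toAddMonoidHom_coe, TensorProduct.mk_apply,
        ← TensorProduct.smul_tmul]
      congr 2
      simp [Algebra.smul_def, RingHom.algebraMap_toAlgebra])

@[simp] theorem redExtend_mk {M : Type} [AddCommGroup M] [Module R⟦X⟧ M] (m : M) :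
    redExtend R A M (Red.mk R M m) = Red.mk A _ ((1 : A⟦X⟧) ⊗ₜ[R⟦X⟧] m) := rfl

theorem redExtend_isLattice {n : ℕ} {M : Type} [AddCommGroup M] [Module R⟦X⟧ M]
    (b : Module.Basis (Fin n) R⟦X⟧ M) :
    Submodule.IsLattice A (LinearMap.range (redExtend R A M)) where
  fg := by
    have : Module.Finite R (Red R M) := Module.Finite.of_basis (Red.basis b)
    rw [LinearMap.range_eq_map]
    exact Module.Finite.fg_top.map _
  span_eq_top := by
    rw [eq_top_iff, ← (Red.basis (b.baseChange A⟦X⟧)).span_eq, Submodule.span_le]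
    rintro _ ⟨i, rfl⟩
    refine Submodule.subset_span ⟨Red.mk R M (b i), ?_⟩
    simp

/-- Extension of scalars from `R⟦λ⟧` to `A⟦λ⟧`: a module `L` with `λ`-connection goes to
`(A⟦λ⟧ ⊗ L, ∇, L / λ L)`. -/
def extend (u : A) (h : ∀ r, DA (algebraMap R A r) = u * algebraMap R A (DR r)) (n : ℕ) :
    LamMod DR n ⥤ LatMod R DA n where
  obj M :=
    { carrier := A⟦X⟧ ⊗[R⟦X⟧] M.carrier
      free := M.free.map fun b => b.baseChange A⟦X⟧
      conn := extendConn u h M.conn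
      lattice := LinearMap.range (redExtend R A M.carrier)
      isLattice := redExtend_isLattice M.free.some }
  map {M N} f :=
    { equiv := f.equiv.baseChange R⟦X⟧ A⟦X⟧ _ _
      comm := fun s => by
        induction s using TensorProduct.induction_on with
        | zero => simp
        | add s t hs ht => simp only [map_add, hs, ht]
        | tmul a s => simp [extendConn_tmul, f.comm]
      map_lattice := by
        ext x
        constructor
        · rintro ⟨_, ⟨y, rfl⟩, rfl⟩
          obtain ⟨m, rfl⟩ := Red.mk_surjective y
          exact ⟨Red.mk R _ (f.equiv m), by simp⟩
        · rintro ⟨y, rfl⟩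
          obtain ⟨m, rfl⟩ := Red.mk_surjective y
          exact ⟨_, ⟨Red.mk R _ (f.equiv.symm m), rfl⟩, by simp⟩ }
  map_id M := by
    apply LatMod.Hom.ext
    ext s
    induction s using TensorProduct.induction_on with
    | zero => simp
    | add s t hs ht => simp only [map_add, hs, ht]
    | tmul a s => rfl
  map_comp f g := by
    apply LatMod.Hom.ext
    ext s
    induction s using TensorProduct.induction_on with
    | zero => simp
    | add s t hs ht => simp only [map_add, hs, ht]
    | tmul a s => rfl

end Extend

/-! ### Derivations of Laurent series and of quadratic extensions -/

/-- `d/dz` on `ℂ⟦z⟧`. -/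
def ddz : Der ℂ⟦X⟧ :=
  ⟨(PowerSeries.derivative ℂ : ℂ⟦X⟧ →ₗ[ℂ] ℂ⟦X⟧).toAddMonoidHom,
    fun f g => (PowerSeries.derivative ℂ).leibniz f g⟩

theorem ddz_apply (f : ℂ⟦X⟧) : ddz f = PowerSeries.derivative ℂ f := rfl

theorem laurent_theta_coeff (k : ℂ⸨X⸩) (m : ℤ) :
    ((HahnSeries.single 1 1 : ℂ⸨X⸩) * LaurentSeries.derivative ℂ k).coeff m = m * k.coeff m := by
  have := HahnSeries.coeff_single_mul_add (R := ℂ) (r := 1) (x := LaurentSeries.derivative ℂ k)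
    (a := m - 1) (b := (1 : ℤ))
  rw [sub_add_cancel] at this
  rw [this, LaurentSeries.derivative_apply, LaurentSeries.hasseDeriv_coeff]
  simp

theorem laurent_theta_mul (f g : ℂ⸨X⸩) (n : ℤ) :
    n * (f * g).coeff n
      = (f * ((HahnSeries.single 1 1 : ℂ⸨X⸩) * LaurentSeries.derivative ℂ g)).coeff n
      + (((HahnSeries.single 1 1 : ℂ⸨X⸩) * LaurentSeries.derivative ℂ f) * g).coeff n := by
  have hs : ∀ k : ℂ⸨X⸩, ((HahnSeries.single 1 1 : ℂ⸨X⸩) * LaurentSeries.derivative ℂ k).support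
      ⊆ k.support := by
    intro k m hm hk
    exact hm (by rw [laurent_theta_coeff, hk, mul_zero])
  rw [HahnSeries.coeff_mul, HahnSeries.coeff_mul_right' g.isPWO_support (hs g),
    HahnSeries.coeff_mul_left' f.isPWO_support (hs f), ← Finset.sum_add_distrib, Finset.mul_sum]
  refine Finset.sum_congr rfl fun ij hij => ?_
  rw [laurent_theta_coeff, laurent_theta_coeff, ← (Finset.mem_antidiagonal.1 hij).2.2]
  push_cast
  ring

theorem laurent_leibniz (f g : ℂ⸨X⸩) : LaurentSeries.derivative ℂ (f * g)
    = f * LaurentSeries.derivative ℂ g + g * LaurentSeries.derivative ℂ f := by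
  have hz : (HahnSeries.single 1 1 : ℂ⸨X⸩) ≠ 0 := by simp
  apply mul_left_cancel₀ hz
  ext n
  have h1 := laurent_theta_mul f g n
  rw [← laurent_theta_coeff] at h1
  refine h1.trans ?_
  rw [← HahnSeries.coeff_add]
  congr 1
  ring

theorem laurent_derivative_algebraMap (f : ℂ⟦X⟧) :
    LaurentSeries.derivative ℂ (algebraMap ℂ⟦X⟧ ℂ⸨X⸩ f)
      = algebraMap ℂ⟦X⟧ ℂ⸨X⸩ (PowerSeries.derivative ℂ f) := by
  ext n
  rw [LaurentSeries.derivative_apply, LaurentSeries.hasseDeriv_coeff,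
    LaurentSeries.coe_algebraMap, PowerSeries.coeff_coe, PowerSeries.coeff_coe]
  rcases lt_trichotomy n (-1) with hn | rfl | hn
  · rw [if_pos (by push_cast; lia), if_pos (by lia), smul_zero]
  · simp
  · obtain ⟨k, rfl⟩ : ∃ k : ℕ, n = k := ⟨n.toNat, by lia⟩
    rw [if_neg (by push_cast; lia), if_neg (by lia)]
    have : ((k : ℤ) + ((1 : ℕ) : ℤ)).natAbs = k + 1 := by lia
    rw [this, Int.natAbs_natCast, PowerSeries.coeff_derivative]
    simp [mul_comm]

/-- The field `ℂ((z))` of formal Laurent series. -/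
def Lz : Type := ℂ⸨X⸩

instance : Field Lz := inferInstanceAs (Field ℂ⸨X⸩)

instance : Algebra ℂ⟦X⟧ Lz := inferInstanceAs (Algebra ℂ⟦X⟧ ℂ⸨X⸩)

instance : IsFractionRing ℂ⟦X⟧ Lz := inferInstanceAs (IsFractionRing ℂ⟦X⟧ ℂ⸨X⸩)

instance : CharZero Lz :=
  charZero_of_injective_ringHom
    (RingHom.injective ((algebraMap ℂ⟦X⟧ Lz).comp (PowerSeries.C : ℂ →+* ℂ⟦X⟧)))

/-- `d/dz` on `ℂ((z))`. -/
def ddzK : Der Lz :=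
  ⟨(LaurentSeries.derivative ℂ : ℂ⸨X⸩ →ₗ[ℂ] ℂ⸨X⸩).toAddMonoidHom, laurent_leibniz⟩

theorem ddzK_algebraMap (f : ℂ⟦X⟧) :
    ddzK (algebraMap ℂ⟦X⟧ Lz f) = algebraMap ℂ⟦X⟧ Lz (ddz f) :=
  laurent_derivative_algebraMap f

section Quadratic

open QuadraticAlgebra

variable {R : Type} [CommRing R] {a b : R}

/-- The derivation of `R[ω] / (ω² - b ω - a)` which is `c` times the given derivation `D` on `R`
and takes `ω` to `η`. -/
def quadDer (D : Der R) (c η : QuadraticAlgebra R a b)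
    (h : 2 * omega * η = c * (algebraMap R _ (D a) + algebraMap R _ (D b) * omega)
      + algebraMap R _ b * η) : Der (QuadraticAlgebra R a b) :=
  ⟨AddMonoidHom.mk' (fun x => c * (algebraMap R _ (D x.re) + algebraMap R _ (D x.im) * omega)
        + algebraMap R _ x.im * η)
      (fun x y => by simp only [re_add, im_add, map_add]; ring),
    fun x y => by
      simp only [AddMonoidHom.mk'_apply, re_mul, im_mul, map_add, map_mul, Der.leibniz]
      have hx : ∀ x : QuadraticAlgebra R a b,
          x = algebraMap R _ x.re + algebraMap R _ x.im * omega := by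
        intro x; ext <;> simp
      have hw : (omega : QuadraticAlgebra R a b) * omega
          = algebraMap R _ a + algebraMap R _ b * omega := by
        ext <;> simp
      generalize hp : algebraMap R (QuadraticAlgebra R a b) x.re = p at *
      generalize hq : algebraMap R (QuadraticAlgebra R a b) x.im = q at *
      have hx1 := hx x
      have hy1 := hx y
      rw [hp, hq] at hx1
      linear_combination (-(c * (q * algebraMap R _ (D y.im) + algebraMap R _ y.im
        * algebraMap R _ (D x.im)))) * hw - (q * algebraMap R _ y.im) * h
        - (c * (algebraMap R _ (D y.re) + algebraMap R _ (D y.im) * omega)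
          + algebraMap R _ y.im * η) * hx1
        - (c * (algebraMap R _ (D x.re) + algebraMap R _ (D x.im) * omega) + q * η) * hy1⟩

theorem quadDer_apply (D : Der R) (c η : QuadraticAlgebra R a b) (h) (x) :
    quadDer D c η h x = c * (algebraMap R _ (D x.re) + algebraMap R _ (D x.im) * omega)
      + algebraMap R _ x.im * η := rfl

theorem quadDer_algebraMap (D : Der R) (c η : QuadraticAlgebra R a b) (h) (r : R) :
    quadDer D c η h (algebraMap R _ r) = c * algebraMap R _ (D r) := by
  simp [quadDer_apply]

theorem quadDer_omega (D : Der R) (c η : QuadraticAlgebra R a b) (h) :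
    quadDer D c η h omega = η := by
  simp [quadDer_apply]

end Quadratic

/-! ### The spectral curve -/

/-- A smooth ramified spectral curve `ξ² - t(z) ξ + d(z) = 0` in the cotangent bundle of the formal
disc `Spf ℂ⟦z⟧`: the discriminant `t² - 4 d` has a simple zero at `z = 0`. -/
structure SpectralCurve where
  t : ℂ⟦X⟧
  d : ℂ⟦X⟧
  order_disc : (t ^ 2 - 4 * d).order = 1

namespace SpectralCurve

open QuadraticAlgebra

variable (S : SpectralCurve)

/-- The ring of functions `ℂ⟦z⟧[ξ] / (ξ² - t ξ + d)` on the spectral curve. -/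
abbrev O : Type := QuadraticAlgebra ℂ⟦X⟧ (-S.d) S.t

/-- The ring of functions `ℂ((z))[ξ] / (ξ² - t ξ + d)` on the spectral curve with the ramification
point removed. -/
abbrev K : Type :=
  QuadraticAlgebra Lz (-algebraMap ℂ⟦X⟧ Lz S.d) (algebraMap ℂ⟦X⟧ Lz S.t)

/-- The inclusion of functions on the curve into functions on the punctured curve. -/
instance : Algebra S.O S.K :=
  RingHom.toAlgebra
    { toFun := fun x => ⟨algebraMap ℂ⟦X⟧ Lz x.re, algebraMap ℂ⟦X⟧ Lz x.im⟩
      map_zero' := by ext <;> simp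
      map_one' := by ext <;> simp [re_one, im_one]
      map_add' := fun x y => by ext1 <;> simp
      map_mul' := fun x y => by ext1 <;> simp only [re_mul, im_mul, map_add, map_mul, map_neg] }

theorem algebraMap_apply (x : S.O) :
    algebraMap S.O S.K x = ⟨algebraMap ℂ⟦X⟧ Lz x.re, algebraMap ℂ⟦X⟧ Lz x.im⟩ := rfl

/-- The discriminant. -/
def disc : ℂ⟦X⟧ := S.t ^ 2 - 4 * S.d

theorem disc_ne_zero : S.disc ≠ 0 := by
  intro h
  have := S.order_disc
  rw [← disc, h, PowerSeries.order_zero] at this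
  simp at this

theorem ddz_disc_mul_inv : ddz S.disc * (ddz S.disc)⁻¹ = 1 := by
  apply PowerSeries.mul_inv_cancel
  have h := (PowerSeries.order_eq_nat.1 (show S.disc.order = (1 : ℕ) by
    simpa [disc] using S.order_disc)).1
  rw [← PowerSeries.coeff_zero_eq_constantCoeff_apply, ddz_apply, PowerSeries.coeff_derivative]
  simpa using h

theorem ddz_disc : ddz S.disc = 2 * S.t * ddz S.t - 4 * ddz S.d := by
  rw [disc, map_sub, pow_two, Der.leibniz, Der.leibniz, Der.map_ofNat]
  ring

/-- The tautological function `ξ`; the canonical `1`-form on the curve is `μ = ξ dz`. -/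
def xi : S.O := omega

theorem xi_eq : S.xi = omega := rfl

/-- The formal coordinate `z̃ = 2 ξ - t` on the curve, a square root of the discriminant. -/
def zt : S.O := 2 * S.xi - algebraMap ℂ⟦X⟧ S.O S.t

theorem xi_sq : S.xi ^ 2 = algebraMap _ S.O S.t * S.xi - algebraMap _ S.O S.d := by
  ext <;> simp [xi, pow_two]

theorem zt_sq : S.zt ^ 2 = algebraMap ℂ⟦X⟧ S.O S.disc := by
  have := S.xi_sq
  simp only [zt, disc, map_sub, map_mul, map_pow, map_ofNat]
  linear_combination 4 * this

/-- The derivation `d/dz̃` of `O`. On functions of `z` it is `(dz/dz̃) d/dz`, where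
`dz/dz̃ = 2 z̃ / (t² - 4 d)'`, and on `ξ` it is dictated by the equation of the curve. -/
def ddzt : Der S.O :=
  quadDer ddz (2 * S.zt * algebraMap ℂ⟦X⟧ S.O (ddz S.disc)⁻¹)
    (2 * algebraMap ℂ⟦X⟧ S.O (ddz S.disc)⁻¹
      * (algebraMap ℂ⟦X⟧ S.O (ddz S.t) * S.xi - algebraMap ℂ⟦X⟧ S.O (ddz S.d)))
    (by
      simp only [zt, xi, map_neg]
      ring)

theorem ddzt_algebraMap (f : ℂ⟦X⟧) : S.ddzt (algebraMap ℂ⟦X⟧ S.O f)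
    = 2 * S.zt * algebraMap ℂ⟦X⟧ S.O (ddz S.disc)⁻¹ * algebraMap ℂ⟦X⟧ S.O (ddz f) :=
  quadDer_algebraMap _ _ _ _ _

theorem ddzt_xi : S.ddzt S.xi = 2 * algebraMap ℂ⟦X⟧ S.O (ddz S.disc)⁻¹
    * (algebraMap ℂ⟦X⟧ S.O (ddz S.t) * S.xi - algebraMap ℂ⟦X⟧ S.O (ddz S.d)) :=
  quadDer_omega _ _ _ _

theorem ddzt_zt : S.ddzt S.zt = 1 := by
  have h := congrArg (algebraMap ℂ⟦X⟧ S.O) S.ddz_disc_mul_inv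
  have e : S.ddzt S.zt = 2 * S.ddzt S.xi - S.ddzt (algebraMap ℂ⟦X⟧ S.O S.t) := by
    rw [zt, map_sub, Der.leibniz, Der.map_ofNat]; ring
  rw [map_mul, S.ddz_disc, map_sub, map_mul, map_mul, map_mul, ← S.ddz_disc] at h
  simp only [map_ofNat, map_one] at h
  rw [e, S.ddzt_algebraMap, S.ddzt_xi, zt]
  linear_combination h

theorem algebraMap_O_K (f : ℂ⟦X⟧) : algebraMap S.O S.K (algebraMap ℂ⟦X⟧ S.O f)
    = algebraMap Lz S.K (algebraMap ℂ⟦X⟧ Lz f) := by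
  rw [S.algebraMap_apply]
  ext1
  · rfl
  · exact map_zero _

theorem algebraMap_xi : algebraMap S.O S.K S.xi = omega := by
  rw [S.algebraMap_apply]
  ext1
  · exact map_zero _
  · exact map_one _

theorem algebraMap_disc_mul_inv :
    algebraMap Lz S.K (algebraMap ℂ⟦X⟧ Lz S.disc)
      * algebraMap Lz S.K (algebraMap ℂ⟦X⟧ Lz S.disc)⁻¹ = 1 := by
  rw [← map_mul, mul_inv_cancel₀, map_one]
  intro h
  exact S.disc_ne_zero (IsFractionRing.injective ℂ⟦X⟧ Lz (by rw [h, map_zero]))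

theorem algebraMap_zt_sq : algebraMap S.O S.K S.zt * algebraMap S.O S.K S.zt
    = algebraMap Lz S.K (algebraMap ℂ⟦X⟧ Lz S.disc) := by
  rw [← map_mul, ← pow_two, S.zt_sq, algebraMap_O_K]

theorem algebraMap_zt : algebraMap S.O S.K S.zt
    = 2 * omega - algebraMap Lz S.K (algebraMap ℂ⟦X⟧ Lz S.t) := by
  rw [zt, map_sub, map_mul, map_ofNat, algebraMap_O_K, algebraMap_xi]

/-- The derivation `d/dz` of the ring of functions on the punctured curve: it is the derivation
`d/dz` on `ℂ((z))`, and on `ξ` it is dictated by the equation of the curve,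
`(2 ξ - t) ξ' = t' ξ - d'`. -/
def ddzS : Der S.K :=
  quadDer ddzK 1
    (algebraMap Lz S.K (algebraMap ℂ⟦X⟧ Lz S.disc)⁻¹ * algebraMap S.O S.K S.zt
      * (algebraMap Lz S.K (ddzK (algebraMap ℂ⟦X⟧ Lz S.t)) * omega
        - algebraMap Lz S.K (ddzK (algebraMap ℂ⟦X⟧ Lz S.d))))
    (by
      rw [map_neg, map_neg]
      linear_combination
        (algebraMap Lz S.K (ddzK (algebraMap ℂ⟦X⟧ Lz S.t)) * omega
          - algebraMap Lz S.K (ddzK (algebraMap ℂ⟦X⟧ Lz S.d))) * S.algebraMap_disc_mul_inv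
        + (algebraMap Lz S.K (algebraMap ℂ⟦X⟧ Lz S.disc)⁻¹)
          * (algebraMap Lz S.K (ddzK (algebraMap ℂ⟦X⟧ Lz S.t)) * omega
          - algebraMap Lz S.K (ddzK (algebraMap ℂ⟦X⟧ Lz S.d))) * S.algebraMap_zt_sq
        - (algebraMap Lz S.K (algebraMap ℂ⟦X⟧ Lz S.disc)⁻¹ * algebraMap S.O S.K S.zt
          * (algebraMap Lz S.K (ddzK (algebraMap ℂ⟦X⟧ Lz S.t)) * omega
          - algebraMap Lz S.K (ddzK (algebraMap ℂ⟦X⟧ Lz S.d)))) * S.algebraMap_zt)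

theorem ddzS_algebraMap (f : Lz) :
    S.ddzS (algebraMap Lz S.K f) = algebraMap Lz S.K (ddzK f) := by
  rw [ddzS, quadDer_algebraMap, one_mul]

theorem ddzS_xi : S.ddzS omega = algebraMap Lz S.K (algebraMap ℂ⟦X⟧ Lz S.disc)⁻¹
    * algebraMap S.O S.K S.zt * (algebraMap Lz S.K (ddzK (algebraMap ℂ⟦X⟧ Lz S.t)) * omega
      - algebraMap Lz S.K (ddzK (algebraMap ℂ⟦X⟧ Lz S.d))) :=
  quadDer_omega _ _ _ _

/-- The logarithmic derivation `z̃ d/dz̃` of `O`, dual to the generator `z̃⁻¹ dz̃` of the module of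
differentials with a first order pole at `z̃ = 0`. -/
def theta : Der S.O := S.ddzt.mul S.zt

/-- The factor `(z̃⁻¹ dz̃) / dz = (t² - 4 d)' / (2 (t² - 4 d))`. -/
def logFactor : S.K :=
  algebraMap Lz S.K (algebraMap ℂ⟦X⟧ Lz (ddz S.disc) / (2 * algebraMap ℂ⟦X⟧ Lz S.disc))

theorem ddzS_algebraMap_O (x : S.O) :
    S.ddzS (algebraMap S.O S.K x) = S.logFactor * algebraMap S.O S.K (S.theta x) := by
  have hx : x = algebraMap ℂ⟦X⟧ S.O x.re + algebraMap ℂ⟦X⟧ S.O x.im * S.xi := by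
    rw [xi_eq]; ext <;> simp
  set Δ := algebraMap Lz S.K (algebraMap ℂ⟦X⟧ Lz S.disc) with hΔ
  set Δi := algebraMap Lz S.K (algebraMap ℂ⟦X⟧ Lz S.disc)⁻¹ with hΔi
  set e := algebraMap Lz S.K (algebraMap ℂ⟦X⟧ Lz (ddz S.disc)) with he
  set ei := algebraMap Lz S.K (algebraMap ℂ⟦X⟧ Lz (ddz S.disc)⁻¹) with hei
  have h1 : Δ * Δi = 1 := S.algebraMap_disc_mul_inv
  have h2 : e * ei = 1 := by
    rw [he, hei, ← map_mul, ← map_mul, S.ddz_disc_mul_inv, map_one, map_one]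
  have h3 : S.logFactor * 2 = e * Δi := by
    rw [logFactor, he, hΔi, ← map_mul, ← map_ofNat (algebraMap Lz S.K) 2, ← map_mul]
    congr 1
    rw [div_mul_eq_mul_div, mul_comm 2 (algebraMap ℂ⟦X⟧ Lz S.disc),
      mul_div_mul_right _ _ two_ne_zero, div_eq_mul_inv]
  have h4 := S.algebraMap_zt_sq
  have hC : ∀ f : ℂ⟦X⟧, S.ddzS (algebraMap S.O S.K (algebraMap ℂ⟦X⟧ S.O f))
      = S.logFactor * algebraMap S.O S.K (S.theta (algebraMap ℂ⟦X⟧ S.O f)) := by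
    intro f
    rw [theta, Der.mul_apply, S.ddzt_algebraMap]
    simp only [map_mul, map_ofNat, algebraMap_O_K, ddzS_algebraMap, ddzK_algebraMap]
    rw [← hei]
    generalize algebraMap Lz S.K (algebraMap ℂ⟦X⟧ Lz (ddz f)) = F
    linear_combination (-(algebraMap S.O S.K S.zt * algebraMap S.O S.K S.zt * ei * F)) * h3
      - (e * Δi * ei * F) * h4 - (e * ei * F) * h1 - F * h2
  have hxi : S.ddzS (algebraMap S.O S.K S.xi)
      = S.logFactor * algebraMap S.O S.K (S.theta S.xi) := by
    rw [theta, Der.mul_apply, S.ddzt_xi]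
    simp only [map_mul, map_sub, map_ofNat, algebraMap_O_K, algebraMap_xi, ddzS_xi,
      ddzK_algebraMap]
    rw [← hei]
    generalize algebraMap Lz S.K (algebraMap ℂ⟦X⟧ Lz (ddz S.t)) * omega
      - algebraMap Lz S.K (algebraMap ℂ⟦X⟧ Lz (ddz S.d)) = Y
    linear_combination (-(algebraMap S.O S.K S.zt * ei * Y)) * h3
      - (Δi * algebraMap S.O S.K S.zt * Y) * h2
  rw [hx, map_add, map_add, map_add, map_add, map_mul, Der.leibniz, Der.leibniz, hC, hC, hxi,
    map_add, map_mul, map_mul]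
  ring

end SpectralCurve

section ExtendReduction

variable {R A : Type} [CommRing R] [CommRing A] [Algebra R A] {DR : Der R} {DA : Der A}

theorem extendConn_red_redExtend (u : A)
    (h : ∀ r, DA (algebraMap R A r) = u * algebraMap R A (DR r))
    {M : Type} [AddCommGroup M] [Module R⟦X⟧ M] (c : LambdaConnection DR M) (x : Red R M) :
    (extendConn u h c).red A (redExtend R A M x) = u • redExtend R A M (c.red R x) := by
  obtain ⟨m, rfl⟩ := Red.mk_surjective x
  rw [redExtend_mk, LambdaConnection.red_mk, LambdaConnection.red_mk, redExtend_mk,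
    extendConn_tmul, coeffDeriv_one, mul_zero, TensorProduct.zero_tmul, add_zero, Red.smul_mk,
    TensorProduct.smul_tmul', smul_eq_mul]
  rfl

theorem redExtend_basis {ι : Type} [Finite ι] {M : Type} [AddCommGroup M] [Module R⟦X⟧ M]
    (b : Module.Basis ι R⟦X⟧ M) (i : ι) :
    Red.basis (b.baseChange A⟦X⟧) i = redExtend R A M (Red.basis b i) := by
  simp

theorem redExtend_repr {ι : Type} [Finite ι] {M : Type} [AddCommGroup M] [Module R⟦X⟧ M]
    (b : Module.Basis ι R⟦X⟧ M) (x : Red R M) (i : ι) :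
    (Red.basis (b.baseChange A⟦X⟧)).repr (redExtend R A M x) i
      = algebraMap R A ((Red.basis b).repr x i) := by
  obtain ⟨m, rfl⟩ := Red.mk_surjective x
  rw [redExtend_mk, Red.basis_repr_mk, Red.basis_repr_mk, Module.Basis.baseChange_repr_tmul,
    Algebra.smul_def, mul_one, ← PowerSeries.coeff_zero_eq_constantCoeff_apply,
    ← PowerSeries.coeff_zero_eq_constantCoeff_apply]
  exact PowerSeries.coeff_map (algebraMap R A) 0 _

theorem redExtend_smul {M : Type} [AddCommGroup M] [Module R⟦X⟧ M] (r : R) (x : Red R M) :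
    redExtend R A M (r • x) = algebraMap R A r • redExtend R A M x := by
  rw [map_smul, algebraMap_smul]

theorem extendConn_toMatrix (h : ∀ r, DA (algebraMap R A r) = 1 * algebraMap R A (DR r))
    {ι : Type} [Fintype ι] [DecidableEq ι]
    {M : Type} [AddCommGroup M] [Module R⟦X⟧ M] (b : Module.Basis ι R⟦X⟧ M)
    (c : LambdaConnection DR M) :
    LinearMap.toMatrix (Red.basis (b.baseChange A⟦X⟧)) (Red.basis (b.baseChange A⟦X⟧))
        ((extendConn 1 h c).red A)
      = (LinearMap.toMatrix (Red.basis b) (Red.basis b) (c.red R)).map (algebraMap R A) := by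
  ext i j
  rw [LinearMap.toMatrix_apply, Matrix.map_apply, LinearMap.toMatrix_apply, redExtend_basis,
    extendConn_red_redExtend, one_smul, redExtend_repr]

theorem extendConn_trace (h : ∀ r, DA (algebraMap R A r) = 1 * algebraMap R A (DR r)) {n : ℕ}
    {M : Type} [AddCommGroup M] [Module R⟦X⟧ M] (b : Module.Basis (Fin n) R⟦X⟧ M)
    (c : LambdaConnection DR M) :
    LinearMap.trace A _ ((extendConn 1 h c).red A)
      = algebraMap R A (LinearMap.trace R _ (c.red R)) := by
  rw [LinearMap.trace_eq_matrix_trace A (Red.basis (b.baseChange A⟦X⟧)), extendConn_toMatrix,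
    LinearMap.trace_eq_matrix_trace R (Red.basis b), Matrix.trace, Matrix.trace, map_sum]
  rfl

theorem extendConn_det (h : ∀ r, DA (algebraMap R A r) = 1 * algebraMap R A (DR r)) {n : ℕ}
    {M : Type} [AddCommGroup M] [Module R⟦X⟧ M] (b : Module.Basis (Fin n) R⟦X⟧ M)
    (c : LambdaConnection DR M) :
    LinearMap.det ((extendConn 1 h c).red A) = algebraMap R A (LinearMap.det (c.red R)) := by
  rw [← LinearMap.det_toMatrix (Red.basis (b.baseChange A⟦X⟧)), extendConn_toMatrix,
    ← LinearMap.det_toMatrix (Red.basis b), RingHom.map_det]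
  rfl

end ExtendReduction

/-! ### The groupoids attached to a spectral curve -/

namespace SpectralCurve

open QuadraticAlgebra

variable (S : SpectralCurve)

/-- `(L, ∇)` has a Higgs field `∇₀` on `L / λ L` with `tr ∇₀ = t dz` and `det ∇₀ = d (dz)²`. -/
def IsConn : ObjectProperty (LamMod ddz 2) := fun M =>
  LinearMap.trace ℂ⟦X⟧ (Red ℂ⟦X⟧ M.carrier) (M.conn.red ℂ⟦X⟧) = S.t ∧
    LinearMap.det (M.conn.red ℂ⟦X⟧) = S.d

/-- The groupoid of pairs `(L, ∇)`: `L` is a free module of rank `2` over `ℂ⟦z, λ⟧` and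
`∇ : L → L dz` is a `λ`-connection whose reduction modulo `λ` has the given spectral curve. -/
abbrev Conn : Type 1 := S.IsConn.FullSubcategory

/-- `(L_u, ∇, L₀)` has a Higgs field `∇₀` on `L_u / λ L_u` with `tr ∇₀ = t dz` and
`det ∇₀ = d (dz)²`, and `∇₀ (L₀) ⊆ L₀ dz`. -/
def IsCC : ObjectProperty (LatMod ℂ⟦X⟧ ddzK 2) := fun M =>
  LinearMap.trace Lz (Red Lz M.carrier) (M.conn.red Lz) = algebraMap ℂ⟦X⟧ Lz S.t ∧
    LinearMap.det (M.conn.red Lz) = algebraMap ℂ⟦X⟧ Lz S.d ∧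
    ∀ x ∈ M.lattice, M.conn.red Lz x ∈ M.lattice

/-- The groupoid of triples `(L_u, ∇, L₀)`: `L_u` is a free module of rank `2` over `ℂ((z))⟦λ⟧`,
`∇ : L_u → L_u dz` is a `λ`-connection whose reduction modulo `λ` has the given punctured spectral
curve, and `L₀` is a `ℂ⟦z⟧`-lattice in `L_u / λ L_u` that is preserved by the Higgs field. -/
abbrev CC : Type 1 := S.IsCC.FullSubcategory

/-- The conditions on `δ : l → z̃⁻¹ l dz̃`, written as `δ s = (E s) z̃⁻¹ dz̃`: the reduction of `δ`
modulo `λ` is multiplication by the form `μ = ξ dz = z̃ (dz/dz̃) ξ · z̃⁻¹ dz̃`, and the residue of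
`δ`, which is the map `l / z̃ l → l / z̃ l` induced by `E`, equals `-λ/2`. -/
def IsTConn : ObjectProperty (LamMod S.theta 1) := fun M =>
  (∀ x : Red S.O M.carrier, M.conn.red S.O x
    = (S.zt * S.ddzt (algebraMap ℂ⟦X⟧ S.O PowerSeries.X) * S.xi) • x) ∧
  ∀ s : M.carrier, ∃ s' : M.carrier, M.conn s
    = -((PowerSeries.C (algebraMap ℂ S.O (1 / 2)) * PowerSeries.X : S.O⟦X⟧) • s)
      + PowerSeries.C S.zt • s'

/-- The groupoid of pairs `(l, δ)`: `l` is a free module of rank `1` over `O⟦λ⟧ = ℂ⟦z̃, λ⟧`, and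
`δ : l → z̃⁻¹ l dz̃` is a `λ`-connection with residue `-λ/2` and with reduction `μ` modulo `λ`. -/
abbrev TConn : Type 1 := S.IsTConn.FullSubcategory

/-- The reduction modulo `λ` of `δ : l_u → l_u dz` is multiplication by `μ = ξ dz`. -/
def IsTCC : ObjectProperty (LatMod S.O S.ddzS 1) := fun M =>
  ∀ x : Red S.K M.carrier, M.conn.red S.K x = algebraMap S.O S.K S.xi • x

/-- The groupoid of triples `(l_u, δ, l₀)`: `l_u` is a free module of rank `1` over
`K⟦λ⟧ = ℂ((z̃))⟦λ⟧`, `δ : l_u → l_u dz = l_u dz̃` is a `λ`-connection with reduction `μ` modulo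
`λ`, and `l₀` is an `O`-lattice in `l_u / λ l_u`. -/
abbrev TCC : Type 1 := S.IsTCC.FullSubcategory

/-! ### The functors -/

theorem _root_.LambdaConn.ddzK_algebraMap' (f : ℂ⟦X⟧) :
    ddzK (algebraMap ℂ⟦X⟧ Lz f) = 1 * algebraMap ℂ⟦X⟧ Lz (ddz f) := by
  rw [one_mul, ddzK_algebraMap]

theorem isCC_extend (M : LamMod ddz 2) (hM : S.IsConn M) :
    S.IsCC ((extend 1 ddzK_algebraMap' 2 :
      LamMod ddz 2 ⥤ LatMod ℂ⟦X⟧ ddzK 2).obj M) := by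
  refine ⟨?_, ?_, ?_⟩
  · rw [← hM.1]
    exact extendConn_trace ddzK_algebraMap' M.free.some M.conn
  · rw [← hM.2]
    exact extendConn_det ddzK_algebraMap' M.free.some M.conn
  · rintro _ ⟨x, rfl⟩
    exact ⟨M.conn.red ℂ⟦X⟧ x, by
      have := extendConn_red_redExtend (DA := ddzK) 1
        ddzK_algebraMap' M.conn x
      rw [one_smul] at this
      exact this.symm⟩

/-- The natural functor `(L, ∇) ↦ (ℂ((z))⟦λ⟧ ⊗ L, ∇, L / λ L)`. -/
def connToCC : S.Conn ⥤ S.CC :=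
  S.IsCC.lift (S.IsConn.ι ⋙ extend 1 ddzK_algebraMap' 2)
    fun M => S.isCC_extend M.obj M.property

theorem isTCC_extend (M : LamMod S.theta 1) (hM : S.IsTConn M) :
    S.IsTCC ((extend S.logFactor S.ddzS_algebraMap_O 1 :
      LamMod S.theta 1 ⥤ LatMod S.O S.ddzS 1).obj M) := by
  have key : S.logFactor * algebraMap S.O S.K
      (S.zt * S.ddzt (algebraMap ℂ⟦X⟧ S.O PowerSeries.X) * S.xi) = algebraMap S.O S.K S.xi := by
    have h := S.ddzS_algebraMap_O (algebraMap ℂ⟦X⟧ S.O PowerSeries.X)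
    rw [algebraMap_O_K, ddzS_algebraMap, ddzK_algebraMap, ddz_apply, PowerSeries.derivative_X,
      map_one, map_one] at h
    rw [map_mul, ← mul_assoc]
    rw [theta, Der.mul_apply] at h
    rw [← h, one_mul]
  have hb := (Red.basis (M.free.some.baseChange S.K⟦X⟧)).ext
    (f₁ := (extendConn S.logFactor S.ddzS_algebraMap_O M.conn).red S.K)
    (f₂ := LinearMap.lsmul S.K _ (algebraMap S.O S.K S.xi)) (fun i => by
      rw [redExtend_basis, extendConn_red_redExtend, hM.1, redExtend_smul, smul_smul, key]
      rfl)
  intro x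
  exact LinearMap.congr_fun hb x

/-- The natural functor `(l, δ) ↦ (ℂ((z̃))⟦λ⟧ ⊗ l, δ, l / λ l)`. -/
def tConnToTCC : S.TConn ⥤ S.TCC :=
  S.IsTCC.lift (S.IsTConn.ι ⋙ extend S.logFactor S.ddzS_algebraMap_O 1)
    fun M => S.isTCC_extend M.obj M.property

end SpectralCurve

/-! ### Restriction of scalars -/

section Restrict

variable {A B : Type} [CommRing A] [CommRing B] [Algebra A B]

/-- A basis of `B` over `A` induces a basis of `B⟦λ⟧` over `A⟦λ⟧`. -/
def powerSeriesBasis {ι : Type} [Finite ι] (β : Module.Basis ι A B) :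
    Module.Basis ι A⟦X⟧ B⟦X⟧ :=
  letI := Fintype.ofFinite ι
  Module.Basis.ofEquivFun
    { toFun := fun f i => PowerSeries.mk fun n => β.equivFun (PowerSeries.coeff n f) i
      invFun := fun v => PowerSeries.mk fun n =>
        β.equivFun.symm fun i => PowerSeries.coeff n (v i)
      map_add' := fun f g => by ext i n; simp
      map_smul' := fun c f => by
        ext i n
        rw [Algebra.smul_def, RingHom.algebraMap_toAlgebra]
        simp only [PowerSeries.coeff_mk, PowerSeries.coeff_mul, PowerSeries.coeff_map,
          ← Algebra.smul_def, map_sum, map_smul, Finset.sum_apply, Pi.smul_apply, smul_eq_mul,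
          RingHom.id_apply]
      left_inv := fun f => by ext n; simp
      right_inv := fun v => by
        ext i n
        simp only [PowerSeries.coeff_mk, LinearEquiv.apply_symm_apply] }

/-- A `B⟦λ⟧`-module `l`, considered as a module over `A⟦λ⟧`. -/
def Res (_A _B l : Type) : Type := l

variable (l : Type) [AddCommGroup l] [Module B⟦X⟧ l]

instance : AddCommGroup (Res A B l) := inferInstanceAs (AddCommGroup l)

instance Res.moduleTop : Module B⟦X⟧ (Res A B l) := inferInstanceAs (Module B⟦X⟧ l)

instance Res.module : Module A⟦X⟧ (Res A B l) :=
  Module.compHom l (algebraMap A⟦X⟧ B⟦X⟧)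

theorem Res.smul_def (a : A⟦X⟧) (x : Res A B l) : a • x = algebraMap A⟦X⟧ B⟦X⟧ a • x := rfl

instance : IsScalarTower A⟦X⟧ B⟦X⟧ (Res A B l) where
  smul_assoc a b x := by
    rw [Algebra.smul_def, mul_smul, Res.smul_def]

variable {l}

/-- A basis of the restriction of scalars of a module of rank one. -/
def resBasis {n : ℕ} (β : Module.Basis (Fin n) A B) (b : Module.Basis (Fin 1) B⟦X⟧ l) :
    Module.Basis (Fin n) A⟦X⟧ (Res A B l) :=
  let b' : Module.Basis (Fin 1) B⟦X⟧ (Res A B l) := b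
  ((powerSeriesBasis β).smulTower b').reindex (Equiv.prodUnique (Fin n) (Fin 1))

theorem algebraMap_X : algebraMap A⟦X⟧ B⟦X⟧ PowerSeries.X = PowerSeries.X := by
  simp [RingHom.algebraMap_toAlgebra]

theorem algebraMap_C (a : A) :
    algebraMap A⟦X⟧ B⟦X⟧ (PowerSeries.C a) = PowerSeries.C (algebraMap A B a) := by
  simp [RingHom.algebraMap_toAlgebra]

theorem Res.X_smul (x : Res A B l) :
    (PowerSeries.X : A⟦X⟧) • x = (PowerSeries.X : B⟦X⟧) • x := by
  rw [Res.smul_def, algebraMap_X]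

/-- A `λ`-connection over `B`, considered as a `λ`-connection over `A`. -/
def resConn {DA : Der A} {DB : Der B} (h : ∀ a, DB (algebraMap A B a) = algebraMap A B (DA a))
    (c : LambdaConnection DB l) : LambdaConnection DA (Res A B l) where
  toFun := c.toFun
  leibniz f s := by
    rw [Res.smul_def, Res.smul_def, Res.smul_def, map_mul, algebraMap_X]
    refine (c.leibniz _ s).trans ?_
    rw [coeffDeriv_algebraMap (u := 1) (DR := DA) (fun r => by rw [h, one_mul]), map_one, one_mul]
    rfl

variable (A) in
/-- Restriction of scalars does not change the reduction modulo `λ`. -/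
def resRed (R : Type) [CommRing R] [Algebra R A] [Algebra R B] [IsScalarTower R A B]
    (l : Type) [AddCommGroup l] [Module B⟦X⟧ l] : Red B l ≃ₗ[R] Red A (Res A B l) :=
  LinearEquiv.ofLinearMap
    (Red.desc R (N := Res A B l) (AddMonoidHom.id l)
      (fun m => Red.mk_eq_zero.2 ⟨m, Res.X_smul m⟩)
      (fun r m => by
        rw [Red.smul_mk, Res.smul_def, algebraMap_C, ← IsScalarTower.algebraMap_apply]; rfl))
    (Red.desc R (M := Res A B l) (N := l) (AddMonoidHom.id l)
      (fun m => Red.mk_eq_zero.2 ⟨m, (Res.X_smul (l := l) m).symm⟩)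
      (fun r (m : Res A B l) => by
        rw [Red.smul_mk, Res.smul_def (l := l) _ m, algebraMap_C,
          ← IsScalarTower.algebraMap_apply]; rfl))
    (by ext x; obtain ⟨m, rfl⟩ := Red.mk_surjective x; rfl)
    (by ext x; obtain ⟨m, rfl⟩ := Red.mk_surjective x; rfl)

theorem resRed_mk {R : Type} [CommRing R] [Algebra R A] [Algebra R B] [IsScalarTower R A B]
    (m : l) : resRed A R l (Red.mk B l m) = Red.mk A (Res A B l) m := rfl

theorem resConn_red {DA : Der A} {DB : Der B}
    (h : ∀ a, DB (algebraMap A B a) = algebraMap A B (DA a))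
    (c : LambdaConnection DB l) (x : Red B l) :
    (resConn h c).red A (resRed A A l x) = resRed A A l (c.red B x) := by
  obtain ⟨m, rfl⟩ := Red.mk_surjective x
  rfl

theorem powerSeriesBasis_apply {ι : Type} [Finite ι] (β : Module.Basis ι A B) (i : ι) :
    powerSeriesBasis β i = PowerSeries.C (β i) := by
  classical
  let _ := Fintype.ofFinite ι
  rw [powerSeriesBasis, Module.Basis.coe_ofEquivFun]
  ext n
  simp only [LinearEquiv.coe_symm_mk', PowerSeries.coeff_mk, PowerSeries.coeff_C]
  split_ifs with h
  · subst h
    simp [Pi.single_apply, apply_ite]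
  · simp [Pi.single_apply, apply_ite, PowerSeries.coeff_one, h]

theorem red_resBasis {n : ℕ} (β : Module.Basis (Fin n) A B) (b : Module.Basis (Fin 1) B⟦X⟧ l)
    (i : Fin n) : Red.basis (resBasis β b) i = resRed A A l (β i • Red.mk B l (b 0)) := by
  have h : resBasis β b i = (powerSeriesBasis β i : B⟦X⟧) • (b 0 : Res A B l) := by
    simp only [resBasis, Module.Basis.reindex_apply]
    exact Module.Basis.smulTower_apply _ _ _
  rw [Red.basis_apply, h, powerSeriesBasis_apply, Red.smul_mk, resRed_mk]
  rfl

/-- A lattice over a finite extension of the coefficient ring is a lattice over the coefficient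
ring. -/
theorem isLattice_restrict {R R' : Type} [CommRing R] [CommRing R'] [Algebra R R'] [Algebra R A]
    [Algebra R' B] [Algebra R B] [IsScalarTower R A B] [IsScalarTower R R' B] [Module.Finite R R']
    (hspan : Submodule.span A (Set.range (algebraMap R' B)) = ⊤)
    (L : Submodule R' (Red B l)) (hL : Submodule.IsLattice B L) :
    Submodule.IsLattice A
      ((L.restrictScalars R).map (resRed A R l).toLinearMap) where
  fg := by
    have : Module.Finite R' L := Module.Finite.iff_fg.2 hL.fg
    have : Module.Finite R L := Module.Finite.trans R' L
    have : (L.restrictScalars R).FG := Module.Finite.iff_fg.1 this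
    exact this.map _
  span_eq_top := by
    have key : Submodule.span A (L : Set (Red B l)) = ⊤ := by
      rw [eq_top_iff]
      rintro x -
      have hx : x ∈ Submodule.span B (L : Set (Red B l)) := by rw [hL.span_eq_top]; trivial
      induction hx using Submodule.span_induction with
      | mem x hx => exact Submodule.subset_span hx
      | zero => exact zero_mem _
      | add x y _ _ hx hy => exact add_mem hx hy
      | smul b x hx' hx =>
        clear hx'
        have hx' := hx
        have hb : b ∈ Submodule.span A (Set.range (algebraMap R' B)) := by rw [hspan]; trivial
        induction hb using Submodule.span_induction with
        | zero => rw [zero_smul]; exact zero_mem _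
        | add b b' _ _ hb hb' => rw [add_smul]; exact add_mem hb hb'
        | smul a b _ hb => rw [smul_assoc]; exact Submodule.smul_mem _ _ hb
        | mem b hb =>
          obtain ⟨r, rfl⟩ := hb
          rw [algebraMap_smul]
          clear hx
          induction hx' using Submodule.span_induction with
          | mem x hx => exact Submodule.subset_span (L.smul_mem r hx)
          | zero => rw [smul_zero]; exact zero_mem _
          | add x y _ _ hx hy => rw [smul_add]; exact add_mem hx hy
          | smul a x _ hx =>
            rw [← algebraMap_smul B r, smul_comm, algebraMap_smul]
            exact Submodule.smul_mem _ _ hx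
    rw [eq_top_iff]
    rintro y -
    obtain ⟨x, rfl⟩ := (resRed A A l).surjective y
    have hx : x ∈ Submodule.span A (L : Set (Red B l)) := by rw [key]; trivial
    induction hx using Submodule.span_induction with
    | mem x hx =>
      refine Submodule.subset_span ⟨x, hx, ?_⟩
      obtain ⟨m, rfl⟩ := Red.mk_surjective x
      rfl
    | zero => rw [map_zero]; exact zero_mem _
    | add x y _ _ hx hy => rw [map_add]; exact add_mem hx hy
    | smul a x _ hx => rw [map_smul]; exact Submodule.smul_mem _ _ hx

end Restrict

/-! ### Direct image along the projection of the punctured spectral curve -/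

section

open QuadraticAlgebra

/-- The direct image of multiplication by `ω` on a module of rank one has the trace and the
determinant given by the equation `ω² = a + b ω`. -/
theorem res_trace_det {A : Type} [CommRing A] {a b : A} {DA : Der A}
    {DB : Der (QuadraticAlgebra A a b)} (h : ∀ x, DB (algebraMap A _ x) = algebraMap A _ (DA x))
    {l : Type} [AddCommGroup l] [Module (QuadraticAlgebra A a b)⟦X⟧ l]
    (e : Module.Basis (Fin 1) (QuadraticAlgebra A a b)⟦X⟧ l) (c : LambdaConnection DB l)
    (hc : ∀ x, c.red (QuadraticAlgebra A a b) x = (omega : QuadraticAlgebra A a b) • x) :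
    LinearMap.trace A _ ((resConn h c).red A) = b ∧ LinearMap.det ((resConn h c).red A) = -a := by
  let β := QuadraticAlgebra.basis a b
  let v := Red.basis (resBasis β e)
  have hβ0 : β 0 = 1 := β.repr.injective (by
    rw [Module.Basis.repr_self]; ext i; fin_cases i <;> simp [β, re_one, im_one])
  have hβ1 : β 1 = omega := β.repr.injective (by
    rw [Module.Basis.repr_self]; ext i; fin_cases i <;> simp [β])
  have hv : ∀ i, v i = resRed A A l (β i • Red.mk _ l (e 0)) := red_resBasis β e
  have hcv : ∀ i, (resConn h c).red A (v i)
      = resRed A A l ((omega * β i) • Red.mk _ l (e 0)) := by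
    intro i
    rw [hv, resConn_red, hc, smul_smul]
  have h0 : (resConn h c).red A (v 0) = v 1 := by rw [hcv, hv, hβ0, hβ1, mul_one]
  have h1 : (resConn h c).red A (v 1) = a • v 0 + b • v 1 := by
    rw [hcv, hv, hv, hβ0, hβ1]
    generalize Red.mk (QuadraticAlgebra A a b) l (e 0) = y
    have hw : (omega * omega : QuadraticAlgebra A a b) = a • 1 + b • omega := by
      ext <;> simp [re_one, im_one]
    rw [hw, add_smul, smul_assoc, smul_assoc, one_smul, map_add, map_smul, map_smul]
  have hm : LinearMap.toMatrix v v ((resConn h c).red A) = !![0, a; 1, b] := by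
    ext i j
    rw [LinearMap.toMatrix_apply]
    fin_cases j
    · simp only [Fin.zero_eta, h0, Module.Basis.repr_self]
      fin_cases i <;> simp
    · simp only [Fin.mk_one, h1, map_add, map_smul, Module.Basis.repr_self]
      fin_cases i <;> simp
  constructor
  · rw [LinearMap.trace_eq_matrix_trace A v, hm]
    simp [Matrix.trace_fin_two]
  · rw [← LinearMap.det_toMatrix v, hm]
    simp [Matrix.det_fin_two]

end

namespace SpectralCurve

open QuadraticAlgebra

variable (S : SpectralCurve)

instance : IsScalarTower ℂ⟦X⟧ S.O S.K := .of_algebraMap_eq fun f => by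
  rw [S.algebraMap_O_K]; rfl

theorem span_range_algebraMap :
    Submodule.span Lz (Set.range (algebraMap S.O S.K)) = ⊤ := by
  rw [eq_top_iff]
  rintro x -
  have hx : x = x.re • algebraMap S.O S.K 1 + x.im • algebraMap S.O S.K S.xi := by
    rw [map_one, algebraMap_xi]
    ext <;> simp [re_one, im_one]
  rw [hx]
  exact add_mem (Submodule.smul_mem _ _ (Submodule.subset_span ⟨_, rfl⟩))
    (Submodule.smul_mem _ _ (Submodule.subset_span ⟨_, rfl⟩))

/-- The direct image of `(l_u, δ, l₀)`: the same triple, considered over `ℂ((z))⟦λ⟧`,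
`ℂ((z))` and `ℂ⟦z⟧`. -/
def pushObj (M : LatMod S.O S.ddzS 1) : LatMod ℂ⟦X⟧ ddzK 2 where
  carrier := Res Lz S.K M.carrier
  free := M.free.map fun b => resBasis (QuadraticAlgebra.basis _ _) b
  conn := resConn S.ddzS_algebraMap M.conn
  lattice := (M.lattice.restrictScalars ℂ⟦X⟧).map (resRed Lz ℂ⟦X⟧ M.carrier).toLinearMap
  isLattice := isLattice_restrict S.span_range_algebraMap M.lattice M.isLattice

/-- The direct image on isomorphisms: the same map, considered over `ℂ((z))⟦λ⟧`. -/
def pushMap {M N : LatMod S.O S.ddzS 1} (f : LatMod.Hom M N) :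
    LatMod.Hom (S.pushObj M) (S.pushObj N) where
  equiv :=
    { f.equiv.toAddEquiv with
      map_smul' := fun a x => f.equiv.map_smul (algebraMap Lz⟦X⟧ S.K⟦X⟧ a) x }
  comm := f.comm
  map_lattice := by
    have h := f.map_lattice
    ext y
    constructor
    · rintro ⟨_, ⟨x, hx, rfl⟩, rfl⟩
      refine ⟨Red.map S.O f.equiv.toLinearMap x, ?_, ?_⟩
      · rw [← h]
        exact ⟨x, hx, rfl⟩
      · obtain ⟨m, rfl⟩ := Red.mk_surjective x
        rfl
    · rintro ⟨x, hx, rfl⟩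
      rw [← h] at hx
      obtain ⟨x, hx, rfl⟩ := hx
      refine ⟨_, ⟨x, hx, rfl⟩, ?_⟩
      obtain ⟨m, rfl⟩ := Red.mk_surjective x
      rfl

/-- The direct image functor on modules with lattices. -/
def pushLat : LatMod S.O S.ddzS 1 ⥤ LatMod ℂ⟦X⟧ ddzK 2 where
  obj := S.pushObj
  map f := S.pushMap f
  map_id _ := rfl
  map_comp _ _ := rfl

theorem isCC_push (M : LatMod S.O S.ddzS 1) (hM : S.IsTCC M) : S.IsCC (S.pushObj M) := by
  have h := res_trace_det S.ddzS_algebraMap M.free.some M.conn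
    (fun x => by rw [hM, algebraMap_xi])
  refine ⟨h.1, h.2.trans (neg_neg _), ?_⟩
  rintro _ ⟨x, hx, rfl⟩
  refine ⟨S.xi • x, M.lattice.smul_mem _ hx, ?_⟩
  have h1 : (S.xi • x : Red S.K M.carrier) = M.conn.red S.K x := by
    rw [hM, algebraMap_smul]
  rw [h1]
  obtain ⟨m, rfl⟩ := Red.mk_surjective x
  rfl

/-- The direct image functor `(l_u, δ, l₀) ↦ (l_u, δ, l₀)`, where the target triple is considered
over `ℂ((z))⟦λ⟧`, `ℂ((z))` and `ℂ⟦z⟧`. -/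
def push : S.TCC ⥤ S.CC :=
  S.IsCC.lift (S.IsTCC.ι ⋙ S.pushLat) fun M => S.isCC_push M.obj M.property

end SpectralCurve

/-! ### Isomorphism classes -/

/-- The set `[C]` of isomorphism classes of objects. -/
def IsoClasses (C : Type 1) [Category.{0} C] : Type 1 := Quotient (isIsomorphicSetoid C)

/-- The map `[C] → [C']` induced by a functor. -/
def IsoClasses.map {C C' : Type 1} [Category.{0} C] [Category.{0} C'] (F : C ⥤ C') :
    IsoClasses C → IsoClasses C' :=
  Quotient.map (sa := isIsomorphicSetoid C) (sb := isIsomorphicSetoid C') F.obj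
    fun _ _ ⟨f⟩ => ⟨F.mapIso f⟩

end LambdaConn

end

noncomputable section

namespace LambdaConn

/-! ### Recursion for power series -/

/-! Order by order in `λ`, everything reduces to first order rank one equations on the spectral
curve. Two facts carry the proof. Off the ramification point `z̃ = 2 ξ - t`, the difference of the
two roots, is invertible. And `dz` is `z̃ dz̃` up to a unit, so `z̃ d/dz` is a unit times the
regular derivation `d/dz̃`.

Direct image. If the commutator with `ξ` of a map of direct images is divisible by `λ ^ n`,
compatibility with the connections makes `z̃` times it divisible by `λ ^ (n + 1)`; hence the
commutator vanishes and the map is linear over `K⟦λ⟧` (`map_smul_of_comm`). For essential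
surjectivity, a cyclic vector turns `∇` into a second order equation with companion coefficients
`P`, `Q`. This equation comes from the rank one connection `λ d + a` as soon as `λ a' + a² = P + Q
a` with `a ≡ ξ` modulo `λ`. The linearization of this Riccati equation is multiplication by `z̃`, so
it is solvable (`exists_riccati`, `exists_equiv_of_isCompanion`). A lattice stable under `∇₀` is a
lattice over `O` (`exists_lattice`).

Full faithfulness. Faithfulness holds because free modules embed in their localizations. For
fullness one shows that an isomorphism over the punctured disc or curve has regular matrix
coefficients, by induction on the order in `λ`. In rank one the two connection forms have equal
residue and equal reduction, so the leading nonregular coefficient satisfies an equation `dk/dz̃ = c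
k + r` with regular `c`, `r`, which allows no pole (`exists_algebraMap_eq_of_ddzS`). In rank two,
cyclic vectors exist over the whole disc because the curve is smooth. The two coordinates `x`, `y`
of the image of such a vector combine into `x + y ξ`, which satisfies an equation of the same kind
(`exists_algebraMap_eq_of_system`).

Isomorphism classes. Both images consist of the single class of the connection form `ξ dz - λ dz̃ /
(2 z̃)` with lattice `O`. An object of `TConn` differs from it by `λ` times a form regular in `dz̃`.
For an object of `Conn`, write the Riccati solution as `a = p + q z̃`. The odd part of the equation
gives `2 p = Q - λ q' / q - λ z̃' / z̃`, and the last term is the residue `-λ/2`; the even part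
bounds the pole of what remains (`exists_gauge_riccati`). In both cases the difference is `λ e`,
where `e` is regular in `dz̃` modulo `λ` and exact over `K` in higher degrees. The gauge
transformation removing it is a unit of `O` times the exponential of a multiple of `λ`, so it
preserves the lattice (`exists_gauge`). -/

theorem exists_seq_eq {V : Type} [Nonempty V] (Ψ : (ℕ → V) → ℕ → V)
    (hΨ : ∀ f g n, (∀ i < n, f i = g i) → Ψ f n = Ψ g n) : ∃ f, ∀ n, f n = Ψ f n := by
  let _ : Inhabited V := ⟨Classical.arbitrary V⟩
  -- The values at indices `≥ n` are filled with an arbitrary default, which `Ψ` cannot see at `n`.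
  let F : ℕ → V := fun n => Nat.strongRecOn n fun n ih =>
    Ψ (fun m => if h : m < n then ih m h else default) n
  refine ⟨F, fun n => ?_⟩
  have h : F n = Ψ (fun m => if _ : m < n then F m else default) n := by
    simp only [F]
    rw [Nat.strongRecOn_eq]
  rw [h]
  refine hΨ _ _ _ fun i hi => ?_
  simp [hi]

section PowerSeries

variable {A : Type} [CommRing A]

/-- A fixed point equation which is contracting for the adic topology has a solution. -/
theorem exists_eq_add_X_mul (G : A⟦X⟧) (Ψ : A⟦X⟧ → A⟦X⟧)
    (hΨ : ∀ f g n, (PowerSeries.X : A⟦X⟧) ^ n ∣ f - g → (PowerSeries.X : A⟦X⟧) ^ n ∣ Ψ f - Ψ g) :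
    ∃ f, f = G + PowerSeries.X * Ψ f := by
  -- Multiplication by `λ` shifts degrees by one, so the coefficient of degree `n + 1` on the right
  -- depends only on coefficients of `s` of degree at most `n`.
  obtain ⟨s, hs⟩ := exists_seq_eq (V := A)
    (fun s n => PowerSeries.coeff n (G + PowerSeries.X * Ψ (PowerSeries.mk s))) (by
      intro f g n h
      cases n with
      | zero => simp
      | succ n =>
        have h1 : (PowerSeries.X : A⟦X⟧) ^ (n + 1) ∣ PowerSeries.mk f - PowerSeries.mk g := by
          rw [PowerSeries.X_pow_dvd_iff]
          intro i hi
          simp [h i hi]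
        have h2 := PowerSeries.X_pow_dvd_iff.1 (hΨ _ _ _ h1) n n.lt_succ_self
        rw [map_sub, sub_eq_zero] at h2
        simp [PowerSeries.coeff_succ_X_mul, h2])
  refine ⟨PowerSeries.mk s, ?_⟩
  ext n
  rw [PowerSeries.coeff_mk, hs]

theorem X_pow_dvd_coeffDeriv (D : Der A) {f : A⟦X⟧} {n : ℕ}
    (h : (PowerSeries.X : A⟦X⟧) ^ n ∣ f) : (PowerSeries.X : A⟦X⟧) ^ n ∣ coeffDeriv D f := by
  rw [PowerSeries.X_pow_dvd_iff] at h ⊢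
  intro i hi
  simp [h i hi]

@[simp] theorem coeffDeriv_C (D : Der A) (a : A) :
    coeffDeriv D (PowerSeries.C a) = PowerSeries.C (D a) := by
  ext n
  simp only [coeff_coeffDeriv, PowerSeries.coeff_C]
  split_ifs <;> simp

theorem constantCoeff_coeffDeriv (D : Der A) (f : A⟦X⟧) :
    PowerSeries.constantCoeff (coeffDeriv D f) = D (PowerSeries.constantCoeff f) := by
  simp only [← PowerSeries.coeff_zero_eq_constantCoeff_apply, coeff_coeffDeriv]

/-- A derivation kills the integers that `d/dλ` brings down, so the two derivatives commute. This is
the only link between `D` and `d/dλ` needed for exponentials and logarithms. -/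
theorem coeffDeriv_derivative (D : Der A) (f : A⟦X⟧) :
    coeffDeriv D (PowerSeries.derivative A f) = PowerSeries.derivative A (coeffDeriv D f) := by
  ext n
  have h : D ((n : A) + 1) = 0 := by
    have := D.map_natCast (n + 1)
    push_cast at this
    exact this
  simp [PowerSeries.coeff_derivative, Der.leibniz, h, mul_comm]

/-- A first order linear differential equation has a solution with any initial value. -/
theorem exists_derivative_eq_mul (hA : ∀ n : ℕ, IsUnit ((n + 1 : ℕ) : A)) (g : A⟦X⟧) :
    ∃ u : A⟦X⟧, PowerSeries.constantCoeff u = 1 ∧ PowerSeries.derivative A u = g * u := by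
  choose w hw using fun n => (hA n).exists_right_inv
  -- The integrated equation: `w n` is the inverse of `n + 1`, so the series multiplied by `λ` is
  -- the primitive of `g * u` divided by `λ`.
  obtain ⟨u, hu⟩ := exists_eq_add_X_mul (1 : A⟦X⟧)
    (fun u => PowerSeries.mk fun n => w n * PowerSeries.coeff n (g * u)) (by
      intro f g' n h
      rw [PowerSeries.X_pow_dvd_iff]
      intro i hi
      have h1 := PowerSeries.X_pow_dvd_iff.1 (h.mul_left g) i hi
      rw [mul_sub, map_sub] at h1
      rw [map_sub, PowerSeries.coeff_mk, PowerSeries.coeff_mk, ← mul_sub, h1, mul_zero])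
  refine ⟨u, by rw [hu]; simp, ?_⟩
  ext n
  rw [PowerSeries.coeff_derivative]
  conv_lhs => rw [hu]
  rw [map_add, PowerSeries.coeff_succ_X_mul, PowerSeries.coeff_mk, PowerSeries.coeff_one,
    if_neg n.succ_ne_zero]
  have := hw n
  push_cast at this
  linear_combination PowerSeries.coeff n (g * u) * this

/-- Each coefficient of positive degree is determined by the lower ones, after division by `n + 1`.
-/
theorem eq_zero_of_derivative_eq_mul (hA : ∀ n : ℕ, IsUnit ((n + 1 : ℕ) : A)) {g v : A⟦X⟧}
    (h0 : PowerSeries.constantCoeff v = 0) (h : PowerSeries.derivative A v = g * v) : v = 0 := by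
  ext n
  rw [map_zero]
  induction n using Nat.strong_induction_on with
  | _ n ih =>
    cases n with
    | zero => simpa using h0
    | succ n =>
      have h1 := congrArg (PowerSeries.coeff n) h
      rw [PowerSeries.coeff_derivative, PowerSeries.coeff_mul, Finset.sum_eq_zero] at h1
      · have h2 := hA n
        push_cast at h2
        exact h2.mul_left_eq_zero.1 h1
      · intro x hx
        rw [ih x.2 (by have := Finset.HasAntidiagonal.mem_antidiagonal.1 hx; lia), mul_zero]

/-- The exponential of a power series without constant term, and its derivative along a derivation
of the coefficients. -/
theorem exists_exp (hA : ∀ n : ℕ, IsUnit ((n + 1 : ℕ) : A)) (D : Der A) (E : A⟦X⟧)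
    (hE : PowerSeries.constantCoeff E = 0) :
    ∃ u : A⟦X⟧, PowerSeries.constantCoeff u = 1 ∧ coeffDeriv D u = coeffDeriv D E * u := by
  obtain ⟨u, hu0, hu⟩ := exists_derivative_eq_mul hA (PowerSeries.derivative A E)
  refine ⟨u, hu0, ?_⟩
  -- The defect `D u - (D E) u` satisfies the same equation in `λ` as `u`, with initial value zero,
  -- so it vanishes.
  rw [← sub_eq_zero]
  refine eq_zero_of_derivative_eq_mul hA (g := PowerSeries.derivative A E) ?_ ?_
  · simp [constantCoeff_coeffDeriv, hu0, hE]
  · have h := congrArg (coeffDeriv D) hu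
    rw [coeffDeriv_derivative, coeffDeriv_mul, coeffDeriv_derivative] at h
    rw [map_sub, Derivation.leibniz, h, hu, smul_eq_mul, smul_eq_mul]
    ring

/-- The logarithmic derivative of an invertible power series is exact in positive degrees. -/
theorem exists_log (hA : ∀ n : ℕ, IsUnit ((n + 1 : ℕ) : A)) (D : Der A) {q r : A⟦X⟧}
    (hqr : q * r = 1) (n : ℕ) :
    ∃ x, D x = PowerSeries.coeff (n + 1) (coeffDeriv D q * r) := by
  -- Symmetry of the mixed derivatives of `log q`: differentiating `D q / q` in `λ` gives a
  -- `D`-exact series. Every coefficient but the constant one survives `d/dλ`.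
  have h : PowerSeries.derivative A (coeffDeriv D q * r)
      = coeffDeriv D (PowerSeries.derivative A q * r) := by
    have h1 := congrArg (PowerSeries.derivative A) hqr
    have h2 := congrArg (coeffDeriv D) hqr
    rw [coeffDeriv_mul, coeffDeriv_one] at h2
    rw [Derivation.leibniz, Derivation.map_one_eq_zero, smul_eq_mul, smul_eq_mul] at h1
    rw [Derivation.leibniz, coeffDeriv_mul, coeffDeriv_derivative, smul_eq_mul, smul_eq_mul]
    linear_combination (coeffDeriv D q * r) * h1 - (PowerSeries.derivative A q * r) * h2
      - (coeffDeriv D q * PowerSeries.derivative A r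
        - PowerSeries.derivative A q * coeffDeriv D r) * hqr
  have h1 := congrArg (PowerSeries.coeff n) h
  rw [PowerSeries.coeff_derivative, coeff_coeffDeriv] at h1
  obtain ⟨w, hw⟩ := (hA n).exists_right_inv
  refine ⟨w * PowerSeries.coeff n (PowerSeries.derivative A q * r), ?_⟩
  -- Dividing by the integer `n + 1` commutes with `D`.
  have hDw : D w = 0 := by
    have h2 := congrArg D hw
    rw [D.leibniz, D.map_natCast, D.map_one, mul_zero, add_zero] at h2
    exact (hA n).mul_right_eq_zero.1 h2
  rw [D.leibniz, hDw, mul_zero, add_zero, ← h1]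
  push_cast at hw
  linear_combination PowerSeries.coeff (n + 1) (coeffDeriv D q * r) * hw

end PowerSeries

/-! ### Functions on the spectral curve -/

namespace SpectralCurve

open QuadraticAlgebra

variable (S : SpectralCurve)

theorem isUnit_natCast_O (n : ℕ) : IsUnit ((n + 1 : ℕ) : S.O) := by
  have h : IsUnit ((n + 1 : ℕ) : ℂ) := by
    rw [isUnit_iff_ne_zero]; exact Nat.cast_ne_zero.2 n.succ_ne_zero
  simpa using h.map (algebraMap ℂ S.O)

theorem isUnit_natCast_K (n : ℕ) : IsUnit ((n + 1 : ℕ) : S.K) := by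
  have h : IsUnit ((n + 1 : ℕ) : Lz) := by
    rw [isUnit_iff_ne_zero]; exact Nat.cast_ne_zero.2 n.succ_ne_zero
  simpa using h.map (algebraMap Lz S.K)

theorem algebraMap_O_K_injective : Function.Injective (algebraMap S.O S.K) := by
  intro x y h
  rw [S.algebraMap_apply, S.algebraMap_apply] at h
  have hi := IsFractionRing.injective ℂ⟦X⟧ Lz
  ext1
  · exact hi (congrArg QuadraticAlgebra.re h)
  · exact hi (congrArg QuadraticAlgebra.im h)

theorem exists_disc_eq : ∃ U : ℂ⟦X⟧, IsUnit U ∧ S.disc = PowerSeries.X * U := by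
  have h := PowerSeries.order_eq_nat.1 (show S.disc.order = (1 : ℕ) by
    simpa [disc] using S.order_disc)
  have h0 : PowerSeries.constantCoeff S.disc = 0 := by
    simpa using h.2 0 one_pos
  obtain ⟨U, hU⟩ := PowerSeries.X_dvd_iff.2 h0
  refine ⟨U, ?_, hU⟩
  rw [PowerSeries.isUnit_iff_constantCoeff, isUnit_iff_ne_zero]
  have h1 := h.1
  rw [hU, PowerSeries.coeff_succ_X_mul] at h1
  simpa using h1

/-- The discriminant has a simple zero, so it is a uniformizer of `ℂ⟦z⟧` and its powers clear all
denominators. -/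
theorem exists_disc_pow_mul (f : Lz) :
    ∃ (m : ℕ) (r : ℂ⟦X⟧), algebraMap ℂ⟦X⟧ Lz S.disc ^ m * f = algebraMap ℂ⟦X⟧ Lz r := by
  obtain ⟨r, s, hs, rfl⟩ := IsFractionRing.div_surjective (A := ℂ⟦X⟧) f
  obtain ⟨U, hU, hD⟩ := S.exists_disc_eq
  have hirr : Irreducible S.disc := by
    rw [hD, irreducible_mul_isUnit hU]
    exact PowerSeries.X_irreducible
  have hs0 : s ≠ 0 := nonZeroDivisors.ne_zero hs
  obtain ⟨n, u, hu⟩ := IsDiscreteValuationRing.associated_pow_irreducible hs0 hirr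
  refine ⟨n, u * r, ?_⟩
  have hs1 : algebraMap ℂ⟦X⟧ Lz s ≠ 0 := fun h =>
    hs0 (IsFractionRing.injective ℂ⟦X⟧ Lz (by rw [h, map_zero]))
  rw [← map_pow, ← hu, map_mul, map_mul]
  field_simp

theorem exists_zt_pow_mul (k : S.K) :
    ∃ (m : ℕ) (x : S.O), algebraMap S.O S.K S.zt ^ m * k = algebraMap S.O S.K x := by
  obtain ⟨m, r, hr⟩ := S.exists_disc_pow_mul k.re
  obtain ⟨n, s, hs⟩ := S.exists_disc_pow_mul k.im
  -- An even power of `z̃` is a power of the discriminant, which acts on both coordinates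
  -- separately.
  refine ⟨2 * (m + n), ⟨S.disc ^ n * r, S.disc ^ m * s⟩, ?_⟩
  rw [pow_mul, pow_two, S.algebraMap_zt_sq, ← map_pow, ← Algebra.smul_def, S.algebraMap_apply]
  ext1
  · simp only [re_smul, smul_eq_mul, map_mul, map_pow, ← hr]
    ring
  · simp only [im_smul, smul_eq_mul, map_mul, map_pow, ← hs]
    ring

theorem isUnit_zt : IsUnit (algebraMap S.O S.K S.zt) := by
  refine IsUnit.of_mul_eq_one
    (algebraMap S.O S.K S.zt * algebraMap Lz S.K (algebraMap ℂ⟦X⟧ Lz S.disc)⁻¹) ?_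
  rw [← mul_assoc, S.algebraMap_zt_sq, S.algebraMap_disc_mul_inv]

/-- The derivative of the discriminant is a unit, so changing the generator from `z̃⁻¹ dz̃` to `dz`
costs exactly a factor `z̃⁻²` up to a unit. All pole orders below are counted with this. -/
theorem two_logFactor_zt_sq : 2 * S.logFactor * algebraMap S.O S.K S.zt
    * algebraMap S.O S.K S.zt = algebraMap S.O S.K (algebraMap ℂ⟦X⟧ S.O (ddz S.disc)) := by
  have h0 : algebraMap ℂ⟦X⟧ Lz S.disc ≠ 0 := fun h =>
    S.disc_ne_zero (IsFractionRing.injective ℂ⟦X⟧ Lz (by rw [h, map_zero]))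
  rw [mul_assoc, S.algebraMap_zt_sq, logFactor, algebraMap_O_K, ← map_ofNat (algebraMap Lz S.K) 2,
    ← map_mul, ← map_mul]
  congr 1
  field_simp

theorem isUnit_logFactor : IsUnit S.logFactor := by
  have h := S.two_logFactor_zt_sq
  have h1 : IsUnit (algebraMap S.O S.K (algebraMap ℂ⟦X⟧ S.O (ddz S.disc))) :=
    ((IsUnit.of_mul_eq_one _ S.ddz_disc_mul_inv).map _).map _
  rw [← h] at h1
  exact isUnit_of_mul_isUnit_right
    (isUnit_of_mul_isUnit_left (isUnit_of_mul_isUnit_left h1))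

theorem ddzS_zt : S.ddzS (algebraMap S.O S.K S.zt) = S.logFactor * algebraMap S.O S.K S.zt := by
  rw [S.ddzS_algebraMap_O, theta, Der.mul_apply, S.ddzt_zt, mul_one]

theorem ddzS_zt_pow (j : ℕ) : S.ddzS (algebraMap S.O S.K S.zt ^ j)
    = j * S.logFactor * algebraMap S.O S.K S.zt ^ j := by
  induction j with
  | zero => simp
  | succ j ih =>
    rw [pow_succ, Der.leibniz, ih, ddzS_zt]
    push_cast
    ring

/-- A function on the punctured curve which satisfies a nonresonant first order differential
equation with regular coefficients is regular. -/
theorem exists_algebraMap_eq_of_ddzS {k : S.K} {c r : S.O}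
    (h : S.ddzS k = S.logFactor * (algebraMap S.O S.K (S.zt * c) * k + algebraMap S.O S.K r)) :
    ∃ x, algebraMap S.O S.K x = k := by
  -- Descent on the pole order. If `x = z̃ ^ (j + 1) k` is regular, the equation says that `(j + 1)
  -- x` is divisible by `z̃`; since `j + 1` is invertible, `z̃ ^ j k` is already regular.
  obtain ⟨m, hm⟩ := S.exists_zt_pow_mul k
  induction m with
  | zero =>
    obtain ⟨x, hx⟩ := hm
    exact ⟨x, by rw [← hx, pow_zero, one_mul]⟩
  | succ j ih =>
    obtain ⟨x, hx⟩ := hm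
    apply ih
    have h1 := S.ddzS_algebraMap_O x
    rw [← hx, Der.leibniz, h, ddzS_zt_pow] at h1
    have h2 : algebraMap S.O S.K (S.zt * (S.zt ^ j * r + c * x) + (j + 1 : ℕ) * x)
        = algebraMap S.O S.K (S.theta x) := by
      apply S.isUnit_logFactor.mul_left_cancel
      rw [← h1]
      simp only [map_add, map_mul, map_pow, map_natCast, ← hx]
      ring
    have h3 := S.algebraMap_O_K_injective h2
    rw [theta, Der.mul_apply] at h3
    obtain ⟨w, hw⟩ := (S.isUnit_natCast_O j).exists_right_inv
    have h4 : x = S.zt * (w * (S.ddzt x - (S.zt ^ j * r + c * x))) := by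
      linear_combination w * h3 - x * hw
    refine ⟨w * (S.ddzt x - (S.zt ^ j * r + c * x)), S.isUnit_zt.mul_left_cancel ?_⟩
    rw [← map_mul, ← h4, ← hx]
    ring

end SpectralCurve

/-! ### Differential equations with a regular singularity -/

/-- Solutions of a linear system with a nonresonant regular singularity at the origin. -/
theorem exists_regular_singular_solution (c : ℂ) (hc : ∀ n : ℕ, (n : ℂ) + c ≠ 0)
    (r s α β : ℂ⟦X⟧) : ∃ f g : ℂ⟦X⟧, PowerSeries.constantCoeff f = 1 ∧ ddz f = r * f + s * g ∧
      PowerSeries.X * ddz g + PowerSeries.C c * g = α * f + PowerSeries.X * (β * g) := by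
  -- `F v` is the primitive of `r v.1 + s v.2` with constant term `1`.
  let F : (ℕ → ℂ × ℂ) → ℂ⟦X⟧ := fun v => 1 + PowerSeries.X * PowerSeries.mk fun n =>
    ((n : ℂ) + 1)⁻¹ * PowerSeries.coeff n (r * PowerSeries.mk (fun i => (v i).1)
      + s * PowerSeries.mk (fun i => (v i).2))
  have hmul : ∀ (f : ℂ⟦X⟧) (v w : ℕ → ℂ) (n : ℕ), (∀ i ≤ n, v i = w i) →
      PowerSeries.coeff n (f * PowerSeries.mk v) = PowerSeries.coeff n (f * PowerSeries.mk w) := by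
    intro f v w n h
    rw [PowerSeries.coeff_mul, PowerSeries.coeff_mul]
    refine Finset.sum_congr rfl fun x hx => ?_
    have := Finset.HasAntidiagonal.mem_antidiagonal.1 hx
    rw [PowerSeries.coeff_mk, PowerSeries.coeff_mk, h _ (by lia)]
  have hF : ∀ v w n, (∀ i < n, v i = w i) →
      PowerSeries.coeff n (F v) = PowerSeries.coeff n (F w) := by
    intro v w n h
    cases n with
    | zero => simp [F]
    | succ n =>
      simp only [F, map_add, PowerSeries.coeff_succ_X_mul, PowerSeries.coeff_mk]
      rw [hmul r _ (fun i => (w i).1) n (fun i hi => by rw [h i (by lia)]),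
        hmul s _ (fun i => (w i).2) n (fun i hi => by rw [h i (by lia)])]
  -- In degree `n` the second equation reads `(n + c) gₙ = …` and involves `fₙ` itself. Using `F v`
  -- in place of the first component of `v` keeps the recursion well founded, since `F v` in degree
  -- `n` needs `v` only below `n`.
  obtain ⟨v, hv⟩ := exists_seq_eq (V := ℂ × ℂ)
    (fun v n => (PowerSeries.coeff n (F v), ((n : ℂ) + c)⁻¹ * PowerSeries.coeff n
      (α * F v + PowerSeries.X * (β * PowerSeries.mk (fun i => (v i).2))))) (by
      intro v w n h
      have h1 : PowerSeries.coeff n (α * F v) = PowerSeries.coeff n (α * F w) := by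
        rw [PowerSeries.coeff_mul, PowerSeries.coeff_mul]
        refine Finset.sum_congr rfl fun x hx => ?_
        have := Finset.HasAntidiagonal.mem_antidiagonal.1 hx
        rw [hF v w _ (fun i hi => h i (by lia))]
      have h2 : PowerSeries.coeff n (PowerSeries.X * (β * PowerSeries.mk (fun i => (v i).2)))
          = PowerSeries.coeff n (PowerSeries.X * (β * PowerSeries.mk (fun i => (w i).2))) := by
        cases n with
        | zero => simp
        | succ n =>
          rw [PowerSeries.coeff_succ_X_mul, PowerSeries.coeff_succ_X_mul,
            hmul β _ (fun i => (w i).2) n (fun i hi => by rw [h i (by lia)])]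
      simp only [map_add, h1, h2, hF v w n h])
  have hf : PowerSeries.mk (fun i => (v i).1) = F v := by
    ext n
    rw [PowerSeries.coeff_mk, hv]
  refine ⟨F v, PowerSeries.mk (fun i => (v i).2), by simp [F], ?_, ?_⟩
  · conv_rhs => rw [← hf]
    ext n
    have hn : (n : ℂ) + 1 ≠ 0 := by exact_mod_cast n.succ_ne_zero
    rw [ddz_apply, PowerSeries.coeff_derivative]
    simp only [F, map_add, PowerSeries.coeff_succ_X_mul, PowerSeries.coeff_mk,
      PowerSeries.coeff_one, if_neg n.succ_ne_zero]
    field_simp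
    ring
  · ext n
    have h1 : PowerSeries.coeff n (PowerSeries.X * ddz (PowerSeries.mk (fun i => (v i).2)))
        = n * (v n).2 := by
      cases n with
      | zero => simp
      | succ n =>
        rw [PowerSeries.coeff_succ_X_mul, ddz_apply, PowerSeries.coeff_derivative,
          PowerSeries.coeff_mk]
        push_cast
        ring
    have h2 := congrArg Prod.snd (hv n)
    dsimp only at h2
    rw [map_add, h1, PowerSeries.coeff_C_mul, PowerSeries.coeff_mk, ← add_mul]
    conv_lhs => rw [h2]
    rw [mul_inv_cancel_left₀ (hc n)]

theorem exists_ddz_eq (p : ℂ⟦X⟧) : ∃ f, ddz f = p := by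
  refine ⟨PowerSeries.X * PowerSeries.mk fun n => ((n : ℂ) + 1)⁻¹ * PowerSeries.coeff n p, ?_⟩
  ext n
  have hn : (n : ℂ) + 1 ≠ 0 := by exact_mod_cast n.succ_ne_zero
  rw [ddz_apply, PowerSeries.coeff_derivative, PowerSeries.coeff_succ_X_mul, PowerSeries.coeff_mk]
  field_simp

namespace SpectralCurve

open QuadraticAlgebra

variable (S : SpectralCurve)

/-- With the discriminant written as `z U`, dividing by the unit `U` gives a regular singular system
at `z = 0` with the same exponent `c`. The term of the derivative of the discriminant coming from
`U'` is divisible by `z`, so it is absorbed into `β`. -/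
theorem exists_disc_mul_ddz_eq (c : ℂ) (hc : ∀ n : ℕ, (n : ℂ) + c ≠ 0) (r s α β : ℂ⟦X⟧) :
    ∃ f g : ℂ⟦X⟧, PowerSeries.constantCoeff f = 1 ∧ ddz f = r * f + s * g ∧
      S.disc * ddz g + PowerSeries.C c * ddz S.disc * g = α * f + S.disc * (β * g) := by
  obtain ⟨U, hU, hD⟩ := S.exists_disc_eq
  obtain ⟨V, hV⟩ := hU.exists_right_inv
  obtain ⟨f, g, h0, hf, hg⟩ := exists_regular_singular_solution c hc r s (V * α)
    (β - PowerSeries.C c * V * ddz U)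
  refine ⟨f, g, h0, hf, ?_⟩
  have hD' : ddz S.disc = U + PowerSeries.X * ddz U := by
    rw [hD, Der.leibniz, ddz_apply PowerSeries.X, PowerSeries.derivative_X]
    ring
  rw [hD', hD]
  linear_combination U * hg
    + (α * f - PowerSeries.X * PowerSeries.C c * ddz U * g) * hV

end SpectralCurve

theorem Der.mul_map_pow {A : Type} [CommRing A] (D : Der A) (a : A) (n : ℕ) :
    a * D (a ^ n) = n * a ^ n * D a := by
  induction n with
  | zero => simp
  | succ n ih =>
    rw [pow_succ, Der.leibniz]
    push_cast
    linear_combination a * ih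

theorem ddzK_inv_two : ddzK (2⁻¹ : Lz) = 0 := by
  have h : ddzK ((2 : Lz) * 2⁻¹) = 0 := by rw [mul_inv_cancel₀ two_ne_zero, Der.map_one]
  rw [Der.leibniz, Der.map_ofNat, mul_zero, add_zero] at h
  exact (mul_eq_zero.1 h).resolve_left two_ne_zero

theorem coeff_algebraMap {A B : Type} [CommRing A] [CommRing B] [Algebra A B] (f : A⟦X⟧) (n : ℕ) :
    PowerSeries.coeff n (algebraMap A⟦X⟧ B⟦X⟧ f) = algebraMap A B (PowerSeries.coeff n f) := by
  rw [RingHom.algebraMap_toAlgebra]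
  exact PowerSeries.coeff_map _ _ _

theorem constantCoeff_algebraMap {A B : Type} [CommRing A] [CommRing B] [Algebra A B] (f : A⟦X⟧) :
    PowerSeries.constantCoeff (algebraMap A⟦X⟧ B⟦X⟧ f)
      = algebraMap A B (PowerSeries.constantCoeff f) := by
  simp only [← PowerSeries.coeff_zero_eq_constantCoeff_apply, coeff_algebraMap]

theorem exists_eq_C_add_X_mul {A : Type} [CommRing A] (f : A⟦X⟧) :
    ∃ g, f = PowerSeries.C (PowerSeries.constantCoeff f) + PowerSeries.X * g := by
  obtain ⟨g, hg⟩ : (PowerSeries.X : A⟦X⟧) ∣ f - PowerSeries.C (PowerSeries.constantCoeff f) := by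
    rw [PowerSeries.X_dvd_iff]; simp
  exact ⟨g, by rw [← hg]; ring⟩

/-! ### Rank one equations on the curve, the Riccati equation and the normal form -/

namespace SpectralCurve

open QuadraticAlgebra

variable (S : SpectralCurve)

theorem ddzS_algebraMap_algebraMap (f : ℂ⟦X⟧) :
    S.ddzS (algebraMap S.O S.K (algebraMap ℂ⟦X⟧ S.O f))
      = algebraMap S.O S.K (algebraMap ℂ⟦X⟧ S.O (ddz f)) := by
  rw [algebraMap_O_K, ddzS_algebraMap, ddzK_algebraMap, algebraMap_O_K]

/-- The even and odd parts of a function for the exchange of the two sheets, which sends `z̃` to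
`-z̃`; `ξ` is half of `t + z̃`. -/
theorem exists_eq_add_mul_zt (y : S.O) :
    ∃ r s : ℂ⟦X⟧, y = algebraMap ℂ⟦X⟧ S.O r + algebraMap ℂ⟦X⟧ S.O s * S.zt := by
  have h : (PowerSeries.C (2⁻¹ : ℂ) : ℂ⟦X⟧) * 2 = 1 := by
    rw [← map_ofNat PowerSeries.C 2, ← map_mul, inv_mul_cancel₀ two_ne_zero, map_one]
  have h' := congrArg (algebraMap ℂ⟦X⟧ S.O) h
  rw [map_mul, map_ofNat, map_one] at h'
  have hy : y = algebraMap ℂ⟦X⟧ S.O y.re + algebraMap ℂ⟦X⟧ S.O y.im * S.xi := by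
    rw [xi_eq]; ext <;> simp
  refine ⟨y.re + PowerSeries.C 2⁻¹ * (S.t * y.im), PowerSeries.C 2⁻¹ * y.im, ?_⟩
  conv_lhs => rw [hy]
  rw [zt]
  simp only [map_add, map_mul]
  linear_combination (-(algebraMap ℂ⟦X⟧ S.O y.im * S.xi)) * h'

theorem disc_ne_zero' : algebraMap ℂ⟦X⟧ Lz S.disc ≠ 0 := fun h =>
  S.disc_ne_zero (IsFractionRing.injective ℂ⟦X⟧ Lz (by rw [h, map_zero]))

/-- A rank one equation with regular coefficients (with respect to `dz̃`) has an invertible regular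
solution. -/
theorem exists_isUnit_ddzS_eq {e : S.K} {y : S.O}
    (h : algebraMap S.O S.K S.zt * e = algebraMap S.O S.K y) :
    ∃ u : S.O, IsUnit u ∧ S.ddzS (algebraMap S.O S.K u) = e * algebraMap S.O S.K u := by
  obtain ⟨r, s, rfl⟩ := S.exists_eq_add_mul_zt y
  -- The exponent `1/2` is that of `z̃` as a square root of the discriminant. For `u = f + g z̃` and
  -- the form `s + r z̃ / disc`, the even and odd parts of `u' = e u` are exactly the system solved
  -- here.
  have hc : ∀ n : ℕ, (n : ℂ) + 2⁻¹ ≠ 0 := by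
    intro n hn
    have h1 : ((2 * n + 1 : ℕ) : ℂ) = 0 := by push_cast; linear_combination 2 * hn
    exact absurd h1 (Nat.cast_ne_zero.2 (by lia))
  obtain ⟨f, g, h0, hf, hg⟩ := S.exists_disc_mul_ddz_eq 2⁻¹ hc s r r s
  have h2 : (2 : ℂ⟦X⟧) * PowerSeries.C (2⁻¹ : ℂ) = 1 := by
    rw [← map_ofNat PowerSeries.C 2, ← map_mul, mul_inv_cancel₀ two_ne_zero, map_one]
  have hg' : 2 * S.disc * ddz g + ddz S.disc * g = 2 * r * f + 2 * S.disc * s * g := by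
    linear_combination 2 * hg - ddz S.disc * g * h2
  refine ⟨algebraMap ℂ⟦X⟧ S.O f + algebraMap ℂ⟦X⟧ S.O g * S.zt, ?_, ?_⟩
  -- The solution is a unit because its norm has constant term `1`.
  · have hu : IsUnit (f ^ 2 - S.disc * g ^ 2) := by
      obtain ⟨U, -, hD⟩ := S.exists_disc_eq
      rw [PowerSeries.isUnit_iff_constantCoeff, hD]
      simp [h0]
    have hu' := hu.map (algebraMap ℂ⟦X⟧ S.O)
    have : algebraMap ℂ⟦X⟧ S.O (f ^ 2 - S.disc * g ^ 2)
        = (algebraMap ℂ⟦X⟧ S.O f + algebraMap ℂ⟦X⟧ S.O g * S.zt)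
          * (algebraMap ℂ⟦X⟧ S.O f - algebraMap ℂ⟦X⟧ S.O g * S.zt) := by
      simp only [map_sub, map_mul, map_pow, ← S.zt_sq]
      ring
    rw [this] at hu'
    exact isUnit_of_mul_isUnit_left hu'
  · have hf' := congrArg (fun x => algebraMap S.O S.K (algebraMap ℂ⟦X⟧ S.O x)) hf
    have hg' := congrArg (fun x => algebraMap S.O S.K (algebraMap ℂ⟦X⟧ S.O x)) hg'
    have hl := S.two_logFactor_zt_sq
    have hz := congrArg (algebraMap S.O S.K) S.zt_sq
    simp only [map_add, map_mul, map_ofNat, map_pow] at hf' hg' hz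
    have h2 : IsUnit (2 : S.K) := by simpa using S.isUnit_natCast_K 1
    apply h2.mul_left_cancel
    apply S.isUnit_zt.mul_left_cancel
    simp only [map_add, map_mul] at h ⊢
    rw [Der.leibniz, ddzS_zt, ddzS_algebraMap_algebraMap, ddzS_algebraMap_algebraMap]
    generalize algebraMap S.O S.K (algebraMap ℂ⟦X⟧ S.O (ddz g)) = g' at *
    generalize algebraMap S.O S.K S.zt = Z at *
    generalize algebraMap S.O S.K (algebraMap ℂ⟦X⟧ S.O S.disc) = Δ at *
    generalize algebraMap S.O S.K (algebraMap ℂ⟦X⟧ S.O f) = f at *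
    generalize algebraMap S.O S.K (algebraMap ℂ⟦X⟧ S.O g) = g at *
    generalize algebraMap S.O S.K (algebraMap ℂ⟦X⟧ S.O s) = s at *
    linear_combination 2 * Z * hf' + hg' + g * hl
      + 2 * (g' - s * g) * hz
      - 2 * (f + g * Z) * h

/-- Written in `z̃`, the form `q z̃ dz` contains only even powers of `z̃` times `dz̃`, so it has no
residue and is exact, whatever the pole of `q`. -/
theorem exists_ddzS_eq_mul_zt (q : Lz) :
    ∃ x : S.K, S.ddzS x = algebraMap Lz S.K q * algebraMap S.O S.K S.zt := by
  obtain ⟨m, r, hr⟩ := S.exists_disc_pow_mul q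
  -- The primitive is sought as `h z̃ / disc ^ m`: the denominator lowers the exponent `1/2` by `m`,
  -- and a half-integer is never resonant.
  have hc : ∀ n : ℕ, (n : ℂ) + (2⁻¹ - m) ≠ 0 := by
    intro n hn
    have h1 : ((2 * n + 1 : ℕ) : ℂ) = (2 * m : ℕ) := by push_cast; linear_combination 2 * hn
    have := Nat.cast_injective h1
    lia
  obtain ⟨f, h, h0, hf, hh⟩ := S.exists_disc_mul_ddz_eq (2⁻¹ - m) hc 0 0 (S.disc * r) 0
  -- The first unknown satisfies `f' = 0` with `f(0) = 1`; it only serves to make the equation for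
  -- `h` inhomogeneous.
  have hf1 : f = 1 := by
    apply PowerSeries.derivative.ext (R := ℂ)
    · rw [← ddz_apply, hf]; simp
    · simp [h0]
  subst hf1
  have h2 : (2 : ℂ⟦X⟧) * PowerSeries.C (2⁻¹ : ℂ) = 1 := by
    rw [← map_ofNat PowerSeries.C 2, ← map_mul, mul_inv_cancel₀ two_ne_zero, map_one]
  have hh' : 2 * S.disc * ddz h + (1 - 2 * m) * ddz S.disc * h = 2 * S.disc * r := by
    rw [map_sub, map_natCast] at hh
    linear_combination 2 * hh - ddz S.disc * h * h2
  have hh'' := congrArg (algebraMap ℂ⟦X⟧ Lz) hh'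
  simp only [map_add, map_sub, map_mul, map_ofNat, map_one, map_natCast] at hh''
  have hΔ := S.disc_ne_zero'
  let Δ := algebraMap ℂ⟦X⟧ Lz S.disc
  let g : Lz := algebraMap ℂ⟦X⟧ Lz h / Δ ^ m
  have hg : Δ ^ m * g = algebraMap ℂ⟦X⟧ Lz h := by
    rw [mul_comm]
    exact div_mul_cancel₀ _ (pow_ne_zero m hΔ)
  have hdg := congrArg ddzK hg
  rw [Der.leibniz, ddzK_algebraMap] at hdg
  have hpow := ddzK.mul_map_pow Δ m
  have hDΔ : ddzK Δ = algebraMap ℂ⟦X⟧ Lz (ddz S.disc) := ddzK_algebraMap _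
  rw [hDΔ] at hpow
  have key : 2 * Δ * ddzK g + algebraMap ℂ⟦X⟧ Lz (ddz S.disc) * g = 2 * Δ * q := by
    apply mul_left_cancel₀ (pow_ne_zero m hΔ)
    change Δ ^ m * _ = Δ ^ m * _
    linear_combination 2 * Δ * hdg - 2 * g * hpow + hh'' + 2 * Δ * hr.symm
      + (1 - 2 * m) * algebraMap ℂ⟦X⟧ Lz (ddz S.disc) * hg
  refine ⟨algebraMap Lz S.K g * algebraMap S.O S.K S.zt, ?_⟩
  have hl : S.logFactor * 2 * algebraMap Lz S.K Δ
      = algebraMap Lz S.K (algebraMap ℂ⟦X⟧ Lz (ddz S.disc)) := by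
    rw [logFactor, ← map_ofNat (algebraMap Lz S.K) 2, ← map_mul, ← map_mul]
    congr 1
    simp only [Δ]
    field_simp
  have key' := congrArg (algebraMap Lz S.K) key
  simp only [map_add, map_mul, map_ofNat] at key'
  have hu : IsUnit (2 * algebraMap Lz S.K Δ) := by
    rw [← map_ofNat (algebraMap Lz S.K) 2, ← map_mul]
    exact (isUnit_iff_ne_zero.2 (mul_ne_zero two_ne_zero hΔ)).map _
  apply hu.mul_left_cancel
  rw [Der.leibniz, ddzS_zt, ddzS_algebraMap]
  linear_combination algebraMap S.O S.K S.zt * (key' + algebraMap Lz S.K g * hl)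

/-- The form is `s + r z̃ / disc` with `r`, `s` regular: the even part has a primitive in `ℂ⟦z⟧`,
and the odd part is exact for lack of residue. -/
theorem exists_ddzS_eq {e : S.K} {y : S.O}
    (h : algebraMap S.O S.K S.zt * e = algebraMap S.O S.K y) : ∃ x, S.ddzS x = e := by
  obtain ⟨r, s, rfl⟩ := S.exists_eq_add_mul_zt y
  obtain ⟨p, hp⟩ := exists_ddz_eq s
  obtain ⟨x, hx⟩ := S.exists_ddzS_eq_mul_zt
    (algebraMap ℂ⟦X⟧ Lz r * (algebraMap ℂ⟦X⟧ Lz S.disc)⁻¹)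
  refine ⟨x + algebraMap S.O S.K (algebraMap ℂ⟦X⟧ S.O p), ?_⟩
  apply S.isUnit_zt.mul_left_cancel
  rw [h, map_add, hx, ddzS_algebraMap_algebraMap, hp]
  simp only [map_add, map_mul, algebraMap_O_K]
  linear_combination (algebraMap Lz S.K (algebraMap ℂ⟦X⟧ Lz r)
    * algebraMap Lz S.K (algebraMap ℂ⟦X⟧ Lz S.disc)⁻¹) * S.algebraMap_zt_sq
    + algebraMap Lz S.K (algebraMap ℂ⟦X⟧ Lz r) * S.algebraMap_disc_mul_inv

/-- A rank one equation over `K⟦λ⟧` whose form is regular modulo `λ` and exact in higher degrees has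
a solution which is invertible and regular modulo `λ`. -/
theorem exists_gauge (e : S.K⟦X⟧) {y : S.O}
    (h0 : algebraMap S.O S.K S.zt * PowerSeries.constantCoeff e = algebraMap S.O S.K y)
    (h : ∀ n, ∃ x, S.ddzS x = PowerSeries.coeff (n + 1) e) :
    ∃ (u : S.K⟦X⟧) (v : S.O), IsUnit v ∧ PowerSeries.constantCoeff u = algebraMap S.O S.K v ∧
      coeffDeriv S.ddzS u = e * u := by
  obtain ⟨v, hv, hve⟩ := S.exists_isUnit_ddzS_eq h0
  choose x hx using h
  -- The primitives of the coefficients of positive degree assemble into a multiple of `λ`, whose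
  -- exponential is `1` modulo `λ`; the constant coefficient is handled by the unit `v`.
  obtain ⟨u, hu0, hu⟩ := exists_exp S.isUnit_natCast_K S.ddzS
    (PowerSeries.X * PowerSeries.mk x) (by simp)
  have hE : e = PowerSeries.C (PowerSeries.constantCoeff e)
      + coeffDeriv S.ddzS (PowerSeries.X * PowerSeries.mk x) := by
    refine PowerSeries.ext fun n => ?_
    cases n with
    | zero => simp [constantCoeff_coeffDeriv]
    | succ n => simp [PowerSeries.coeff_succ_X_mul, hx]
  refine ⟨PowerSeries.C (algebraMap S.O S.K v) * u, v, hv, by simp [hu0], ?_⟩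
  rw [coeffDeriv_mul, coeffDeriv_C, hve, hu, map_mul PowerSeries.C]
  linear_combination (-(PowerSeries.C (algebraMap S.O S.K v) * u)) * hE

theorem coeffDeriv_ddzS_algebraMap (f : Lz⟦X⟧) :
    coeffDeriv S.ddzS (algebraMap Lz⟦X⟧ S.K⟦X⟧ f)
      = algebraMap Lz⟦X⟧ S.K⟦X⟧ (coeffDeriv ddzK f) := by
  rw [coeffDeriv_algebraMap (u := 1) (DR := ddzK) (fun r => by rw [S.ddzS_algebraMap, one_mul]),
    map_one, one_mul]

theorem omega_sq : (omega : S.K) * omega = algebraMap Lz S.K (algebraMap ℂ⟦X⟧ Lz S.t) * omega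
    - algebraMap Lz S.K (algebraMap ℂ⟦X⟧ Lz S.d) := by
  ext <;> simp

/-- The Riccati equation of a second order equation with the given spectral curve has a solution
over the punctured curve. -/
theorem exists_riccati {A B : Lz⟦X⟧} (hA : PowerSeries.constantCoeff A = -algebraMap ℂ⟦X⟧ Lz S.d)
    (hB : PowerSeries.constantCoeff B = algebraMap ℂ⟦X⟧ Lz S.t) :
    ∃ a : S.K⟦X⟧, PowerSeries.constantCoeff a = omega ∧
      PowerSeries.X * coeffDeriv S.ddzS a + a * a
        = algebraMap Lz⟦X⟧ S.K⟦X⟧ A + algebraMap Lz⟦X⟧ S.K⟦X⟧ B * a := by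
  obtain ⟨w, hw⟩ := S.isUnit_zt.exists_right_inv
  obtain ⟨A', hA'⟩ := exists_eq_C_add_X_mul A
  obtain ⟨B', hB'⟩ := exists_eq_C_add_X_mul B
  rw [hA] at hA'
  rw [hB] at hB'
  let α := algebraMap Lz⟦X⟧ S.K⟦X⟧ A'
  let β := algebraMap Lz⟦X⟧ S.K⟦X⟧ B'
  -- Substituting `a = ω + λ h` and dividing by `λ` leaves `(2 ω - t) h` equal to a known term plus
  -- a multiple of `λ`. As `2 ω - t = z̃` is invertible, with inverse `w`, this is a contracting
  -- fixed point equation.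
  obtain ⟨h, hh⟩ := exists_eq_add_X_mul (PowerSeries.C w * (α + β * PowerSeries.C omega
      - PowerSeries.C (S.ddzS omega)))
    (fun h => PowerSeries.C w * (β * h - coeffDeriv S.ddzS h - h * h)) (by
      intro f g n hfg
      have h1 := X_pow_dvd_coeffDeriv S.ddzS hfg
      rw [map_sub] at h1
      have : PowerSeries.C w * (β * f - coeffDeriv S.ddzS f - f * f)
          - PowerSeries.C w * (β * g - coeffDeriv S.ddzS g - g * g)
          = PowerSeries.C w * ((β - f - g) * (f - g)
            - (coeffDeriv S.ddzS f - coeffDeriv S.ddzS g)) := by ring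
      rw [this]
      exact (dvd_sub (hfg.mul_left _) h1).mul_left _)
  refine ⟨PowerSeries.C omega + PowerSeries.X * h, by simp, ?_⟩
  have hw' := congrArg (PowerSeries.C (R := S.K)) hw
  have ho := congrArg (PowerSeries.C (R := S.K)) S.omega_sq
  rw [S.algebraMap_zt] at hw'
  simp only [map_sub, map_mul, map_one, map_ofNat] at hw' ho
  rw [map_add, coeffDeriv_mul, coeffDeriv_C, coeffDeriv_X, zero_mul, add_zero, hA', hB']
  simp only [map_add, map_mul, algebraMap_X, algebraMap_C, map_neg]
  change _ = _ + PowerSeries.X * α + (_ + PowerSeries.X * β) * _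
  linear_combination ho + PowerSeries.X * (2 * PowerSeries.C omega
    - PowerSeries.C (algebraMap Lz S.K (algebraMap ℂ⟦X⟧ Lz S.t))) * hh
    + PowerSeries.X * (α + β * PowerSeries.C omega - PowerSeries.C (S.ddzS omega)
      + PowerSeries.X * (β * h - coeffDeriv S.ddzS h - h * h)) * hw'

theorem exists_eq_add_mul_zt_K (k : S.K) : ∃ p q : Lz, k = algebraMap Lz S.K p
    + algebraMap Lz S.K q * algebraMap S.O S.K S.zt := by
  have h : (algebraMap Lz S.K 2⁻¹) * 2 = 1 := by
    rw [← map_ofNat (algebraMap Lz S.K) 2, ← map_mul, inv_mul_cancel₀ two_ne_zero, map_one]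
  have hk : k = algebraMap Lz S.K k.re + algebraMap Lz S.K k.im * omega := by
    ext <;> simp
  refine ⟨k.re + 2⁻¹ * (algebraMap ℂ⟦X⟧ Lz S.t * k.im), 2⁻¹ * k.im, ?_⟩
  conv_lhs => rw [hk]
  rw [algebraMap_zt]
  simp only [map_add, map_mul]
  linear_combination (-(algebraMap Lz S.K k.im * omega)) * h

theorem eq_of_add_mul_zt_eq {p q p' q' : Lz}
    (h : algebraMap Lz S.K p + algebraMap Lz S.K q * algebraMap S.O S.K S.zt
      = algebraMap Lz S.K p' + algebraMap Lz S.K q' * algebraMap S.O S.K S.zt) :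
    p = p' ∧ q = q' := by
  rw [algebraMap_zt, ← map_ofNat (algebraMap Lz S.K) 2] at h
  have him := congrArg QuadraticAlgebra.im h
  have hre := congrArg QuadraticAlgebra.re h
  simp at him hre
  subst him
  exact ⟨by simpa using hre, rfl⟩

theorem exists_eq_add_mul_zt_powerSeries (k : S.K⟦X⟧) : ∃ p q : Lz⟦X⟧,
    k = algebraMap Lz⟦X⟧ S.K⟦X⟧ p
      + algebraMap Lz⟦X⟧ S.K⟦X⟧ q * PowerSeries.C (algebraMap S.O S.K S.zt) := by
  choose p q h using fun n => S.exists_eq_add_mul_zt_K (PowerSeries.coeff n k)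
  refine ⟨PowerSeries.mk p, PowerSeries.mk q, PowerSeries.ext fun n => ?_⟩
  rw [map_add, PowerSeries.coeff_mul_C, coeff_algebraMap, coeff_algebraMap, PowerSeries.coeff_mk,
    PowerSeries.coeff_mk, h]

theorem eq_of_add_mul_zt_powerSeries_eq {p q p' q' : Lz⟦X⟧}
    (h : algebraMap Lz⟦X⟧ S.K⟦X⟧ p
      + algebraMap Lz⟦X⟧ S.K⟦X⟧ q * PowerSeries.C (algebraMap S.O S.K S.zt)
      = algebraMap Lz⟦X⟧ S.K⟦X⟧ p'
      + algebraMap Lz⟦X⟧ S.K⟦X⟧ q' * PowerSeries.C (algebraMap S.O S.K S.zt)) :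
    p = p' ∧ q = q' := by
  have h1 : ∀ n, PowerSeries.coeff n p = PowerSeries.coeff n p' ∧
      PowerSeries.coeff n q = PowerSeries.coeff n q' := by
    intro n
    have := congrArg (PowerSeries.coeff n) h
    rw [map_add, map_add, PowerSeries.coeff_mul_C, PowerSeries.coeff_mul_C, coeff_algebraMap,
      coeff_algebraMap, coeff_algebraMap, coeff_algebraMap] at this
    exact S.eq_of_add_mul_zt_eq this
  exact ⟨PowerSeries.ext fun n => (h1 n).1, PowerSeries.ext fun n => (h1 n).2⟩

theorem _root_.LambdaConn.algebraMap_C_inv_two :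
    algebraMap ℂ⟦X⟧ Lz (PowerSeries.C 2⁻¹) = 2⁻¹ := by
  apply eq_inv_of_mul_eq_one_left
  rw [← map_ofNat (algebraMap ℂ⟦X⟧ Lz) 2, ← map_mul, ← map_ofNat PowerSeries.C 2, ← map_mul,
    inv_mul_cancel₀ two_ne_zero, map_one, map_one]

/-- The connection form `ξ dz - λ dz̃ / (2 z̃)`, divided by `dz`. -/
def normalForm : S.K⟦X⟧ :=
  PowerSeries.C omega - PowerSeries.X * PowerSeries.C (algebraMap Lz S.K 2⁻¹ * S.logFactor)

/-- The Riccati solution of a second order equation which is regular on the disc is gauge equivalent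
to the normal form. -/
theorem exists_gauge_riccati {A B : ℂ⟦X⟧⟦X⟧} {a : S.K⟦X⟧}
    (hA : PowerSeries.constantCoeff A = -S.d) (hB : PowerSeries.constantCoeff B = S.t)
    (ha : PowerSeries.constantCoeff a = omega)
    (h : PowerSeries.X * coeffDeriv S.ddzS a + a * a
        = algebraMap Lz⟦X⟧ S.K⟦X⟧ (algebraMap ℂ⟦X⟧⟦X⟧ Lz⟦X⟧ A)
          + algebraMap Lz⟦X⟧ S.K⟦X⟧ (algebraMap ℂ⟦X⟧⟦X⟧ Lz⟦X⟧ B) * a) :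
    ∃ (u : S.K⟦X⟧) (v : S.O), IsUnit v ∧ PowerSeries.constantCoeff u = algebraMap S.O S.K v ∧
      PowerSeries.X * coeffDeriv S.ddzS u = (a - S.normalForm) * u := by
  obtain ⟨p, q, rfl⟩ := S.exists_eq_add_mul_zt_powerSeries a
  obtain ⟨A', hA'⟩ := exists_eq_C_add_X_mul A
  obtain ⟨B', hB'⟩ := exists_eq_C_add_X_mul B
  rw [hA] at hA'
  rw [hB] at hB'
  obtain ⟨p', hp'⟩ := exists_eq_C_add_X_mul p
  obtain ⟨q', hq'⟩ := exists_eq_C_add_X_mul q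
  have h2 : (2⁻¹ : Lz) * 2 = 1 := inv_mul_cancel₀ two_ne_zero
  have h2K := congrArg (algebraMap Lz S.K) h2
  rw [map_mul, map_ofNat, map_one] at h2K
  have h2P := congrArg (PowerSeries.C (R := Lz)) h2
  rw [map_mul, map_ofNat, map_one] at h2P
  set t' := algebraMap ℂ⟦X⟧ Lz S.t with ht'
  set d' := algebraMap ℂ⟦X⟧ Lz S.d with hd'
  set Δ := algebraMap ℂ⟦X⟧ Lz S.disc with hΔ
  have hΔ' : Δ = t' ^ 2 - 4 * d' := by
    simp only [hΔ, ht', hd', disc, map_sub, map_mul, map_pow, map_ofNat]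
  have h0 : PowerSeries.constantCoeff p = 2⁻¹ * t' ∧ PowerSeries.constantCoeff q = 2⁻¹ := by
    apply S.eq_of_add_mul_zt_eq
    rw [map_add, map_mul, PowerSeries.constantCoeff_C, constantCoeff_algebraMap,
      constantCoeff_algebraMap] at ha
    rw [ha, S.algebraMap_zt, map_mul]
    linear_combination (-omega) * h2K
  rw [h0.1] at hp'
  rw [h0.2] at hq'
  let l : Lz := algebraMap ℂ⟦X⟧ Lz (ddz S.disc) / (2 * Δ)
  have hl : S.logFactor = algebraMap Lz S.K l := rfl
  set A₁ := algebraMap ℂ⟦X⟧⟦X⟧ Lz⟦X⟧ A' with hA₁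
  set B₁ := algebraMap ℂ⟦X⟧⟦X⟧ Lz⟦X⟧ B' with hB₁
  have hA₂ : algebraMap ℂ⟦X⟧⟦X⟧ Lz⟦X⟧ A = -PowerSeries.C d' + PowerSeries.X * A₁ := by
    rw [hA', map_add, map_mul, algebraMap_C, algebraMap_X, map_neg, map_neg]
  have hB₂ : algebraMap ℂ⟦X⟧⟦X⟧ Lz⟦X⟧ B = PowerSeries.C t' + PowerSeries.X * B₁ := by
    rw [hB', map_add, map_mul, algebraMap_C, algebraMap_X]
  -- The even and odd parts of the Riccati equation for `a = p + q z̃`. The extra term with `l`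
  -- comes from `z̃' = l z̃`.
  have hsplit := S.eq_of_add_mul_zt_powerSeries_eq
    (p := PowerSeries.X * coeffDeriv ddzK p + p * p + q * q * PowerSeries.C Δ)
    (q := PowerSeries.X * (coeffDeriv ddzK q + q * PowerSeries.C l) + 2 * p * q)
    (p' := algebraMap ℂ⟦X⟧⟦X⟧ Lz⟦X⟧ A + algebraMap ℂ⟦X⟧⟦X⟧ Lz⟦X⟧ B * p)
    (q' := algebraMap ℂ⟦X⟧⟦X⟧ Lz⟦X⟧ B * q) (by
      rw [map_add, coeffDeriv_mul, coeffDeriv_ddzS_algebraMap, coeffDeriv_ddzS_algebraMap,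
        coeffDeriv_C, ddzS_zt, hl] at h
      have hz := congrArg (PowerSeries.C (R := S.K)) S.algebraMap_zt_sq
      simp only [map_add, map_mul, algebraMap_X, algebraMap_C, map_ofNat] at h hz ⊢
      linear_combination h - algebraMap Lz⟦X⟧ S.K⟦X⟧ q * algebraMap Lz⟦X⟧ S.K⟦X⟧ q * hz)
  obtain ⟨heven, hodd⟩ := hsplit
  have hqu : IsUnit q := by
    rw [PowerSeries.isUnit_iff_constantCoeff, h0.2, isUnit_iff_ne_zero]
    exact inv_ne_zero two_ne_zero
  obtain ⟨r, hr⟩ := hqu.exists_right_inv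
  have hX : ∀ x y : Lz⟦X⟧, PowerSeries.X * x = PowerSeries.X * y → x = y :=
    fun x y hxy => mul_left_cancel₀ PowerSeries.X_ne_zero hxy
  -- The odd equation divided by `λ` and by the unit `q` determines the even part of `a`. The term
  -- `-l / 2` is the `λ`-term of `normalForm`, that is, the residue `-λ/2`.
  have hodd' : p' = PowerSeries.C 2⁻¹ * (B₁ - PowerSeries.C l - coeffDeriv ddzK q * r) := by
    have h3 := hX (coeffDeriv ddzK q + q * PowerSeries.C l + 2 * p' * q) (B₁ * q) (by
      rw [hB₂, hp', map_mul] at hodd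
      linear_combination hodd - PowerSeries.C t' * q * h2P)
    linear_combination PowerSeries.C 2⁻¹ * r * h3 - p' * h2P
      + PowerSeries.C 2⁻¹ * (B₁ - PowerSeries.C l - 2 * p') * hr
  -- The even equation in degree one in `λ`. The contributions of `p'`, which contains the pole of
  -- `l`, cancel because `p ≡ t / 2`; hence the leading coefficient of `q'` has at most a simple
  -- pole in `z`.
  have heven' : Δ * PowerSeries.constantCoeff q' = algebraMap ℂ⟦X⟧ Lz
      (PowerSeries.constantCoeff A' + PowerSeries.C 2⁻¹ *
        (PowerSeries.constantCoeff B' * S.t - ddz S.t)) := by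
    have hdt : ddzK (2⁻¹ * t') = 2⁻¹ * algebraMap ℂ⟦X⟧ Lz (ddz S.t) := by
      rw [Der.leibniz, ddzK_inv_two, mul_zero, add_zero, ht', ddzK_algebraMap]
    have h3 := hX (PowerSeries.C (ddzK (2⁻¹ * t')) + PowerSeries.X * coeffDeriv ddzK p'
        + p' * PowerSeries.C t' + PowerSeries.X * p' * p' + PowerSeries.C Δ * (q'
          + PowerSeries.X * q' * q'))
      (A₁ + PowerSeries.C t' * p' + B₁ * PowerSeries.C (2⁻¹ * t') + PowerSeries.X * B₁ * p') (by
      have hΔP := congrArg (PowerSeries.C (R := Lz)) hΔ'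
      simp only [map_sub, map_mul, map_pow, map_ofNat] at hΔP
      rw [hA₂, hB₂, hp', hq', map_add, coeffDeriv_mul, coeffDeriv_C, coeffDeriv_X, zero_mul,
        add_zero] at heven
      have h2C : PowerSeries.C (2⁻¹ * t') = PowerSeries.C 2⁻¹ * PowerSeries.C t' := map_mul _ _ _
      rw [h2C] at heven ⊢
      linear_combination heven - PowerSeries.C 2⁻¹ ^ 2 * hΔP
        + (PowerSeries.C d' * (2 * PowerSeries.C 2⁻¹ + 1) - PowerSeries.X * p' * PowerSeries.C t'
          - PowerSeries.X * PowerSeries.C Δ * q' - PowerSeries.C t' ^ 2 * PowerSeries.C 2⁻¹)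
          * h2P)
    have h4 := congrArg PowerSeries.constantCoeff h3
    simp only [map_add, map_mul, PowerSeries.constantCoeff_X, PowerSeries.constantCoeff_C,
      zero_mul, add_zero, hdt, hA₁, hB₁, constantCoeff_algebraMap] at h4
    simp only [map_add, map_sub, map_mul, algebraMap_C_inv_two]
    linear_combination h4
  -- What remains of `a` after subtracting the normal form and dividing by `λ`.
  let e : S.K⟦X⟧ := algebraMap Lz⟦X⟧ S.K⟦X⟧ (PowerSeries.C 2⁻¹ * (B₁ - coeffDeriv ddzK q * r))
    + algebraMap Lz⟦X⟧ S.K⟦X⟧ q' * PowerSeries.C (algebraMap S.O S.K S.zt)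
  have he : PowerSeries.X * e = algebraMap Lz⟦X⟧ S.K⟦X⟧ p
      + algebraMap Lz⟦X⟧ S.K⟦X⟧ q * PowerSeries.C (algebraMap S.O S.K S.zt) - S.normalForm := by
    rw [hp', hq', hodd', normalForm, hl, S.algebraMap_zt]
    simp only [e, map_add, map_sub, map_mul, algebraMap_X, algebraMap_C, map_ofNat,
      S.algebraMap_zt]
    have h2' := congrArg (PowerSeries.C (R := S.K)) h2K
    rw [map_mul, map_ofNat, map_one] at h2'
    rw [hq']
    linear_combination (-PowerSeries.C omega) * h2'
  obtain ⟨u, v, hv, huv, hu⟩ := S.exists_gauge e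
    (y := S.zt * algebraMap ℂ⟦X⟧ S.O (PowerSeries.C 2⁻¹ * PowerSeries.constantCoeff B')
      + algebraMap ℂ⟦X⟧ S.O (PowerSeries.constantCoeff A' + PowerSeries.C 2⁻¹ *
        (PowerSeries.constantCoeff B' * S.t - ddz S.t))) (by
      -- Modulo `λ`, `q` is the constant `1/2`, so its logarithmic derivative does not contribute to
      -- `e` in degree zero.
      have hq0 : PowerSeries.constantCoeff (coeffDeriv ddzK q) = 0 := by
        rw [constantCoeff_coeffDeriv, h0.2, ddzK_inv_two]
      have h5 := congrArg (algebraMap Lz S.K) heven'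
      simp only [e, map_add, map_mul, PowerSeries.constantCoeff_C, constantCoeff_algebraMap,
        map_sub, hq0, map_zero, hB₁, algebraMap_O_K, algebraMap_C_inv_two] at h5 ⊢
      linear_combination h5 + algebraMap Lz S.K (PowerSeries.constantCoeff q')
        * S.algebraMap_zt_sq) (by
      intro n
      have hA : ∀ n : ℕ, IsUnit ((n + 1 : ℕ) : Lz) := fun n => by
        rw [isUnit_iff_ne_zero]; exact Nat.cast_ne_zero.2 n.succ_ne_zero
      -- Three exact pieces in positive degree: a regular power series in `z`, a logarithmic
      -- derivative, and an odd form without residue.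
      obtain ⟨x, hx⟩ := exists_ddz_eq (PowerSeries.coeff (n + 1) B')
      obtain ⟨y, hy⟩ := exists_log hA ddzK hr n
      obtain ⟨w, hw⟩ := S.exists_ddzS_eq_mul_zt (PowerSeries.coeff (n + 1) q')
      refine ⟨algebraMap Lz S.K (2⁻¹ * (algebraMap ℂ⟦X⟧ Lz x - y)) + w, ?_⟩
      rw [map_add, ddzS_algebraMap, Der.leibniz, ddzK_inv_two, mul_zero, add_zero, map_sub,
        ddzK_algebraMap, hx, hy, hw]
      simp only [e, hB₁, map_add, PowerSeries.coeff_mul_C, coeff_algebraMap,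
        PowerSeries.coeff_C_mul,
        map_sub])
  refine ⟨u, v, hv, huv, ?_⟩
  rw [← he, hu]
  ring

end SpectralCurve

/-! ### Extension of scalars is faithful, and full on morphisms with regular matrices -/

section Extend

variable {R A : Type} [CommRing R] [CommRing A] [Algebra R A] {DR : Der R} {DA : Der A}

theorem algebraMap_powerSeries_injective (hRA : Function.Injective (algebraMap R A)) :
    Function.Injective (algebraMap R⟦X⟧ A⟦X⟧) := by
  intro f g h
  ext n
  apply hRA
  rw [← coeff_algebraMap, h, coeff_algebraMap]

/-- In the coordinates of the base-changed basis the map is the coefficientwise inclusion of `R⟦λ⟧`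
into `A⟦λ⟧`. -/
theorem one_tmul_injective (hRA : Function.Injective (algebraMap R A)) {ι M : Type}
    [AddCommGroup M] [Module R⟦X⟧ M] (b : Module.Basis ι R⟦X⟧ M) :
    Function.Injective fun m : M => (1 : A⟦X⟧) ⊗ₜ[R⟦X⟧] m := by
  intro m m' h
  apply b.ext_elem
  intro i
  have h1 := congrArg (fun x => (b.baseChange A⟦X⟧).repr x i) h
  simp only [Module.Basis.baseChange_repr_tmul, Algebra.smul_def, mul_one] at h1
  exact algebraMap_powerSeries_injective hRA h1

theorem extend_faithful (hRA : Function.Injective (algebraMap R A)) (u : A)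
    (h : ∀ r, DA (algebraMap R A r) = u * algebraMap R A (DR r)) (n : ℕ) :
    (extend u h n).Faithful where
  map_injective {M N} f g hfg := by
    apply LamMod.Hom.ext
    ext m
    apply one_tmul_injective (A := A) hRA N.free.some
    have := congrArg (fun k : LatMod.Hom ((extend u h n).obj M) ((extend u h n).obj N) =>
      k.equiv ((1 : A⟦X⟧) ⊗ₜ[R⟦X⟧] m)) hfg
    exact this

theorem exists_one_tmul_eq_of_basis {ι M N : Type} [AddCommGroup M] [Module R⟦X⟧ M]
    [AddCommGroup N] [Module R⟦X⟧ N] (b : Module.Basis ι R⟦X⟧ M)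
    (f : A⟦X⟧ ⊗[R⟦X⟧] M →ₗ[A⟦X⟧] A⟦X⟧ ⊗[R⟦X⟧] N)
    (hf : ∀ i, ∃ y : N, f (1 ⊗ₜ b i) = 1 ⊗ₜ y) (m : M) : ∃ y : N, f (1 ⊗ₜ m) = 1 ⊗ₜ y := by
  have hm : m ∈ Submodule.span R⟦X⟧ (Set.range b) := by rw [b.span_eq]; trivial
  induction hm using Submodule.span_induction with
  | mem x hx =>
    obtain ⟨i, rfl⟩ := hx
    exact hf i
  | zero => exact ⟨0, by simp⟩
  | add x y _ _ hx hy =>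
    obtain ⟨x', hx'⟩ := hx
    obtain ⟨y', hy'⟩ := hy
    exact ⟨x' + y', by rw [TensorProduct.tmul_add, map_add, hx', hy', TensorProduct.tmul_add]⟩
  | smul a x _ hx =>
    obtain ⟨x', hx'⟩ := hx
    exact ⟨a • x', by
      rw [TensorProduct.tmul_smul, ← algebraMap_smul A⟦X⟧ a, map_smul, hx', algebraMap_smul,
        TensorProduct.tmul_smul]⟩

/-- A free module embeds in its extension of scalars. An isomorphism that, together with its
inverse, preserves these submodules restricts to an isomorphism of them, which determines it. -/
theorem exists_extend_map_eq (hRA : Function.Injective (algebraMap R A)) {u : A} (hu : IsUnit u)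
    (h : ∀ r, DA (algebraMap R A r) = u * algebraMap R A (DR r)) {n : ℕ} {M N : LamMod DR n}
    (f : LatMod.Hom ((extend u h n).obj M) ((extend u h n).obj N))
    (h1 : ∀ m : M.carrier, ∃ y : N.carrier,
      f.equiv ((1 : A⟦X⟧) ⊗ₜ[R⟦X⟧] m) = (1 : A⟦X⟧) ⊗ₜ[R⟦X⟧] y)
    (h2 : ∀ y : N.carrier, ∃ m : M.carrier,
      f.equiv.symm ((1 : A⟦X⟧) ⊗ₜ[R⟦X⟧] y) = (1 : A⟦X⟧) ⊗ₜ[R⟦X⟧] m) :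
    ∃ g : LamMod.Hom M N, (extend u h n).map g = f := by
  have hM := one_tmul_injective (A := A) hRA M.free.some
  have hN := one_tmul_injective (A := A) hRA N.free.some
  choose g hg using h1
  choose g' hg' using h2
  have hsmul : ∀ (a : R⟦X⟧) (m : M.carrier), f.equiv ((1 : A⟦X⟧) ⊗ₜ[R⟦X⟧] (a • m))
      = (1 : A⟦X⟧) ⊗ₜ[R⟦X⟧] (a • g m) := by
    intro a m
    rw [TensorProduct.tmul_smul, ← algebraMap_smul A⟦X⟧ a]
    refine (f.equiv.map_smul _ _).trans ?_
    rw [hg]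
    have h3 : algebraMap R⟦X⟧ A⟦X⟧ a • ((1 : A⟦X⟧) ⊗ₜ[R⟦X⟧] g m)
        = (1 : A⟦X⟧) ⊗ₜ[R⟦X⟧] (a • g m) := by
      rw [algebraMap_smul, TensorProduct.tmul_smul]
    exact h3
  let e : M.carrier ≃ₗ[R⟦X⟧] N.carrier :=
    { toFun := g
      invFun := g'
      map_add' := fun x y => hN (by
        dsimp only
        rw [← hg, TensorProduct.tmul_add, TensorProduct.tmul_add, ← hg, ← hg]
        exact f.equiv.map_add _ _)
      map_smul' := fun a x => hN (by
        dsimp only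
        rw [← hg]
        exact hsmul a x)
      left_inv := fun x => hM (by
        dsimp only
        rw [← hg', ← hg]
        exact f.equiv.symm_apply_apply _)
      right_inv := fun x => hN (by
        dsimp only
        rw [← hg, ← hg']
        exact f.equiv.apply_symm_apply _) }
  have he : ∀ m, (1 : A⟦X⟧) ⊗ₜ[R⟦X⟧] e m = f.equiv ((1 : A⟦X⟧) ⊗ₜ[R⟦X⟧] m) := fun m => (hg m).symm
  -- The extended connection is `u` times the original one on the submodule, so `u` must be
  -- cancelled to compare the original connections.
  have huX : IsUnit (PowerSeries.C u : A⟦X⟧) := hu.map _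
  refine ⟨⟨e, fun s => hN ?_⟩, ?_⟩
  · have hc := f.comm ((1 : A⟦X⟧) ⊗ₜ[R⟦X⟧] s)
    rw [← he] at hc
    change f.equiv (extendConn u h M.conn ((1 : A⟦X⟧) ⊗ₜ[R⟦X⟧] s))
      = extendConn u h N.conn ((1 : A⟦X⟧) ⊗ₜ[R⟦X⟧] e s) at hc
    have hs : ∀ (L : LamMod DR n) (s : L.carrier),
        extendConn u h L.conn ((1 : A⟦X⟧) ⊗ₜ[R⟦X⟧] s)
          = (PowerSeries.C u : A⟦X⟧) • ((1 : A⟦X⟧) ⊗ₜ[R⟦X⟧] L.conn s) := by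
      intro L s
      rw [extendConn_tmul, coeffDeriv_one, mul_zero, TensorProduct.zero_tmul, add_zero,
        TensorProduct.smul_tmul', smul_eq_mul]
    rw [hs, hs] at hc
    have hc' := (f.equiv.map_smul (PowerSeries.C u : A⟦X⟧) _).symm.trans hc
    rw [← he] at hc'
    exact (huX.smul_left_cancel).1 hc'
  · apply LatMod.Hom.ext
    apply LinearEquiv.ext
    intro x
    induction x using TensorProduct.induction_on with
    | zero => exact (map_zero _).trans (f.equiv.map_zero).symm
    | add x y hx hy =>
      exact (map_add _ _ _).trans ((congrArg₂ _ hx hy).trans (f.equiv.map_add _ _).symm)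
    | tmul a m =>
      have h3 : a ⊗ₜ[R⟦X⟧] m = a • ((1 : A⟦X⟧) ⊗ₜ[R⟦X⟧] m) := by
        rw [TensorProduct.smul_tmul', smul_eq_mul, mul_one]
      rw [h3]
      refine Eq.trans ?_ (f.equiv.map_smul _ _).symm
      rw [← he]
      refine (LinearEquiv.map_smul _ _ _).trans ?_
      rfl

end Extend

/-! ### Cyclic vectors -/

section Cyclic

variable {A : Type} [CommRing A] {D : Der A} {M N : Type} [AddCommGroup M] [Module A⟦X⟧ M]
  [AddCommGroup N] [Module A⟦X⟧ N]

/-- A linear map which commutes with `λ`-connections on a basis commutes with them. -/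
theorem LambdaConnection.comm_of_basis {ι : Type} (b : Module.Basis ι A⟦X⟧ M)
    (c : LambdaConnection D M) (c' : LambdaConnection D N) (f : M →ₗ[A⟦X⟧] N)
    (h : ∀ i, f (c (b i)) = c' (f (b i))) (s : M) : f (c s) = c' (f s) := by
  have hs : s ∈ Submodule.span A⟦X⟧ (Set.range b) := by rw [b.span_eq]; trivial
  induction hs using Submodule.span_induction with
  | mem x hx =>
    obtain ⟨i, rfl⟩ := hx
    exact h i
  | zero => simp
  | add x y _ _ hx hy => simp only [map_add, hx, hy]
  | smul a x _ hx => simp only [LambdaConnection.leibniz, map_add, map_smul, hx]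

/-- A basis `v, ∇ v` in which the `λ`-connection has a companion matrix. -/
structure IsCompanion (c : LambdaConnection D M) (b : Module.Basis (Fin 2) A⟦X⟧ M)
    (P Q : A⟦X⟧) : Prop where
  apply_zero : c (b 0) = b 1
  apply_one : c (b 1) = P • b 0 + Q • b 1

/-- A vector is cyclic if it and its derivative have invertible determinant modulo `λ`. -/
theorem exists_isCompanion_of_isUnit (c : LambdaConnection D M) (b : Module.Basis (Fin 2) A⟦X⟧ M)
    (v : M) (h : IsUnit (PowerSeries.constantCoeff
      (b.repr v 0 * b.repr (c v) 1 - b.repr (c v) 0 * b.repr v 1))) :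
    ∃ b' P Q, b' 0 = v ∧ IsCompanion c b' P Q := by
  have hd : IsUnit (b.det ![v, c v]) := by
    rw [Module.Basis.det_apply, Matrix.det_fin_two, PowerSeries.isUnit_iff_constantCoeff]
    simpa [Module.Basis.toMatrix_apply] using h
  obtain ⟨hli, hsp⟩ := b.is_basis_iff_det.2 hd
  let b' := Module.Basis.mk hli hsp.ge
  have h0 : b' 0 = v := by simp [b']
  have h1 : b' 1 = c v := by simp [b']
  refine ⟨b', b'.repr (c (b' 1)) 0, b'.repr (c (b' 1)) 1, h0, by rw [h0, h1], ?_⟩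
  conv_lhs => rw [← b'.sum_repr (c (b' 1))]
  rw [Fin.sum_univ_two]

theorem trace_red (c : LambdaConnection D M) (b : Module.Basis (Fin 2) A⟦X⟧ M) :
    LinearMap.trace A _ (c.red A) = PowerSeries.constantCoeff (b.repr (c (b 0)) 0)
      + PowerSeries.constantCoeff (b.repr (c (b 1)) 1) := by
  rw [LinearMap.trace_eq_matrix_trace A (Red.basis b), Matrix.trace_fin_two]
  simp only [LinearMap.toMatrix_apply, Red.basis_apply, LambdaConnection.red_mk, Red.basis_repr_mk]

theorem det_red (c : LambdaConnection D M) (b : Module.Basis (Fin 2) A⟦X⟧ M) :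
    LinearMap.det (c.red A) = PowerSeries.constantCoeff (b.repr (c (b 0)) 0)
      * PowerSeries.constantCoeff (b.repr (c (b 1)) 1)
      - PowerSeries.constantCoeff (b.repr (c (b 1)) 0)
      * PowerSeries.constantCoeff (b.repr (c (b 0)) 1) := by
  rw [← LinearMap.det_toMatrix (Red.basis b), Matrix.det_fin_two]
  simp only [LinearMap.toMatrix_apply, Red.basis_apply, LambdaConnection.red_mk, Red.basis_repr_mk]

theorem IsCompanion.trace {c : LambdaConnection D M} {b : Module.Basis (Fin 2) A⟦X⟧ M}
    {P Q : A⟦X⟧} (h : IsCompanion c b P Q) :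
    LinearMap.trace A _ (c.red A) = PowerSeries.constantCoeff Q := by
  rw [trace_red c b, h.apply_zero, h.apply_one]
  simp

theorem IsCompanion.det {c : LambdaConnection D M} {b : Module.Basis (Fin 2) A⟦X⟧ M}
    {P Q : A⟦X⟧} (h : IsCompanion c b P Q) :
    LinearMap.det (c.red A) = -PowerSeries.constantCoeff P := by
  rw [det_red c b, h.apply_zero, h.apply_one]
  simp

theorem IsCompanion.extend {B : Type} [CommRing B] [Algebra A B] {DB : Der B}
    {c : LambdaConnection D M} {b : Module.Basis (Fin 2) A⟦X⟧ M}
    {P Q : A⟦X⟧} (h : IsCompanion c b P Q)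
    (hD : ∀ r, DB (algebraMap A B r) = 1 * algebraMap A B (D r)) :
    IsCompanion (extendConn 1 hD c) (b.baseChange B⟦X⟧) (algebraMap A⟦X⟧ B⟦X⟧ P)
      (algebraMap A⟦X⟧ B⟦X⟧ Q) := by
  constructor
  · simp [extendConn_tmul, h.apply_zero]
  · simp [extendConn_tmul, h.apply_one, TensorProduct.tmul_add]

end Cyclic

namespace SpectralCurve

variable (S : SpectralCurve)

/-- If neither basis vector is cyclic, both off-diagonal entries of the Higgs field vanish at `z =
0`. The discriminant is `(p - s)² + 4` times the product of these entries, so `p - s` vanishes there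
too and the discriminant has a double zero, contrary to smoothness. -/
theorem exists_isCompanion_conn {M : Type} [AddCommGroup M] [Module ℂ⟦X⟧⟦X⟧ M]
    (c : LambdaConnection ddz M) (b : Module.Basis (Fin 2) ℂ⟦X⟧⟦X⟧ M)
    (htr : LinearMap.trace ℂ⟦X⟧ _ (c.red ℂ⟦X⟧) = S.t) (hdet : LinearMap.det (c.red ℂ⟦X⟧) = S.d) :
    ∃ b' P Q, IsCompanion c b' P Q ∧ PowerSeries.constantCoeff P = -S.d ∧
      PowerSeries.constantCoeff Q = S.t := by
  suffices h : ∃ b' P Q, IsCompanion c b' P Q by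
    obtain ⟨b', P, Q, h⟩ := h
    exact ⟨b', P, Q, h, by rw [← hdet, h.det, neg_neg], by rw [← htr, h.trace]⟩
  by_cases h0 : IsUnit (PowerSeries.constantCoeff (b.repr (c (b 0)) 1))
  · obtain ⟨b', P, Q, -, h⟩ := exists_isCompanion_of_isUnit c b (b 0) (by simpa using h0)
    exact ⟨b', P, Q, h⟩
  by_cases h1 : IsUnit (PowerSeries.constantCoeff (b.repr (c (b 1)) 0))
  · obtain ⟨b', P, Q, -, h⟩ := exists_isCompanion_of_isUnit c b (b 1) (by simpa using h1)
    exact ⟨b', P, Q, h⟩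
  exfalso
  rw [trace_red c b] at htr
  rw [det_red c b] at hdet
  obtain ⟨U, hU, hD⟩ := S.exists_disc_eq
  rw [disc, ← htr, ← hdet] at hD
  rw [PowerSeries.isUnit_iff_constantCoeff, isUnit_iff_ne_zero, not_not] at h0 h1
  rw [PowerSeries.isUnit_iff_constantCoeff, isUnit_iff_ne_zero] at hU
  generalize PowerSeries.constantCoeff (b.repr (c (b 0)) 0) = p at *
  generalize PowerSeries.constantCoeff (b.repr (c (b 1)) 1) = s at *
  obtain ⟨q, hq⟩ := PowerSeries.X_dvd_iff.2 h0
  obtain ⟨r, hr⟩ := PowerSeries.X_dvd_iff.2 h1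
  rw [hq, hr] at hD
  have hps : PowerSeries.constantCoeff (p - s) = 0 := by
    have := congrArg PowerSeries.constantCoeff hD
    simp only [map_sub, map_add, map_mul, map_pow, PowerSeries.constantCoeff_X, map_ofNat] at this
    rw [← sq_eq_zero_iff, map_sub]
    linear_combination this
  obtain ⟨w, hw⟩ := PowerSeries.X_dvd_iff.2 hps
  apply hU
  rw [← PowerSeries.X_dvd_iff]
  refine ⟨w * w + 4 * q * r, mul_left_cancel₀ (PowerSeries.X_ne_zero (R := ℂ)) ?_⟩
  rw [← hD]
  linear_combination (p - s + PowerSeries.X * w) * hw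

/-- Over the field `ℂ((z))`, a nonzero off-diagonal entry of the Higgs field makes a basis vector
cyclic. Otherwise the field is diagonal with distinct eigenvalues, since the discriminant is
nonzero, and the sum of the basis vectors is cyclic. -/
theorem exists_isCompanion_punctured {M : Type} [AddCommGroup M] [Module Lz⟦X⟧ M]
    (c : LambdaConnection ddzK M) (b : Module.Basis (Fin 2) Lz⟦X⟧ M)
    (htr : LinearMap.trace Lz _ (c.red Lz) = algebraMap ℂ⟦X⟧ Lz S.t)
    (hdet : LinearMap.det (c.red Lz) = algebraMap ℂ⟦X⟧ Lz S.d) :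
    ∃ b' P Q, IsCompanion c b' P Q ∧ PowerSeries.constantCoeff P = -algebraMap ℂ⟦X⟧ Lz S.d ∧
      PowerSeries.constantCoeff Q = algebraMap ℂ⟦X⟧ Lz S.t := by
  suffices h : ∃ b' P Q, IsCompanion c b' P Q by
    obtain ⟨b', P, Q, h⟩ := h
    exact ⟨b', P, Q, h, by rw [← hdet, h.det, neg_neg], by rw [← htr, h.trace]⟩
  by_cases h0 : PowerSeries.constantCoeff (b.repr (c (b 0)) 1) = 0
  swap
  · obtain ⟨b', P, Q, -, h⟩ := exists_isCompanion_of_isUnit c b (b 0) (by simpa using h0)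
    exact ⟨b', P, Q, h⟩
  by_cases h1 : PowerSeries.constantCoeff (b.repr (c (b 1)) 0) = 0
  swap
  · obtain ⟨b', P, Q, -, h⟩ := exists_isCompanion_of_isUnit c b (b 1) (by simpa using h1)
    exact ⟨b', P, Q, h⟩
  obtain ⟨b', P, Q, -, h⟩ := exists_isCompanion_of_isUnit c b (b 0 + b 1) (by
    rw [trace_red c b] at htr
    rw [det_red c b, h0, h1] at hdet
    have hD := S.disc_ne_zero'
    rw [disc, map_sub, map_pow, map_mul, map_ofNat, ← htr, ← hdet] at hD
    rw [isUnit_iff_ne_zero]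
    simp only [map_add, Module.Basis.repr_self, Finsupp.add_apply, map_sub, map_mul, h0, h1]
    simp only [Finsupp.single_apply]
    intro h
    apply hD
    simp at h
    linear_combination (PowerSeries.constantCoeff (b.repr (c (b 1)) 1)
      - PowerSeries.constantCoeff (b.repr (c (b 0)) 0)) * h)
  exact ⟨b', P, Q, h⟩

end SpectralCurve

/-! ### Regularity of morphisms and full faithfulness of the two localization functors -/

theorem coeffDeriv_X_pow_mul {A : Type} [CommRing A] (D : Der A) (n : ℕ) (f : A⟦X⟧) :
    coeffDeriv D (PowerSeries.X ^ n * f) = PowerSeries.X ^ n * coeffDeriv D f := by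
  induction n with
  | zero => simp
  | succ n ih =>
    rw [pow_succ', mul_assoc, coeffDeriv_mul, coeffDeriv_X, ih]
    ring

theorem coeffDeriv_ddzK_algebraMap (f : ℂ⟦X⟧⟦X⟧) :
    coeffDeriv ddzK (algebraMap ℂ⟦X⟧⟦X⟧ Lz⟦X⟧ f)
      = algebraMap ℂ⟦X⟧⟦X⟧ Lz⟦X⟧ (coeffDeriv ddz f) := by
  rw [coeffDeriv_algebraMap ddzK_algebraMap', map_one, one_mul]

/-- A power series is regular if all its coefficients are, which can be checked inductively. -/
theorem exists_algebraMap_eq_of_step {R A : Type} [CommRing R] [CommRing A] [Algebra R A]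
    {ι : Type} (k : ι → A⟦X⟧)
    (h : ∀ (n : ℕ) (k₀ : ι → R⟦X⟧) (k₁ : ι → A⟦X⟧),
      (∀ i, k i = algebraMap R⟦X⟧ A⟦X⟧ (k₀ i) + PowerSeries.X ^ n * k₁ i) →
      ∀ i, ∃ r, algebraMap R A r = PowerSeries.constantCoeff (k₁ i)) :
    ∀ i, ∃ k₀, algebraMap R⟦X⟧ A⟦X⟧ k₀ = k i := by
  have key : ∀ n : ℕ, ∃ (k₀ : ι → R⟦X⟧) (k₁ : ι → A⟦X⟧),
      ∀ i, k i = algebraMap R⟦X⟧ A⟦X⟧ (k₀ i) + PowerSeries.X ^ n * k₁ i := by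
    intro n
    induction n with
    | zero => exact ⟨0, k, fun i => by simp⟩
    | succ n ih =>
      obtain ⟨k₀, k₁, hk⟩ := ih
      choose r hr using h n k₀ k₁ hk
      choose k₂ hk₂ using fun i => exists_eq_C_add_X_mul (k₁ i)
      refine ⟨fun i => k₀ i + PowerSeries.X ^ n * PowerSeries.C (r i), k₂, fun i => ?_⟩
      rw [map_add, map_mul, map_pow, algebraMap_X, algebraMap_C, hr]
      linear_combination hk i + PowerSeries.X ^ n * hk₂ i
  intro i
  have hc : ∀ n, ∃ r, algebraMap R A r = PowerSeries.coeff n (k i) := by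
    intro n
    obtain ⟨k₀, k₁, hk⟩ := key (n + 1)
    refine ⟨PowerSeries.coeff n (k₀ i), ?_⟩
    rw [hk i, map_add, coeff_algebraMap, PowerSeries.coeff_X_pow_mul', if_neg (by lia), add_zero]
  choose r hr using hc
  exact ⟨PowerSeries.mk r, PowerSeries.ext fun n => by
    rw [coeff_algebraMap, PowerSeries.coeff_mk, hr]⟩

/-- Reads off degree `n`. After the regular part has been subtracted, this turns an identity for the
remainder `λ ^ n k₁` into an equation for its leading coefficient with a regular right-hand side. -/
theorem exists_constantCoeff_eq {R A : Type} [CommRing R] [CommRing A] [Algebra R A] {n : ℕ}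
    {f : A⟦X⟧} {g : R⟦X⟧} (h : PowerSeries.X ^ n * f = algebraMap R⟦X⟧ A⟦X⟧ g) :
    ∃ r, PowerSeries.constantCoeff f = algebraMap R A r := by
  refine ⟨PowerSeries.coeff n g, ?_⟩
  rw [← coeff_algebraMap, ← h, PowerSeries.coeff_X_pow_mul', if_pos le_rfl, Nat.sub_self]
  simp

namespace SpectralCurve

open QuadraticAlgebra

variable (S : SpectralCurve)

/-- A solution over the punctured curve of a rank one equation, with regular form that vanishes to
first order with respect to `z̃⁻¹ dz̃`, is regular. -/
theorem exists_algebraMap_eq_of_coeffDeriv_eq {k : S.K⟦X⟧} {c : S.O⟦X⟧}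
    (h : coeffDeriv S.ddzS k = PowerSeries.C S.logFactor *
      algebraMap S.O⟦X⟧ S.K⟦X⟧ (PowerSeries.C S.zt * c) * k) :
    ∃ k₀, algebraMap S.O⟦X⟧ S.K⟦X⟧ k₀ = k := by
  refine exists_algebraMap_eq_of_step (ι := Unit) (fun _ => k) ?_ ()
  intro n k₀ k₁ hk i
  have hk := hk i
  -- Once the regular part `k₀` is moved to the other side, the remainder satisfies the same
  -- equation with a regular inhomogeneous term, and its leading coefficient satisfies the scalar
  -- equation on the curve.
  rw [hk, map_add, coeffDeriv_algebraMap S.ddzS_algebraMap_O, coeffDeriv_X_pow_mul] at h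
  obtain ⟨w, hw⟩ := S.isUnit_logFactor.exists_right_inv
  have hw' := congrArg (PowerSeries.C (R := S.K)) hw
  rw [map_mul, map_one] at hw'
  obtain ⟨r, hr⟩ := exists_constantCoeff_eq (n := n)
    (f := PowerSeries.C w * coeffDeriv S.ddzS (k₁ i)
      - algebraMap S.O⟦X⟧ S.K⟦X⟧ (PowerSeries.C S.zt * c) * k₁ i)
    (g := PowerSeries.C S.zt * c * k₀ i - coeffDeriv S.theta (k₀ i)) (by
      rw [map_sub, map_mul _ (PowerSeries.C S.zt * c)]
      linear_combination PowerSeries.C w * h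
        + (algebraMap S.O⟦X⟧ S.K⟦X⟧ (PowerSeries.C S.zt * c) * (algebraMap S.O⟦X⟧ S.K⟦X⟧ (k₀ i)
          + PowerSeries.X ^ n * k₁ i)
        - algebraMap S.O⟦X⟧ S.K⟦X⟧ (coeffDeriv S.theta (k₀ i))) * hw')
  apply S.exists_algebraMap_eq_of_ddzS (c := PowerSeries.constantCoeff c) (r := r)
  rw [← hr]
  simp only [map_sub, map_mul, constantCoeff_coeffDeriv, PowerSeries.constantCoeff_C,
    constantCoeff_algebraMap]
  linear_combination (-S.ddzS (PowerSeries.constantCoeff (k₁ i))) * hw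

/-- Up to a unit, `z̃ d/dz` is the derivation `d/dz̃`, so the equation has no singularity at the
ramification point. -/
theorem exists_algebraMap_eq_of_zt_mul_ddzS {k : S.K} {c r : S.O}
    (h : algebraMap S.O S.K S.zt * S.ddzS k = algebraMap S.O S.K c * k + algebraMap S.O S.K r) :
    ∃ x, algebraMap S.O S.K x = k := by
  -- Chosen so that `logFactor * z̃² * e = 1`.
  let e : S.O := 2 * algebraMap ℂ⟦X⟧ S.O (ddz S.disc)⁻¹
  apply S.exists_algebraMap_eq_of_ddzS (c := e * c) (r := S.zt * e * r)
  have h1 := congrArg (fun x => algebraMap S.O S.K (algebraMap ℂ⟦X⟧ S.O x)) S.ddz_disc_mul_inv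
  have h2 := S.two_logFactor_zt_sq
  simp only [map_mul, map_one] at h1
  simp only [e, map_mul, map_ofNat]
  linear_combination (2 * S.logFactor * algebraMap S.O S.K S.zt
    * algebraMap S.O S.K (algebraMap ℂ⟦X⟧ S.O (ddz S.disc)⁻¹)) * h
    - (S.ddzS k * algebraMap S.O S.K (algebraMap ℂ⟦X⟧ S.O (ddz S.disc)⁻¹)) * h2
    - S.ddzS k * h1

theorem zt_mul_ddzS_omega : algebraMap S.O S.K S.zt * S.ddzS omega
    = algebraMap Lz S.K (algebraMap ℂ⟦X⟧ Lz (ddz S.t)) * omega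
      - algebraMap Lz S.K (algebraMap ℂ⟦X⟧ Lz (ddz S.d)) := by
  rw [ddzS_xi, ddzK_algebraMap, ddzK_algebraMap]
  linear_combination (algebraMap Lz S.K (algebraMap ℂ⟦X⟧ Lz (ddz S.t)) * omega
      - algebraMap Lz S.K (algebraMap ℂ⟦X⟧ Lz (ddz S.d))) * (S.algebraMap_disc_mul_inv
      + algebraMap Lz S.K (algebraMap ℂ⟦X⟧ Lz S.disc)⁻¹ * S.algebraMap_zt_sq)

/-- The system satisfied by the coordinates of a morphism between second order equations has
only regular solutions. -/
theorem exists_algebraMap_eq_of_system {x y : Lz} {α β r s : ℂ⟦X⟧}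
    (h1 : 2 * ddzK x + ddzK (y * algebraMap ℂ⟦X⟧ Lz S.t) + y * algebraMap ℂ⟦X⟧ Lz α
      + x * algebraMap ℂ⟦X⟧ Lz β + y * algebraMap ℂ⟦X⟧ Lz (β * S.t) = algebraMap ℂ⟦X⟧ Lz r)
    (h2 : -(2 * ddzK y * algebraMap ℂ⟦X⟧ Lz S.d) - y * ddzK (algebraMap ℂ⟦X⟧ Lz S.d)
      + x * algebraMap ℂ⟦X⟧ Lz α - algebraMap ℂ⟦X⟧ Lz S.t * ddzK x
      - y * algebraMap ℂ⟦X⟧ Lz (β * S.d) = algebraMap ℂ⟦X⟧ Lz s) :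
    (∃ x₀, algebraMap ℂ⟦X⟧ Lz x₀ = x) ∧ ∃ y₀, algebraMap ℂ⟦X⟧ Lz y₀ = y := by
  -- The two equations are the coefficients of `ω` and of `1` in a single equation `z̃ k' = c k + r`
  -- for the function `k = x + y ω` on the punctured curve.
  obtain ⟨k, hk⟩ := S.exists_algebraMap_eq_of_zt_mul_ddzS
    (k := algebraMap Lz S.K x + algebraMap Lz S.K y * omega)
    (c := -(algebraMap ℂ⟦X⟧ S.O α + algebraMap ℂ⟦X⟧ S.O β * S.xi))
    (r := algebraMap ℂ⟦X⟧ S.O r * S.xi + algebraMap ℂ⟦X⟧ S.O s) (by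
      have e1 := congrArg (algebraMap Lz S.K) h1
      have e2 := congrArg (algebraMap Lz S.K) h2
      have hz := S.zt_mul_ddzS_omega
      have ho := S.omega_sq
      rw [Der.leibniz, ddzK_algebraMap] at e1
      rw [ddzK_algebraMap] at e2
      rw [map_add, Der.leibniz, ddzS_algebraMap, ddzS_algebraMap]
      simp only [map_add, map_sub, map_mul, map_neg, map_ofNat, algebraMap_O_K, algebraMap_xi,
        algebraMap_zt] at e1 e2 hz ⊢
      generalize algebraMap Lz S.K (algebraMap ℂ⟦X⟧ Lz S.t) = t at *
      generalize algebraMap Lz S.K (algebraMap ℂ⟦X⟧ Lz S.d) = d at *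
      generalize algebraMap Lz S.K (algebraMap ℂ⟦X⟧ Lz α) = α at *
      generalize algebraMap Lz S.K (algebraMap ℂ⟦X⟧ Lz β) = β at *
      generalize algebraMap Lz S.K x = x' at *
      generalize algebraMap Lz S.K y = y' at *
      generalize algebraMap Lz S.K (ddzK x) = dx at *
      generalize algebraMap Lz S.K (ddzK y) = dy at *
      linear_combination omega * e1 + e2 + y' * hz + (2 * dy + β * y') * ho)
  rw [S.algebraMap_apply] at hk
  constructor
  · refine ⟨k.re, ?_⟩
    have := congrArg QuadraticAlgebra.re hk
    simpa using this
  · refine ⟨k.im, ?_⟩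
    have := congrArg QuadraticAlgebra.im hk
    simpa using this

end SpectralCurve

theorem extendConn_one_tmul {R A : Type} [CommRing R] [CommRing A] [Algebra R A]
    {DR : Der R} {DA : Der A} (u : A) (h : ∀ r, DA (algebraMap R A r) = u * algebraMap R A (DR r))
    {M : Type} [AddCommGroup M] [Module R⟦X⟧ M] (c : LambdaConnection DR M) {s : M} {a : R⟦X⟧}
    (hs : c s = a • s) : extendConn u h c ((1 : A⟦X⟧) ⊗ₜ[R⟦X⟧] s)
      = (PowerSeries.C u * algebraMap R⟦X⟧ A⟦X⟧ a) • ((1 : A⟦X⟧) ⊗ₜ[R⟦X⟧] s) := by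
  rw [extendConn_tmul, hs, coeffDeriv_one, mul_zero, TensorProduct.zero_tmul, add_zero, mul_one,
    TensorProduct.tmul_smul, ← algebraMap_smul A⟦X⟧ a, TensorProduct.smul_tmul',
    TensorProduct.smul_tmul', smul_eq_mul, smul_eq_mul, mul_one, mul_comm]

namespace SpectralCurve

open QuadraticAlgebra

variable (S : SpectralCurve)

/-- The coordinates, over the punctured disc, of a morphism between second order equations which are
regular on the disc, are regular. -/
theorem exists_algebraMap_eq_of_companion {A B A' B' : ℂ⟦X⟧⟦X⟧} {x y x₁ y₁ : Lz⟦X⟧}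
    (hA : PowerSeries.constantCoeff A = -S.d) (hB : PowerSeries.constantCoeff B = S.t)
    (hA' : PowerSeries.constantCoeff A' = -S.d) (hB' : PowerSeries.constantCoeff B' = S.t)
    (hx₁ : x₁ = PowerSeries.X * coeffDeriv ddzK x + y * algebraMap ℂ⟦X⟧⟦X⟧ Lz⟦X⟧ A')
    (hy₁ : y₁ = x + PowerSeries.X * coeffDeriv ddzK y + y * algebraMap ℂ⟦X⟧⟦X⟧ Lz⟦X⟧ B')
    (h1 : PowerSeries.X * coeffDeriv ddzK x₁ + y₁ * algebraMap ℂ⟦X⟧⟦X⟧ Lz⟦X⟧ A'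
      = algebraMap ℂ⟦X⟧⟦X⟧ Lz⟦X⟧ A * x + algebraMap ℂ⟦X⟧⟦X⟧ Lz⟦X⟧ B * x₁)
    (h2 : x₁ + PowerSeries.X * coeffDeriv ddzK y₁ + y₁ * algebraMap ℂ⟦X⟧⟦X⟧ Lz⟦X⟧ B'
      = algebraMap ℂ⟦X⟧⟦X⟧ Lz⟦X⟧ A * y + algebraMap ℂ⟦X⟧⟦X⟧ Lz⟦X⟧ B * y₁) :
    (∃ x₀, algebraMap ℂ⟦X⟧⟦X⟧ Lz⟦X⟧ x₀ = x) ∧ ∃ y₀, algebraMap ℂ⟦X⟧⟦X⟧ Lz⟦X⟧ y₀ = y := by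
  -- Both equations have the same spectral curve, so their coefficients agree modulo `λ`. This is
  -- what permits dividing the compatibility relations by `λ` below.
  obtain ⟨α, hα⟩ : (PowerSeries.X : ℂ⟦X⟧⟦X⟧) ∣ A' - A := by
    rw [PowerSeries.X_dvd_iff, map_sub, hA, hA', sub_self]
  obtain ⟨β, hβ⟩ : (PowerSeries.X : ℂ⟦X⟧⟦X⟧) ∣ B' - B := by
    rw [PowerSeries.X_dvd_iff, map_sub, hB, hB', sub_self]
  have hα' := congrArg (algebraMap ℂ⟦X⟧⟦X⟧ Lz⟦X⟧) hα
  have hβ' := congrArg (algebraMap ℂ⟦X⟧⟦X⟧ Lz⟦X⟧) hβ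
  rw [map_sub, map_mul, algebraMap_X] at hα' hβ'
  have hX : ∀ z : Lz⟦X⟧, PowerSeries.X * z = 0 → z = 0 := fun z hz =>
    (mul_eq_zero.1 hz).resolve_left PowerSeries.X_ne_zero
  have e2 := hX (2 * coeffDeriv ddzK x + PowerSeries.X * coeffDeriv ddzK (coeffDeriv ddzK y)
      + coeffDeriv ddzK y * algebraMap ℂ⟦X⟧⟦X⟧ Lz⟦X⟧ B'
      + y * algebraMap ℂ⟦X⟧⟦X⟧ Lz⟦X⟧ (coeffDeriv ddz B')
      + y * algebraMap ℂ⟦X⟧⟦X⟧ Lz⟦X⟧ α + x * algebraMap ℂ⟦X⟧⟦X⟧ Lz⟦X⟧ β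
      + PowerSeries.X * algebraMap ℂ⟦X⟧⟦X⟧ Lz⟦X⟧ β * coeffDeriv ddzK y
      + y * algebraMap ℂ⟦X⟧⟦X⟧ Lz⟦X⟧ β * algebraMap ℂ⟦X⟧⟦X⟧ Lz⟦X⟧ B') (by
    simp only [hx₁, hy₁, map_add, coeffDeriv_mul, coeffDeriv_X, coeffDeriv_ddzK_algebraMap] at h2
    linear_combination h2 - y * hα' - (x + PowerSeries.X * coeffDeriv ddzK y
      + y * algebraMap ℂ⟦X⟧⟦X⟧ Lz⟦X⟧ B') * hβ')
  have e1 := hX (PowerSeries.X * coeffDeriv ddzK (coeffDeriv ddzK x)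
      + 2 * coeffDeriv ddzK y * algebraMap ℂ⟦X⟧⟦X⟧ Lz⟦X⟧ A'
      + y * algebraMap ℂ⟦X⟧⟦X⟧ Lz⟦X⟧ (coeffDeriv ddz A')
      + x * algebraMap ℂ⟦X⟧⟦X⟧ Lz⟦X⟧ α - algebraMap ℂ⟦X⟧⟦X⟧ Lz⟦X⟧ B * coeffDeriv ddzK x
      + y * algebraMap ℂ⟦X⟧⟦X⟧ Lz⟦X⟧ A' * algebraMap ℂ⟦X⟧⟦X⟧ Lz⟦X⟧ β) (by
    simp only [hx₁, hy₁, map_add, coeffDeriv_mul, coeffDeriv_X, coeffDeriv_ddzK_algebraMap] at h1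
    linear_combination h1 - x * hα' - y * algebraMap ℂ⟦X⟧⟦X⟧ Lz⟦X⟧ A' * hβ')
  -- Both coordinates are treated together, since their leading coefficients are coupled. In the
  -- relations divided by `λ`, the second derivatives carry a factor `λ`, so the leading
  -- coefficients satisfy a first order system.
  have key := exists_algebraMap_eq_of_step (R := ℂ⟦X⟧) (A := Lz) ![x, y] (by
    intro n k₀ k₁ hk
    have hx := hk 0
    have hy := hk 1
    simp only [Matrix.cons_val_zero, Matrix.cons_val_one] at hx hy
    generalize k₀ 0 = x₀ at *
    generalize k₀ 1 = y₀ at *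
    suffices h : (∃ r, algebraMap ℂ⟦X⟧ Lz r = PowerSeries.constantCoeff (k₁ 0)) ∧
        ∃ r, algebraMap ℂ⟦X⟧ Lz r = PowerSeries.constantCoeff (k₁ 1) by
      intro i
      fin_cases i
      · exact h.1
      · exact h.2
    generalize k₁ 0 = x' at *
    generalize k₁ 1 = y' at *
    simp only [hx, hy, map_add, coeffDeriv_X_pow_mul, coeffDeriv_ddzK_algebraMap] at e1 e2
    obtain ⟨r, hr⟩ := exists_constantCoeff_eq (R := ℂ⟦X⟧) (n := n)
      (f := 2 * coeffDeriv ddzK x' + PowerSeries.X * coeffDeriv ddzK (coeffDeriv ddzK y')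
        + coeffDeriv ddzK y' * algebraMap ℂ⟦X⟧⟦X⟧ Lz⟦X⟧ B'
        + y' * algebraMap ℂ⟦X⟧⟦X⟧ Lz⟦X⟧ (coeffDeriv ddz B')
        + y' * algebraMap ℂ⟦X⟧⟦X⟧ Lz⟦X⟧ α + x' * algebraMap ℂ⟦X⟧⟦X⟧ Lz⟦X⟧ β
        + PowerSeries.X * algebraMap ℂ⟦X⟧⟦X⟧ Lz⟦X⟧ β * coeffDeriv ddzK y'
        + y' * algebraMap ℂ⟦X⟧⟦X⟧ Lz⟦X⟧ β * algebraMap ℂ⟦X⟧⟦X⟧ Lz⟦X⟧ B')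
      (g := -(2 * coeffDeriv ddz x₀ + PowerSeries.X * coeffDeriv ddz (coeffDeriv ddz y₀)
        + coeffDeriv ddz y₀ * B' + y₀ * coeffDeriv ddz B' + y₀ * α + x₀ * β
        + PowerSeries.X * β * coeffDeriv ddz y₀ + y₀ * β * B')) (by
      simp only [map_add, map_mul, map_neg, map_ofNat, algebraMap_X]
      linear_combination e2)
    obtain ⟨s, hs⟩ := exists_constantCoeff_eq (R := ℂ⟦X⟧) (n := n)
      (f := PowerSeries.X * coeffDeriv ddzK (coeffDeriv ddzK x')
        + 2 * coeffDeriv ddzK y' * algebraMap ℂ⟦X⟧⟦X⟧ Lz⟦X⟧ A'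
        + y' * algebraMap ℂ⟦X⟧⟦X⟧ Lz⟦X⟧ (coeffDeriv ddz A')
        + x' * algebraMap ℂ⟦X⟧⟦X⟧ Lz⟦X⟧ α - algebraMap ℂ⟦X⟧⟦X⟧ Lz⟦X⟧ B * coeffDeriv ddzK x'
        + y' * algebraMap ℂ⟦X⟧⟦X⟧ Lz⟦X⟧ A' * algebraMap ℂ⟦X⟧⟦X⟧ Lz⟦X⟧ β)
      (g := -(PowerSeries.X * coeffDeriv ddz (coeffDeriv ddz x₀) + 2 * coeffDeriv ddz y₀ * A'
        + y₀ * coeffDeriv ddz A' + x₀ * α - B * coeffDeriv ddz x₀ + y₀ * A' * β)) (by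
      simp only [map_add, map_sub, map_mul, map_neg, map_ofNat, algebraMap_X]
      linear_combination e1)
    apply S.exists_algebraMap_eq_of_system (α := PowerSeries.constantCoeff α)
      (β := PowerSeries.constantCoeff β) (r := r) (s := s)
    · simp only [map_add, map_mul, constantCoeff_coeffDeriv, constantCoeff_algebraMap, hB',
      map_ofNat,
        PowerSeries.constantCoeff_X, zero_mul, add_zero] at hr
      rw [Der.leibniz, ddzK_algebraMap, map_mul]
      linear_combination hr
    · simp only [map_add, map_sub, map_mul, constantCoeff_coeffDeriv, constantCoeff_algebraMap, hA',
        hB, map_ofNat, map_neg, PowerSeries.constantCoeff_X, zero_mul, zero_add] at hs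
      rw [ddzK_algebraMap, map_mul]
      linear_combination hs)
  exact ⟨key 0, key 1⟩

/-- A morphism over the punctured disc between images of objects of `Conn` is regular. -/
theorem exists_one_tmul_eq_of_conn {M N : LamMod ddz 2} (hM : S.IsConn M) (hN : S.IsConn N)
    (f : LatMod.Hom ((extend 1 ddzK_algebraMap' 2 : LamMod ddz 2 ⥤ LatMod ℂ⟦X⟧ ddzK 2).obj M)
      ((extend 1 ddzK_algebraMap' 2 : LamMod ddz 2 ⥤ LatMod ℂ⟦X⟧ ddzK 2).obj N)) (m : M.carrier) :
    ∃ y : N.carrier, f.equiv ((1 : Lz⟦X⟧) ⊗ₜ[ℂ⟦X⟧⟦X⟧] m) = (1 : Lz⟦X⟧) ⊗ₜ[ℂ⟦X⟧⟦X⟧] y := by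
  obtain ⟨b, A, B, hb, hA, hB⟩ := S.exists_isCompanion_conn M.conn M.free.some hM.1 hM.2
  obtain ⟨b', A', B', hb', hA', hB'⟩ := S.exists_isCompanion_conn N.conn N.free.some hN.1 hN.2
  let c := extendConn (DA := ddzK) 1 ddzK_algebraMap' M.conn
  let c' := extendConn (DA := ddzK) 1 ddzK_algebraMap' N.conn
  let e : (Lz⟦X⟧ ⊗[ℂ⟦X⟧⟦X⟧] M.carrier) ≃ₗ[Lz⟦X⟧] (Lz⟦X⟧ ⊗[ℂ⟦X⟧⟦X⟧] N.carrier) := f.equiv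
  have hcomm : ∀ s, e (c s) = c' (e s) := f.comm
  obtain ⟨hβ0, hβ1⟩ := hb.extend (DB := ddzK) ddzK_algebraMap'
  obtain ⟨hγ0, hγ1⟩ := hb'.extend (DB := ddzK) ddzK_algebraMap'
  let β := b.baseChange Lz⟦X⟧
  let γ := b'.baseChange Lz⟦X⟧
  have hconn : ∀ x y : Lz⟦X⟧, c' (x • γ 0 + y • γ 1)
      = (PowerSeries.X * coeffDeriv ddzK x + y * algebraMap ℂ⟦X⟧⟦X⟧ Lz⟦X⟧ A') • γ 0
        + (x + PowerSeries.X * coeffDeriv ddzK y + y * algebraMap ℂ⟦X⟧⟦X⟧ Lz⟦X⟧ B') • γ 1 := by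
    intro x y
    rw [map_add, c'.leibniz, c'.leibniz]
    change x • c' (γ 0) + _ + (y • c' (γ 1) + _) = _
    rw [show c' (γ 0) = γ 1 from hγ0, show c' (γ 1) = _ from hγ1]
    change x • γ 1 + _ + (y • (_ • γ 0 + _ • γ 1) + _) = _
    simp only [smul_add, smul_smul, add_smul]
    abel
  set x := γ.repr (e (β 0)) 0 with hx
  set y := γ.repr (e (β 0)) 1 with hy
  have hw : e (β 0) = x • γ 0 + y • γ 1 := by
    conv_lhs => rw [← γ.sum_repr (e (β 0))]
    rw [Fin.sum_univ_two]
  have hw1 : e (β 1) = c' (e (β 0)) := by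
    rw [← hcomm, show c (β 0) = β 1 from hβ0]
  -- The image of a cyclic vector satisfies the same second order equation as the vector; its two
  -- coordinates give the system to be solved.
  have hw2 : c' (c' (e (β 0))) = algebraMap ℂ⟦X⟧⟦X⟧ Lz⟦X⟧ A • e (β 0)
      + algebraMap ℂ⟦X⟧⟦X⟧ Lz⟦X⟧ B • c' (e (β 0)) := by
    rw [← hw1, ← hcomm, show c (β 1) = _ from hβ1, map_add, map_smul, map_smul]
  rw [hw, hconn, hconn] at hw2
  have hcoord : ∀ p q p' q' : Lz⟦X⟧, p • γ 0 + q • γ 1 = p' • γ 0 + q' • γ 1 →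
      p = p' ∧ q = q' := by
    intro p q p' q' h
    have h0 := congrArg (fun v => γ.repr v 0) h
    have h1 := congrArg (fun v => γ.repr v 1) h
    exact ⟨by simpa using h0, by simpa using h1⟩
  rw [smul_add, smul_add, smul_smul, smul_smul, smul_smul, smul_smul, add_add_add_comm, ← add_smul,
    ← add_smul] at hw2
  obtain ⟨h1, h2⟩ := hcoord _ _ _ _ hw2
  obtain ⟨⟨x₀, hx₀⟩, y₀, hy₀⟩ := S.exists_algebraMap_eq_of_companion hA hB hA' hB' rfl rfl h1 h2
  have hreg : e ((1 : Lz⟦X⟧) ⊗ₜ b 0) = (1 : Lz⟦X⟧) ⊗ₜ (x₀ • b' 0 + y₀ • b' 1) := by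
    have : (1 : Lz⟦X⟧) ⊗ₜ[ℂ⟦X⟧⟦X⟧] b 0 = β 0 := (b.baseChange_apply Lz⟦X⟧ 0).symm
    rw [this, hw, ← hx₀, ← hy₀, TensorProduct.tmul_add, TensorProduct.tmul_smul,
      TensorProduct.tmul_smul, algebraMap_smul, algebraMap_smul]
    simp [γ]
  refine exists_one_tmul_eq_of_basis b e.toLinearMap ?_ m
  rw [Fin.forall_fin_two]
  refine ⟨⟨_, hreg⟩, ⟨N.conn (x₀ • b' 0 + y₀ • b' 1), ?_⟩⟩
  -- The second basis vector is the derivative of the first, and the connection of the target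
  -- preserves regular vectors.
  have h3 : (1 : Lz⟦X⟧) ⊗ₜ[ℂ⟦X⟧⟦X⟧] b 1 = c ((1 : Lz⟦X⟧) ⊗ₜ[ℂ⟦X⟧⟦X⟧] b 0) := by
    simp [c, extendConn_tmul, hb.apply_zero]
  rw [h3]
  refine (hcomm _).trans ?_
  rw [hreg]
  simp [c', extendConn_tmul]

theorem connToCC_full : S.connToCC.Full where
  map_surjective {M N} f := by
    obtain ⟨g, hg⟩ := exists_extend_map_eq (IsFractionRing.injective ℂ⟦X⟧ Lz) isUnit_one
      ddzK_algebraMap' f.hom (S.exists_one_tmul_eq_of_conn M.property N.property f.hom)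
      (S.exists_one_tmul_eq_of_conn N.property M.property (Groupoid.inv f.hom))
    exact ⟨ObjectProperty.homMk g, ObjectProperty.hom_ext _ hg⟩

theorem connToCC_faithful : S.connToCC.Faithful :=
  haveI := extend_faithful (IsFractionRing.injective ℂ⟦X⟧ Lz) 1 ddzK_algebraMap' 2
  inferInstanceAs (S.IsCC.lift (S.IsConn.ι ⋙ extend 1 ddzK_algebraMap' 2)
    fun M => S.isCC_extend M.obj M.property).Faithful

/-- The form of an object of `TConn` in a basis. -/
theorem exists_tConn_form {M : LamMod S.theta 1} (hM : S.IsTConn M)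
    (b : Module.Basis (Fin 1) S.O⟦X⟧ M.carrier) :
    ∃ c : S.O⟦X⟧, M.conn (b 0) = (PowerSeries.C S.zt * c
        - PowerSeries.C (algebraMap ℂ S.O (1 / 2)) * PowerSeries.X) • b 0 ∧
      PowerSeries.constantCoeff c = S.ddzt (algebraMap ℂ⟦X⟧ S.O PowerSeries.X) * S.xi := by
  obtain ⟨s, hs⟩ := hM.2 (b 0)
  have hs1 : s = b.repr s 0 • b 0 := by
    conv_lhs => rw [← b.sum_repr s]
    rw [Fin.sum_univ_one]
  have hc : M.conn (b 0) = (PowerSeries.C S.zt * b.repr s 0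
        - PowerSeries.C (algebraMap ℂ S.O (1 / 2)) * PowerSeries.X) • b 0 := by
    rw [hs, sub_smul, mul_smul (PowerSeries.C S.zt) (b.repr s 0), ← hs1]
    abel
  refine ⟨b.repr s 0, hc, ?_⟩
  have h0 := hM.1 (Red.mk S.O M.carrier (b 0))
  rw [LambdaConnection.red_mk, Red.smul_mk] at h0
  have h1 := congrArg (fun v => (Red.basis b).repr v 0) h0
  simp only [Red.basis_repr_mk, hc] at h1
  simp only [map_smul, Module.Basis.repr_self, Finsupp.smul_apply, Finsupp.single_eq_same,
    smul_eq_mul, mul_one, map_sub, map_mul, PowerSeries.constantCoeff_C,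
    PowerSeries.constantCoeff_X, mul_zero, sub_zero, Algebra.algebraMap_self, RingHom.id_apply] at h1
  -- The reduction fixes `z̃ c` modulo `λ`; the factor `z̃` is cancelled in `K`, where it is
  -- invertible.
  apply S.algebraMap_O_K_injective
  apply S.isUnit_zt.mul_left_cancel
  rw [← map_mul, ← map_mul, h1, mul_assoc]

/-- A morphism over the punctured curve between images of objects of `TConn` is regular. -/
theorem exists_one_tmul_eq_of_tConn {M N : LamMod S.theta 1} (hM : S.IsTConn M) (hN : S.IsTConn N)
    (f : LatMod.Hom
      ((extend S.logFactor S.ddzS_algebraMap_O 1 : LamMod S.theta 1 ⥤ LatMod S.O S.ddzS 1).obj M)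
      ((extend S.logFactor S.ddzS_algebraMap_O 1 : LamMod S.theta 1 ⥤ LatMod S.O S.ddzS 1).obj N))
    (m : M.carrier) :
    ∃ y : N.carrier, f.equiv ((1 : S.K⟦X⟧) ⊗ₜ[S.O⟦X⟧] m) = (1 : S.K⟦X⟧) ⊗ₜ[S.O⟦X⟧] y := by
  let b := M.free.some
  let b' := N.free.some
  obtain ⟨a, ha, ha0⟩ := S.exists_tConn_form hM b
  obtain ⟨a', ha', ha0'⟩ := S.exists_tConn_form hN b'
  let c := extendConn (DA := S.ddzS) S.logFactor S.ddzS_algebraMap_O M.conn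
  let c' := extendConn (DA := S.ddzS) S.logFactor S.ddzS_algebraMap_O N.conn
  let e : (S.K⟦X⟧ ⊗[S.O⟦X⟧] M.carrier) ≃ₗ[S.K⟦X⟧] (S.K⟦X⟧ ⊗[S.O⟦X⟧] N.carrier) := f.equiv
  have hcomm : ∀ s, e (c s) = c' (e s) := f.comm
  let γ := b'.baseChange S.K⟦X⟧
  have hγ : γ 0 = (1 : S.K⟦X⟧) ⊗ₜ[S.O⟦X⟧] b' 0 := by simp [γ]
  set k := γ.repr (e ((1 : S.K⟦X⟧) ⊗ₜ[S.O⟦X⟧] b 0)) 0 with hk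
  have hw : e ((1 : S.K⟦X⟧) ⊗ₜ[S.O⟦X⟧] b 0) = k • γ 0 := by
    conv_lhs => rw [← γ.sum_repr (e _)]
    rw [Fin.sum_univ_one]
  have hc1 : c ((1 : S.K⟦X⟧) ⊗ₜ[S.O⟦X⟧] b 0) = (PowerSeries.C S.logFactor
      * algebraMap S.O⟦X⟧ S.K⟦X⟧ (PowerSeries.C S.zt * a
        - PowerSeries.C (algebraMap ℂ S.O (1 / 2)) * PowerSeries.X))
      • ((1 : S.K⟦X⟧) ⊗ₜ[S.O⟦X⟧] b 0) :=
    extendConn_one_tmul _ _ _ ha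
  have hc2 : c' (γ 0) = (PowerSeries.C S.logFactor
      * algebraMap S.O⟦X⟧ S.K⟦X⟧ (PowerSeries.C S.zt * a'
        - PowerSeries.C (algebraMap ℂ S.O (1 / 2)) * PowerSeries.X)) • γ 0 := by
    rw [hγ]
    exact extendConn_one_tmul _ _ _ ha'
  have h1 := hcomm ((1 : S.K⟦X⟧) ⊗ₜ[S.O⟦X⟧] b 0)
  rw [hc1, map_smul, hw, c'.leibniz, hc2] at h1
  have h2 := congrArg (fun v => γ.repr v 0) h1
  simp only [map_smul, map_add, Module.Basis.repr_self, Finsupp.smul_apply, Finsupp.add_apply,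
    Finsupp.single_eq_same, smul_eq_mul, mul_one] at h2
  -- The residue terms of the two forms are equal and their reductions are both `μ`, so the forms
  -- differ by `λ z̃ p` relative to `z̃⁻¹ dz̃`: the matrix coefficient `k` satisfies an equation
  -- with a regular form.
  obtain ⟨p, hp⟩ : (PowerSeries.X : S.O⟦X⟧) ∣ a - a' := by
    rw [PowerSeries.X_dvd_iff, map_sub, ha0, ha0', sub_self]
  have hp' := congrArg (algebraMap S.O⟦X⟧ S.K⟦X⟧) hp
  rw [map_sub, map_mul, algebraMap_X] at hp'
  obtain ⟨k₀, hk₀⟩ := S.exists_algebraMap_eq_of_coeffDeriv_eq (k := k) (c := p) (by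
    apply PowerSeries.X_mul_cancel
    simp only [map_sub, map_mul] at h2 ⊢
    linear_combination (-1 : S.K⟦X⟧) * h2 + PowerSeries.C S.logFactor
      * algebraMap S.O⟦X⟧ S.K⟦X⟧ (PowerSeries.C S.zt) * k * hp')
  refine exists_one_tmul_eq_of_basis b e.toLinearMap (fun i => ?_) m
  obtain rfl : i = 0 := Subsingleton.elim _ _
  refine ⟨k₀ • b' 0, hw.trans ?_⟩
  rw [hγ, ← hk₀, algebraMap_smul, TensorProduct.tmul_smul]

theorem tConnToTCC_full : S.tConnToTCC.Full where
  map_surjective {M N} f := by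
    obtain ⟨g, hg⟩ := exists_extend_map_eq S.algebraMap_O_K_injective S.isUnit_logFactor
      S.ddzS_algebraMap_O f.hom (S.exists_one_tmul_eq_of_tConn M.property N.property f.hom)
      (S.exists_one_tmul_eq_of_tConn N.property M.property (Groupoid.inv f.hom))
    exact ⟨ObjectProperty.homMk g, ObjectProperty.hom_ext _ hg⟩

theorem tConnToTCC_faithful : S.tConnToTCC.Faithful :=
  haveI := extend_faithful S.algebraMap_O_K_injective S.logFactor S.ddzS_algebraMap_O 1
  inferInstanceAs (S.IsTCC.lift (S.IsTConn.ι ⋙ extend S.logFactor S.ddzS_algebraMap_O 1)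
    fun M => S.isTCC_extend M.obj M.property).Faithful

end SpectralCurve

/-! ### The direct image functor is fully faithful -/

theorem LambdaConnection.map_X_pow_smul {A : Type} [CommRing A] {D : Der A} {M : Type}
    [AddCommGroup M] [Module A⟦X⟧ M] (c : LambdaConnection D M) (n : ℕ) (s : M) :
    c ((PowerSeries.X : A⟦X⟧) ^ n • s) = (PowerSeries.X : A⟦X⟧) ^ n • c s := by
  induction n with
  | zero => simp
  | succ n ih => rw [pow_succ', mul_smul, c.map_X_smul, ih, mul_smul]

/-- A free module over `A⟦λ⟧` is `λ`-adically separated. -/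
theorem eq_zero_of_forall_X_pow_smul {A : Type} [CommRing A] {ι M : Type}
    [AddCommGroup M] [Module A⟦X⟧ M] (b : Module.Basis ι A⟦X⟧ M) {s : M}
    (h : ∀ n : ℕ, ∃ y, s = (PowerSeries.X : A⟦X⟧) ^ n • y) : s = 0 := by
  apply b.ext_elem
  intro i
  ext n
  obtain ⟨y, rfl⟩ := h (n + 1)
  rw [map_smul, Finsupp.smul_apply, smul_eq_mul, PowerSeries.coeff_X_pow_mul', if_neg (by lia)]
  simp

theorem LambdaConnection.exists_eq_C_smul_add_X_smul {A : Type} [CommRing A] {D : Der A} {M : Type}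
    [AddCommGroup M] [Module A⟦X⟧ M] (c : LambdaConnection D M) {w : A}
    (hc : ∀ x, c.red A x = w • x) (s : M) :
    ∃ y, c s = PowerSeries.C w • s + (PowerSeries.X : A⟦X⟧) • y := by
  have h := hc (Red.mk A M s)
  rw [LambdaConnection.red_mk, Red.smul_mk, ← sub_eq_zero, ← map_sub, Red.mk_eq_zero] at h
  obtain ⟨y, hy⟩ := h
  refine ⟨y, ?_⟩
  rw [hy]
  simp

/-- The `λ`-connection `λ d + a` on the free module of rank one. -/
def rankOneConn {A : Type} [CommRing A] (D : Der A) (a : A⟦X⟧) : LambdaConnection D A⟦X⟧ where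
  toFun := AddMonoidHom.mk' (fun x => PowerSeries.X * coeffDeriv D x + a * x)
    (fun x y => by simp only [map_add]; ring)
  leibniz f s := by
    simp only [AddMonoidHom.mk'_apply, smul_eq_mul, coeffDeriv_mul]
    ring

theorem rankOneConn_apply {A : Type} [CommRing A] (D : Der A) (a x : A⟦X⟧) :
    rankOneConn D a x = PowerSeries.X * coeffDeriv D x + a * x := rfl

theorem rankOneConn_red {A : Type} [CommRing A] (D : Der A) (a : A⟦X⟧) (x : Red A A⟦X⟧) :
    (rankOneConn D a).red A x = PowerSeries.constantCoeff a • x := by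
  obtain ⟨m, rfl⟩ := Red.mk_surjective x
  have h : Red.mk A A⟦X⟧ (PowerSeries.X * coeffDeriv D m) = 0 :=
    Red.mk_eq_zero.2 ⟨coeffDeriv D m, rfl⟩
  rw [LambdaConnection.red_mk, rankOneConn_apply, ← smul_eq_mul a m, map_add, ← Red.mk_smul, h,
    zero_add]

namespace SpectralCurve

open QuadraticAlgebra

variable (S : SpectralCurve)

theorem ddzS_omega_eq : ∃ p q : Lz, S.ddzS omega = algebraMap Lz S.K p
    + algebraMap Lz S.K q * omega := by
  refine ⟨(S.ddzS omega).re, (S.ddzS omega).im, ?_⟩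
  ext <;> simp

/-- A map over the punctured disc which commutes with the `λ`-connections is linear over the
punctured curve. -/
theorem map_smul_of_comm {l l' : Type} [AddCommGroup l] [AddCommGroup l'] [Module S.K⟦X⟧ l]
    [Module S.K⟦X⟧ l'] (b : Module.Basis (Fin 1) S.K⟦X⟧ l') {c : LambdaConnection S.ddzS l}
    {c' : LambdaConnection S.ddzS l'} (hc : ∀ x, c.red S.K x = (omega : S.K) • x)
    (hc' : ∀ x, c'.red S.K x = (omega : S.K) • x) (φ : l →+ l')
    (hφ : ∀ (a : Lz⟦X⟧) (s : l), φ (algebraMap Lz⟦X⟧ S.K⟦X⟧ a • s)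
      = algebraMap Lz⟦X⟧ S.K⟦X⟧ a • φ s)
    (hcomm : ∀ s, φ (c s) = c' (φ s)) (k : S.K⟦X⟧) (s : l) : φ (k • s) = k • φ s := by
  obtain ⟨p, q, hpq⟩ := S.ddzS_omega_eq
  obtain ⟨w, hw⟩ := S.isUnit_zt.exists_right_inv
  let W : S.K⟦X⟧ := PowerSeries.C omega
  let T : S.K⟦X⟧ := algebraMap Lz⟦X⟧ S.K⟦X⟧ (PowerSeries.C (algebraMap ℂ⟦X⟧ Lz S.t))
  let d : S.K⟦X⟧ := algebraMap Lz⟦X⟧ S.K⟦X⟧ (PowerSeries.C (algebraMap ℂ⟦X⟧ Lz S.d))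
  let p' : S.K⟦X⟧ := algebraMap Lz⟦X⟧ S.K⟦X⟧ (PowerSeries.C p)
  let q' : S.K⟦X⟧ := algebraMap Lz⟦X⟧ S.K⟦X⟧ (PowerSeries.C q)
  have hW : W * W = T * W - d := by
    simp only [W, T, d, algebraMap_C, ← map_mul, ← map_sub, S.omega_sq]
  have hdW : coeffDeriv S.ddzS W = p' + q' * W := by
    simp only [W, p', q', algebraMap_C, coeffDeriv_C, hpq, map_add, map_mul]
  have hz : PowerSeries.C (algebraMap S.O S.K S.zt) = 2 * W - T := by
    simp only [W, T, algebraMap_C, S.algebraMap_zt, map_sub, map_mul, map_ofNat]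
  have hzw : (2 * W - T) * PowerSeries.C w = 1 := by rw [← hz, ← map_mul, hw, map_one]
  have hφX : ∀ s, φ ((PowerSeries.X : S.K⟦X⟧) • s) = (PowerSeries.X : S.K⟦X⟧) • φ s := by
    intro s
    have := hφ PowerSeries.X s
    rwa [algebraMap_X] at this
  -- Divisibility by `λ ^ n` of the commutator with `ω` is improved by one order. Applying the
  -- connection to the commutator at `s` acts as `ω` modulo `λ`, but applying it inside gives the
  -- commutator at `ω s`, which is `t - ω` times that at `s`. The difference `2 ω - t = z̃` is
  -- invertible.
  have key : ∀ n : ℕ, ∀ s, ∃ y, φ (W • s) - W • φ s = (PowerSeries.X : S.K⟦X⟧) ^ n • y := by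
    intro n
    induction n with
    | zero => exact fun s => ⟨_, by rw [pow_zero, one_smul]⟩
    | succ n ih =>
      intro s
      obtain ⟨y, hy⟩ := ih s
      obtain ⟨s', hs'⟩ := c.exists_eq_C_smul_add_X_smul hc s
      obtain ⟨y', hy'⟩ := ih s'
      obtain ⟨y₂, hy₂⟩ := c'.exists_eq_C_smul_add_X_smul hc' y
      change c s = W • s + _ at hs'
      change c' y = W • y + _ at hy₂
      have h1 : c' (φ (W • s) - W • φ s) = φ (W • c s) - W • φ (c s)
          + (PowerSeries.X * q') • (φ (W • s) - W • φ s) := by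
        rw [map_sub, ← hcomm, c.leibniz, c'.leibniz, ← hcomm, hdW, map_add, mul_smul, mul_smul,
          hφX, add_smul, map_add, hφ, mul_smul, hφ]
        simp only [add_smul, mul_smul, smul_sub, smul_add]
        abel
      -- By the equation of the curve, the commutator with `ω` interchanges the two roots `ω` and `t
      -- - ω`.
      have h2 : φ (W • W • s) - W • φ (W • s) = (T - W) • (φ (W • s) - W • φ s) := by
        rw [smul_smul, hW, sub_smul, map_sub, hφ, mul_smul, hφ, smul_sub, smul_smul,
          show (T - W) * W = d by rw [sub_mul, hW]; ring, sub_smul]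
        abel
      rw [hs', smul_add, map_add, map_add, smul_add, smul_comm W PowerSeries.X s', hφX, hφX,
        smul_comm W PowerSeries.X (φ s'), add_sub_add_comm, h2, ← smul_sub, hy', hy,
        c'.map_X_pow_smul, hy₂] at h1
      refine ⟨PowerSeries.C w • (y' + q' • y - y₂), ?_⟩
      have h3 : (PowerSeries.X ^ n * (2 * W - T)) • y
          = (PowerSeries.X ^ (n + 1) : S.K⟦X⟧) • (y' + q' • y - y₂) := by
        have e1 : (PowerSeries.X ^ n * (2 * W - T)) • y
          = (PowerSeries.X ^ n : S.K⟦X⟧) • (W • y + (PowerSeries.X : S.K⟦X⟧) • y₂)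
            - ((T - W) • (PowerSeries.X : S.K⟦X⟧) ^ n • y
              + (PowerSeries.X : S.K⟦X⟧) ^ (n + 1) • y₂) := by
          simp only [smul_add, smul_smul, sub_smul, mul_sub, pow_succ, two_mul, mul_add, add_smul,
            sub_mul, mul_comm W, mul_comm T]
          abel
        rw [e1, h1]
        simp only [smul_add, smul_sub, smul_smul, pow_succ, mul_comm, mul_left_comm, mul_assoc]
        abel
      rw [hy, smul_comm, ← h3, smul_smul, mul_comm, mul_assoc, hzw, mul_one]
  have hcomW : ∀ s, φ (W • s) = W • φ s := fun s =>
    sub_eq_zero.1 (eq_zero_of_forall_X_pow_smul b fun n => key n s)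
  obtain ⟨x, y, rfl⟩ := S.exists_eq_add_mul_zt_powerSeries k
  have h2 : φ ((2 * W - T) • s) = (2 * W - T) • φ s := by
    rw [sub_smul, map_sub, two_mul, add_smul, map_add, hcomW, hφ, sub_smul, add_smul]
  rw [hz, add_smul, map_add, hφ, mul_smul, hφ, h2, add_smul, mul_smul]

theorem exists_pushMap_eq {M N : LatMod S.O S.ddzS 1} (hM : S.IsTCC M) (hN : S.IsTCC N)
    (f : LatMod.Hom (S.pushObj M) (S.pushObj N)) : ∃ g : LatMod.Hom M N, S.pushMap g = f := by
  let φ : M.carrier ≃+ N.carrier := f.equiv.toAddEquiv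
  have hlin := S.map_smul_of_comm N.free.some (c := M.conn) (c' := N.conn)
    (fun x => by rw [hM, algebraMap_xi]) (fun x => by rw [hN, algebraMap_xi])
    φ.toAddMonoidHom (fun a s => f.equiv.map_smul a s) f.comm
  let e : M.carrier ≃ₗ[S.K⟦X⟧] N.carrier := { φ with map_smul' := hlin }
  refine ⟨⟨⟨e, f.comm⟩, ?_⟩, rfl⟩
  have h := f.map_lattice
  ext y
  constructor
  · rintro ⟨x, hx, rfl⟩
    have h1 : resRed Lz ℂ⟦X⟧ N.carrier (Red.map S.O e.toLinearMap x)
        ∈ (S.pushObj N).lattice := by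
      rw [← h]
      refine ⟨_, ⟨x, hx, rfl⟩, ?_⟩
      obtain ⟨m, rfl⟩ := Red.mk_surjective x
      rfl
    obtain ⟨y, hy, hyx⟩ := h1
    rwa [← (resRed Lz ℂ⟦X⟧ N.carrier).injective hyx]
  · intro hy
    have h1 : resRed Lz ℂ⟦X⟧ N.carrier y ∈ (S.pushObj N).lattice := ⟨y, hy, rfl⟩
    rw [← h] at h1
    obtain ⟨_, ⟨x, hx, rfl⟩, hxy⟩ := h1
    refine ⟨x, hx, (resRed Lz ℂ⟦X⟧ N.carrier).injective (Eq.trans ?_ hxy)⟩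
    obtain ⟨m, rfl⟩ := Red.mk_surjective x
    rfl

theorem push_full : S.push.Full where
  map_surjective {M N} f := by
    obtain ⟨g, hg⟩ := S.exists_pushMap_eq M.property N.property f.hom
    exact ⟨ObjectProperty.homMk g, ObjectProperty.hom_ext _ hg⟩

theorem push_faithful : S.push.Faithful where
  map_injective {M N} f g h := by
    apply ObjectProperty.hom_ext
    apply LatMod.Hom.ext
    apply LinearEquiv.ext
    intro s
    have h1 : S.pushMap f.hom = S.pushMap g.hom := congrArg (fun k => k.hom) h
    exact congrArg (fun k : LatMod.Hom (S.pushObj M.obj) (S.pushObj N.obj) => k.equiv s) h1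

/-- A solution of the Riccati equation identifies a second order equation with the direct image of
a rank one equation. -/
theorem exists_equiv_of_isCompanion {V : Type} [AddCommGroup V] [Module Lz⟦X⟧ V]
    {c : LambdaConnection ddzK V} {b : Module.Basis (Fin 2) Lz⟦X⟧ V} {P Q : Lz⟦X⟧}
    (h : IsCompanion c b P Q) {a : S.K⟦X⟧} (ha : PowerSeries.constantCoeff a = omega)
    (hr : PowerSeries.X * coeffDeriv S.ddzS a + a * a
      = algebraMap Lz⟦X⟧ S.K⟦X⟧ P + algebraMap Lz⟦X⟧ S.K⟦X⟧ Q * a) :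
    ∃ ψ : V ≃ₗ[Lz⟦X⟧] Res Lz S.K S.K⟦X⟧, ψ (b 0) = (1 : S.K⟦X⟧) ∧ ψ (b 1) = a ∧
      ∀ s, ψ (c s) = resConn S.ddzS_algebraMap (rankOneConn S.ddzS a) (ψ s) := by
  let c' := resConn S.ddzS_algebraMap (rankOneConn S.ddzS a)
  let β := QuadraticAlgebra.basis (-algebraMap ℂ⟦X⟧ Lz S.d) (algebraMap ℂ⟦X⟧ Lz S.t)
  have hβ0 : β 0 = 1 := β.repr.injective (by
    rw [Module.Basis.repr_self]; ext i; fin_cases i <;> simp [β, re_one, im_one])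
  have hβ1 : β 1 = omega := β.repr.injective (by
    rw [Module.Basis.repr_self]; ext i; fin_cases i <;> simp [β])
  let e : Module.Basis (Fin 1) S.K⟦X⟧ S.K⟦X⟧ := Module.Basis.singleton (Fin 1) S.K⟦X⟧
  let γ : Module.Basis (Fin 2) Lz⟦X⟧ (Res Lz S.K S.K⟦X⟧) := resBasis β e
  have hγ : ∀ i, γ i = (PowerSeries.C (β i) : S.K⟦X⟧) := by
    intro i
    have h : γ i = (powerSeriesBasis β i : S.K⟦X⟧) • (e 0 : Res Lz S.K S.K⟦X⟧) := by
      simp only [γ, resBasis, Module.Basis.reindex_apply]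
      exact Module.Basis.smulTower_apply _ _ _
    rw [h, powerSeriesBasis_apply]
    change (PowerSeries.C (β i) : S.K⟦X⟧) * e 0 = _
    simp [e]
  have hγ0 : γ 0 = (1 : S.K⟦X⟧) := by rw [hγ, hβ0, map_one]
  have hγ1 : γ 1 = (PowerSeries.C omega : S.K⟦X⟧) := by rw [hγ, hβ1]
  obtain ⟨a', ha'⟩ := exists_eq_C_add_X_mul a
  have ha1 : ∃ y : Res Lz S.K S.K⟦X⟧, a = γ 1 + (PowerSeries.X : Lz⟦X⟧) • y := by
    refine ⟨a', ?_⟩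
    rw [ha] at ha'
    exact ha'.trans (congrArg₂ (fun x y : Res Lz S.K S.K⟦X⟧ => x + y) hγ1.symm
      (Res.X_smul (A := Lz) (B := S.K) (l := S.K⟦X⟧) a').symm)
  obtain ⟨y, hy⟩ := ha1
  have hc1 : c' (γ 0) = a := by
    rw [hγ0]
    change PowerSeries.X * coeffDeriv S.ddzS 1 + a * 1 = a
    rw [coeffDeriv_one, mul_zero, zero_add, mul_one]
  -- The vector `1` is cyclic for `λ d + a`: its derivative `a` is `ω` modulo `λ`, so the
  -- determinant against the basis `1, ω` is `1` modulo `λ`.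
  obtain ⟨b', P', Q', hb0, hb⟩ := exists_isCompanion_of_isUnit c' γ (γ 0) (by
    rw [hc1, hy]
    simp)
  have hb1 : b' 1 = a := by rw [← hb.apply_zero, hb0, hc1]
  let ψ := b.equiv b' (Equiv.refl _)
  have hψ : ∀ i, ψ (b i) = b' i := fun i => b.equiv_apply i b' (Equiv.refl _)
  refine ⟨ψ, by rw [hψ, hb0, hγ0], by rw [hψ, hb1], ?_⟩
  refine LambdaConnection.comm_of_basis b c c' ψ.toLinearMap ?_
  rw [Fin.forall_fin_two]
  constructor
  · rw [h.apply_zero, LinearEquiv.coe_coe, hψ, hψ, hb.apply_zero]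
  · rw [h.apply_one, LinearEquiv.coe_coe, map_add, map_smul, map_smul, hψ, hψ, hb1, hb0, hγ0]
    -- On the second basis vector, compatibility with the connections is the Riccati equation.
    change algebraMap Lz⟦X⟧ S.K⟦X⟧ P * 1 + algebraMap Lz⟦X⟧ S.K⟦X⟧ Q * a
      = PowerSeries.X * coeffDeriv S.ddzS a + a * a
    rw [mul_one, hr]

end SpectralCurve

/-! ### Essential surjectivity of the direct image functor -/

theorem bijective_isoClasses_map {C C' : Type 1} [Category.{0} C] [Category.{0} C'] (F : C ⥤ C')
    [F.IsEquivalence] : Function.Bijective (IsoClasses.map F) := by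
  constructor
  · rintro ⟨x⟩ ⟨y⟩ h
    obtain ⟨e⟩ := Quotient.exact (s := isIsomorphicSetoid C') h
    exact Quotient.sound (s := isIsomorphicSetoid C) ⟨F.preimageIso e⟩
  · rintro ⟨y⟩
    exact ⟨Quotient.mk _ (F.objPreimage y),
      Quotient.sound (s := isIsomorphicSetoid C') ⟨F.objObjPreimageIso y⟩⟩

theorem exists_linearEquiv_mul {A : Type} [CommRing A] {u : A} (hu : IsUnit u) :
    ∃ e : A ≃ₗ[A] A, ∀ x, e x = u * x :=
  ⟨LinearEquiv.smulOfUnit hu.unit, fun _ => rfl⟩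

namespace SpectralCurve

open QuadraticAlgebra

variable (S : SpectralCurve)

/-- The object of rank one with the connection `λ d + a` and a given lattice. -/
def rankOne (a : S.K⟦X⟧) (L : Submodule S.O (Red S.K S.K⟦X⟧)) (hL : Submodule.IsLattice S.K L) :
    LatMod S.O S.ddzS 1 where
  carrier := S.K⟦X⟧
  free := ⟨Module.Basis.singleton (Fin 1) S.K⟦X⟧⟩
  conn := rankOneConn S.ddzS a
  lattice := L
  isLattice := hL

theorem isTCC_rankOne {a : S.K⟦X⟧} (ha : PowerSeries.constantCoeff a = omega)
    (L : Submodule S.O (Red S.K S.K⟦X⟧)) (hL : Submodule.IsLattice S.K L) :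
    S.IsTCC (S.rankOne a L hL) := by
  intro x
  rw [algebraMap_xi, ← ha]
  exact rankOneConn_red _ _ _

/-- The standard lattice in the free module of rank one. -/
def stdLattice : Submodule S.O (Red S.K S.K⟦X⟧) := Submodule.span S.O {Red.mk S.K S.K⟦X⟧ 1}

theorem stdLattice_isLattice : Submodule.IsLattice S.K S.stdLattice where
  fg := Submodule.fg_span_singleton _
  span_eq_top := by
    rw [eq_top_iff, ← (Red.basis (Module.Basis.singleton (Fin 1) S.K⟦X⟧)).span_eq,
      Submodule.span_le]
    rintro _ ⟨i, rfl⟩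
    refine Submodule.subset_span (Submodule.subset_span ?_)
    rw [Red.basis_apply, Module.Basis.singleton_apply]
    rfl

theorem mk_eq_smul_mk_one {k : S.K⟦X⟧} {y : S.O}
    (h : PowerSeries.constantCoeff k = algebraMap S.O S.K y) :
    Red.mk S.K S.K⟦X⟧ k = y • Red.mk S.K S.K⟦X⟧ 1 := by
  have h1 := Red.mk_smul k (1 : S.K⟦X⟧)
  rw [smul_eq_mul, mul_one, h, algebraMap_smul] at h1
  exact h1

/-- The identification modulo `λ` induced by an identification with a direct image. -/
def redToRankOne {V : Type} [AddCommGroup V] [Module Lz⟦X⟧ V]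
    (ψ : V ≃ₗ[Lz⟦X⟧] Res Lz S.K S.K⟦X⟧) : Red Lz V →ₗ[ℂ⟦X⟧] Red S.K S.K⟦X⟧ :=
  (resRed Lz ℂ⟦X⟧ S.K⟦X⟧).symm.toLinearMap ∘ₗ Red.map ℂ⟦X⟧ ψ.toLinearMap

theorem redToRankOne_mk {V : Type} [AddCommGroup V] [Module Lz⟦X⟧ V]
    (ψ : V ≃ₗ[Lz⟦X⟧] Res Lz S.K S.K⟦X⟧) {v : V} {x : S.K⟦X⟧} (hx : ψ v = x) :
    S.redToRankOne ψ (Red.mk Lz V v) = Red.mk S.K S.K⟦X⟧ x := by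
  subst hx
  rfl

theorem map_smul_res {V : Type} [AddCommGroup V] [Module Lz⟦X⟧ V]
    (ψ : V ≃ₗ[Lz⟦X⟧] Res Lz S.K S.K⟦X⟧) (r : Lz⟦X⟧) {v : V} {x : S.K⟦X⟧} (hx : ψ v = x) :
    ψ (r • v) = (algebraMap Lz⟦X⟧ S.K⟦X⟧ r * x : S.K⟦X⟧) := by
  subst hx
  exact ψ.map_smul r v

theorem redToRankOne_smul {V : Type} [AddCommGroup V] [Module Lz⟦X⟧ V]
    (ψ : V ≃ₗ[Lz⟦X⟧] Res Lz S.K S.K⟦X⟧) (r : Lz) (v : Red Lz V) :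
    S.redToRankOne ψ (r • v) = algebraMap Lz S.K r • S.redToRankOne ψ v := by
  obtain ⟨m, rfl⟩ := Red.mk_surjective v
  obtain ⟨x, hx⟩ : ∃ x : S.K⟦X⟧, ψ m = x := ⟨_, rfl⟩
  have h := S.map_smul_res ψ (PowerSeries.C r) hx
  rw [algebraMap_C] at h
  rw [Red.smul_mk, Algebra.algebraMap_self, RingHom.id_apply, S.redToRankOne_mk ψ hx,
    S.redToRankOne_mk ψ h]
  rfl

/-- An identification of `λ`-connections which is compatible with the lattices is an isomorphism
with the direct image of an object of rank one. -/
def homPushRankOne (N : LatMod ℂ⟦X⟧ ddzK 2) {a : S.K⟦X⟧}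
    (ψ : N.carrier ≃ₗ[Lz⟦X⟧] Res Lz S.K S.K⟦X⟧)
    (hψ : ∀ s, ψ (N.conn s) = resConn S.ddzS_algebraMap (rankOneConn S.ddzS a) (ψ s))
    (L : Submodule S.O (Red S.K S.K⟦X⟧)) (hL : Submodule.IsLattice S.K L)
    (h : N.lattice.map (S.redToRankOne ψ) = L.restrictScalars ℂ⟦X⟧) :
    LatMod.Hom N (S.pushObj (S.rankOne a L hL)) where
  equiv := ψ
  comm := hψ
  map_lattice := by
    change _ = (L.restrictScalars ℂ⟦X⟧).map (resRed Lz ℂ⟦X⟧ S.K⟦X⟧).toLinearMap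
    rw [← h, ← Submodule.map_comp]
    congr 1
    ext x
    obtain ⟨m, rfl⟩ := Red.mk_surjective x
    rfl

/-- The Higgs field becomes multiplication by `ξ`, and `O` is spanned by `1` and `ξ` over `ℂ⟦z⟧`; so
a `ℂ⟦z⟧`-lattice preserved by the Higgs field is a lattice over `O`. -/
theorem exists_lattice {N : LatMod ℂ⟦X⟧ ddzK 2} (hN : S.IsCC N) {a : S.K⟦X⟧}
    (ha : PowerSeries.constantCoeff a = omega)
    (ψ : N.carrier ≃ₗ[Lz⟦X⟧] Res Lz S.K S.K⟦X⟧)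
    (hψ : ∀ s, ψ (N.conn s) = resConn S.ddzS_algebraMap (rankOneConn S.ddzS a) (ψ s)) :
    ∃ L : Submodule S.O (Red S.K S.K⟦X⟧), Submodule.IsLattice S.K L ∧
      N.lattice.map (S.redToRankOne ψ) = L.restrictScalars ℂ⟦X⟧ := by
  let T := S.redToRankOne ψ
  have hT : ∀ x, T (N.conn.red Lz x) = S.xi • T x := by
    intro x
    obtain ⟨m, rfl⟩ := Red.mk_surjective x
    rw [LambdaConnection.red_mk, ← algebraMap_smul S.K S.xi, algebraMap_xi, ← ha,
      ← rankOneConn_red S.ddzS]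
    simp only [T]
    rw [S.redToRankOne_mk ψ (hψ m), S.redToRankOne_mk ψ rfl]
    rfl
  let L : Submodule S.O (Red S.K S.K⟦X⟧) :=
    { carrier := T '' N.lattice
      zero_mem' := ⟨0, zero_mem _, map_zero _⟩
      add_mem' := by
        rintro _ _ ⟨x, hx, rfl⟩ ⟨y, hy, rfl⟩
        exact ⟨x + y, add_mem hx hy, map_add _ _ _⟩
      smul_mem' := by
        rintro y _ ⟨x, hx, rfl⟩
        refine ⟨y.re • x + y.im • N.conn.red Lz x,
          add_mem (N.lattice.smul_mem _ hx) (N.lattice.smul_mem _ (hN.2.2 x hx)), ?_⟩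
        have hy : y = algebraMap ℂ⟦X⟧ S.O y.re + algebraMap ℂ⟦X⟧ S.O y.im * S.xi := by
          rw [xi_eq]; ext <;> simp
        rw [map_add, map_smul, map_smul, hT]
        conv_rhs => rw [hy, add_smul, mul_smul, algebraMap_smul, algebraMap_smul] }
  refine ⟨L, ⟨?_, ?_⟩, rfl⟩
  · obtain ⟨s, hs⟩ := N.isLattice.fg.map T
    refine ⟨s, le_antisymm (Submodule.span_le.2 fun x hx => ?_) fun x hx => ?_⟩
    · have h : x ∈ N.lattice.map T := hs ▸ Submodule.subset_span hx
      exact h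
    · have h : x ∈ Submodule.span ℂ⟦X⟧ (s : Set (Red S.K S.K⟦X⟧)) := by
        rw [hs]
        exact hx
      exact Submodule.span_le_restrictScalars ℂ⟦X⟧ S.O _ h
  · rw [eq_top_iff]
    rintro x -
    obtain ⟨m, rfl⟩ := Red.mk_surjective x
    obtain ⟨v, hv⟩ := ψ.surjective m
    have h : Red.mk Lz N.carrier v ∈ Submodule.span Lz (N.lattice : Set (Red Lz N.carrier)) := by
      rw [N.isLattice.span_eq_top]; trivial
    have h1 : Red.mk S.K S.K⟦X⟧ m = T (Red.mk Lz N.carrier v) := by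
      simp only [T]
      rw [S.redToRankOne_mk ψ hv]
    rw [h1]
    generalize Red.mk Lz N.carrier v = x at h
    clear h1
    induction h using Submodule.span_induction with
    | mem x hx => exact Submodule.subset_span ⟨x, hx, rfl⟩
    | zero => rw [map_zero]; exact zero_mem _
    | add x y _ _ hx hy => rw [map_add]; exact add_mem hx hy
    | smul r x _ hx =>
      simp only [T] at hx ⊢
      rw [redToRankOne_smul]
      exact Submodule.smul_mem _ _ hx

theorem push_essSurj : S.push.EssSurj where
  mem_essImage N := by
    obtain ⟨b, P, Q, hb, hP, hQ⟩ :=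
      S.exists_isCompanion_punctured N.obj.conn N.obj.free.some N.property.1 N.property.2.1
    obtain ⟨a, ha, hr⟩ := S.exists_riccati hP hQ
    obtain ⟨ψ, -, -, hψ⟩ := S.exists_equiv_of_isCompanion hb ha hr
    obtain ⟨L, hL, h⟩ := S.exists_lattice N.property ha ψ hψ
    let f : N.obj ⟶ S.pushObj (S.rankOne a L hL) := S.homPushRankOne N.obj ψ hψ L hL h
    exact ⟨⟨S.rankOne a L hL, S.isTCC_rankOne ha L hL⟩, ⟨S.IsCC.isoMk (asIso f).symm⟩⟩

theorem push_isEquivalence : S.push.IsEquivalence where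
  faithful := S.push_faithful
  full := S.push_full
  essSurj := S.push_essSurj

/-! ### The isomorphism class of the regular objects -/

/-- A gauge transformation is an isomorphism of objects of rank one. -/
theorem nonempty_gaugeHom {a a' u : S.K⟦X⟧} {v : S.O} (hv : IsUnit v)
    (hu : PowerSeries.constantCoeff u = algebraMap S.O S.K v)
    (h : PowerSeries.X * coeffDeriv S.ddzS u = (a - a') * u) :
    Nonempty (LatMod.Hom (S.rankOne a S.stdLattice S.stdLattice_isLattice)
      (S.rankOne a' S.stdLattice S.stdLattice_isLattice)) := by
  have hu' : IsUnit u := by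
    rw [PowerSeries.isUnit_iff_constantCoeff, hu]
    exact hv.map _
  obtain ⟨e, he⟩ := exists_linearEquiv_mul hu'
  have hcomm : ∀ s : S.K⟦X⟧, e (rankOneConn S.ddzS a s) = rankOneConn S.ddzS a' (e s) := by
    intro s
    rw [he, he, rankOneConn_apply, rankOneConn_apply, coeffDeriv_mul]
    linear_combination (-s) * h
  -- Modulo `λ` the gauge transformation is multiplication by a unit of `O`.
  have hL : S.stdLattice.map (Red.map S.O e.toLinearMap) = S.stdLattice := by
    have h1 : Red.map S.O e.toLinearMap (Red.mk S.K S.K⟦X⟧ 1) = v • Red.mk S.K S.K⟦X⟧ 1 := by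
      rw [← S.mk_eq_smul_mk_one hu, Red.map_mk, LinearEquiv.coe_coe, he, mul_one]
    rw [stdLattice, Submodule.map_span, Set.image_singleton, h1,
      Submodule.span_singleton_smul_eq hv]
  exact ⟨⟨⟨e, hcomm⟩, hL⟩⟩

theorem constantCoeff_normalForm : PowerSeries.constantCoeff S.normalForm = omega := by
  simp [normalForm]

/-- The object of rank one in normal form. -/
def normalObj : S.TCC :=
  ⟨S.rankOne S.normalForm S.stdLattice S.stdLattice_isLattice,
    S.isTCC_rankOne S.constantCoeff_normalForm _ _⟩

theorem apply_one_tmul {V : Type} [AddCommGroup V] [Module ℂ⟦X⟧⟦X⟧ V]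
    (b : Module.Basis (Fin 2) ℂ⟦X⟧⟦X⟧ V)
    (ψ : (Lz⟦X⟧ ⊗[ℂ⟦X⟧⟦X⟧] V) ≃ₗ[Lz⟦X⟧] Res Lz S.K S.K⟦X⟧) {a : S.K⟦X⟧}
    (h0 : ψ (b.baseChange Lz⟦X⟧ 0) = (1 : S.K⟦X⟧)) (h1 : ψ (b.baseChange Lz⟦X⟧ 1) = a)
    (f g : ℂ⟦X⟧⟦X⟧) : ψ ((1 : Lz⟦X⟧) ⊗ₜ[ℂ⟦X⟧⟦X⟧] (f • b 0 + g • b 1))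
      = (algebraMap Lz⟦X⟧ S.K⟦X⟧ (algebraMap ℂ⟦X⟧⟦X⟧ Lz⟦X⟧ f)
        + algebraMap Lz⟦X⟧ S.K⟦X⟧ (algebraMap ℂ⟦X⟧⟦X⟧ Lz⟦X⟧ g) * a : S.K⟦X⟧) := by
  have e : (1 : Lz⟦X⟧) ⊗ₜ[ℂ⟦X⟧⟦X⟧] (f • b 0 + g • b 1)
      = algebraMap ℂ⟦X⟧⟦X⟧ Lz⟦X⟧ f • b.baseChange Lz⟦X⟧ 0
        + algebraMap ℂ⟦X⟧⟦X⟧ Lz⟦X⟧ g • b.baseChange Lz⟦X⟧ 1 := by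
    rw [Module.Basis.baseChange_apply, Module.Basis.baseChange_apply, TensorProduct.tmul_add,
      TensorProduct.tmul_smul, TensorProduct.tmul_smul, algebraMap_smul, algebraMap_smul]
  have h0' := S.map_smul_res ψ (algebraMap ℂ⟦X⟧⟦X⟧ Lz⟦X⟧ f) h0
  have h1' := S.map_smul_res ψ (algebraMap ℂ⟦X⟧⟦X⟧ Lz⟦X⟧ g) h1
  rw [mul_one] at h0'
  rw [e]
  exact (ψ.map_add _ _).trans (congrArg₂ (fun x y : Res Lz S.K S.K⟦X⟧ => x + y) h0' h1')

/-- Modulo `λ` the two basis vectors go to `1` and `ξ`, which generate `O` over `ℂ⟦z⟧`. So the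
lattice of an object of `Conn` in companion form becomes the standard one. -/
theorem map_range_redExtend {V : Type} [AddCommGroup V] [Module ℂ⟦X⟧⟦X⟧ V]
    (b : Module.Basis (Fin 2) ℂ⟦X⟧⟦X⟧ V)
    (ψ : (Lz⟦X⟧ ⊗[ℂ⟦X⟧⟦X⟧] V) ≃ₗ[Lz⟦X⟧] Res Lz S.K S.K⟦X⟧) {a : S.K⟦X⟧}
    (ha : PowerSeries.constantCoeff a = omega)
    (h0 : ψ (b.baseChange Lz⟦X⟧ 0) = (1 : S.K⟦X⟧)) (h1 : ψ (b.baseChange Lz⟦X⟧ 1) = a) :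
    (LinearMap.range (redExtend ℂ⟦X⟧ Lz V)).map (S.redToRankOne ψ)
      = S.stdLattice.restrictScalars ℂ⟦X⟧ := by
  have key : ∀ f g : ℂ⟦X⟧⟦X⟧,
      S.redToRankOne ψ (redExtend ℂ⟦X⟧ Lz V (Red.mk ℂ⟦X⟧ V (f • b 0 + g • b 1)))
      = (algebraMap ℂ⟦X⟧ S.O (PowerSeries.constantCoeff f)
        + algebraMap ℂ⟦X⟧ S.O (PowerSeries.constantCoeff g) * S.xi) • Red.mk S.K S.K⟦X⟧ 1 := by
    intro f g
    rw [redExtend_mk, S.redToRankOne_mk ψ (S.apply_one_tmul b ψ h0 h1 f g)]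
    refine S.mk_eq_smul_mk_one ?_
    rw [map_add, map_add, map_mul, map_mul, constantCoeff_algebraMap, constantCoeff_algebraMap,
      constantCoeff_algebraMap, constantCoeff_algebraMap, ha, algebraMap_O_K, algebraMap_O_K,
      algebraMap_xi]
  apply le_antisymm
  · rintro _ ⟨_, ⟨y, rfl⟩, rfl⟩
    obtain ⟨m, rfl⟩ := Red.mk_surjective y
    rw [← b.sum_repr m, Fin.sum_univ_two, key]
    exact Submodule.mem_span_singleton.2 ⟨_, rfl⟩
  · intro x hx
    obtain ⟨y, rfl⟩ := Submodule.mem_span_singleton.1 hx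
    have hy : y = algebraMap ℂ⟦X⟧ S.O y.re + algebraMap ℂ⟦X⟧ S.O y.im * S.xi := by
      rw [xi_eq]; ext <;> simp
    refine ⟨_, ⟨Red.mk ℂ⟦X⟧ V (PowerSeries.C y.re • b 0 + PowerSeries.C y.im • b 1), rfl⟩, ?_⟩
    rw [key, PowerSeries.constantCoeff_C, PowerSeries.constantCoeff_C, ← hy]

/-- A vector cyclic over the whole disc serves twice: it makes the Riccati coefficients regular, so
that the rank one form can be brought to normal form, and it identifies the lattice with the
standard one. -/
theorem exists_hom_pushObj_rankOne (M : LamMod ddz 2) (hM : S.IsConn M) :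
    ∃ a : S.K⟦X⟧,
      Nonempty (LatMod.Hom ((extend 1 ddzK_algebraMap' 2 : LamMod ddz 2 ⥤ LatMod ℂ⟦X⟧ ddzK 2).obj M)
        (S.pushObj (S.rankOne a S.stdLattice S.stdLattice_isLattice))) ∧
      Nonempty (LatMod.Hom (S.rankOne a S.stdLattice S.stdLattice_isLattice)
        (S.rankOne S.normalForm S.stdLattice S.stdLattice_isLattice)) := by
  obtain ⟨b, P, Q, hb, hP, hQ⟩ := S.exists_isCompanion_conn M.conn M.free.some hM.1 hM.2
  have hP' : PowerSeries.constantCoeff (algebraMap ℂ⟦X⟧⟦X⟧ Lz⟦X⟧ P) = -algebraMap ℂ⟦X⟧ Lz S.d := by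
    rw [constantCoeff_algebraMap, hP, map_neg]
  have hQ' : PowerSeries.constantCoeff (algebraMap ℂ⟦X⟧⟦X⟧ Lz⟦X⟧ Q) = algebraMap ℂ⟦X⟧ Lz S.t := by
    rw [constantCoeff_algebraMap, hQ]
  obtain ⟨a, ha, hr⟩ := S.exists_riccati hP' hQ'
  obtain ⟨ψ, hψ0, hψ1, hψ⟩ :=
    S.exists_equiv_of_isCompanion (hb.extend (DB := ddzK) ddzK_algebraMap') ha hr
  obtain ⟨u, v, hv, hu, h⟩ := S.exists_gauge_riccati hP hQ ha hr
  have hL := S.map_range_redExtend b ψ ha hψ0 hψ1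
  exact ⟨a, ⟨S.homPushRankOne
    ((extend 1 ddzK_algebraMap' 2 : LamMod ddz 2 ⥤ LatMod ℂ⟦X⟧ ddzK 2).obj M) ψ hψ _ _ hL⟩,
    S.nonempty_gaugeHom hv hu h⟩

theorem nonempty_iso_normalObj_of_conn (M : S.Conn) :
    Nonempty (S.connToCC.obj M ≅ S.push.obj S.normalObj) := by
  obtain ⟨a, ⟨f⟩, ⟨g⟩⟩ := S.exists_hom_pushObj_rankOne M.obj M.property
  let f' : (S.connToCC.obj M).obj ⟶ S.pushObj (S.rankOne a S.stdLattice S.stdLattice_isLattice) :=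
    f
  let g' : S.rankOne a S.stdLattice S.stdLattice_isLattice ⟶ S.normalObj.obj := g
  exact ⟨S.IsCC.isoMk (asIso f' ≪≫ S.pushLat.mapIso (asIso g'))⟩

/-- The chain rule for `dz̃ / dz` and `dz / dz̃`. -/
theorem logFactor_mul_zt_mul_ddzt : S.logFactor * algebraMap S.O S.K
    (S.zt * S.ddzt (algebraMap ℂ⟦X⟧ S.O PowerSeries.X)) = 1 := by
  have h := S.ddzS_algebraMap_O (algebraMap ℂ⟦X⟧ S.O PowerSeries.X)
  rw [algebraMap_O_K, ddzS_algebraMap, ddzK_algebraMap, ddz_apply, PowerSeries.derivative_X,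
    map_one, map_one] at h
  exact h.symm

theorem algebraMap_half :
    algebraMap S.O S.K (algebraMap ℂ S.O (1 / 2)) = algebraMap Lz S.K 2⁻¹ := by
  have h2 : IsUnit (2 : S.K) := by simpa using S.isUnit_natCast_K 1
  apply h2.mul_left_cancel
  rw [← map_ofNat (algebraMap S.O S.K) 2, ← map_mul, ← map_ofNat (algebraMap ℂ S.O) 2, ← map_mul,
    map_ofNat, map_ofNat, ← map_ofNat (algebraMap Lz S.K) 2, ← map_mul,
    mul_inv_cancel₀ two_ne_zero, mul_one_div_cancel two_ne_zero, map_one, map_one, map_one]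

/-- The reduction and the residue leave only `λ` times a form regular in `dz̃`. All coefficients of
such a form are exact over `K`, and the one in degree zero is the logarithmic derivative of a unit
of `O`. -/
theorem nonempty_iso_normalObj_of_tConn (M : S.TConn) :
    Nonempty (S.tConnToTCC.obj M ≅ S.normalObj) := by
  let b := M.obj.free.some
  obtain ⟨c, hc, hc0⟩ := S.exists_tConn_form M.property b
  let a : S.K⟦X⟧ := PowerSeries.C S.logFactor * algebraMap S.O⟦X⟧ S.K⟦X⟧ (PowerSeries.C S.zt * c
        - PowerSeries.C (algebraMap ℂ S.O (1 / 2)) * PowerSeries.X)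
  obtain ⟨c', hc'⟩ := exists_eq_C_add_X_mul c
  -- The difference from the normal form, divided by `λ` and written relative to `dz`.
  let e : S.K⟦X⟧ := PowerSeries.C (S.logFactor * algebraMap S.O S.K S.zt)
    * algebraMap S.O⟦X⟧ S.K⟦X⟧ c'
  have he : PowerSeries.X * e = a - S.normalForm := by
    have h1 := congrArg (fun x => PowerSeries.C (R := S.K) (x * omega)) S.logFactor_mul_zt_mul_ddzt
    simp only [map_mul, one_mul] at h1
    rw [hc0] at hc'
    simp only [a, e, normalForm]
    rw [hc', ← S.algebraMap_half]
    simp only [map_add, map_sub, map_mul, algebraMap_C, algebraMap_X, algebraMap_xi]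
    linear_combination (-1 : S.K⟦X⟧) * h1
  have h2 := S.two_logFactor_zt_sq
  obtain ⟨h, hh⟩ : ∃ h : S.O, algebraMap S.O S.K S.zt * (S.logFactor * algebraMap S.O S.K S.zt)
      = algebraMap S.O S.K h := by
    refine ⟨algebraMap ℂ S.O (1 / 2) * algebraMap ℂ⟦X⟧ S.O (ddz S.disc), ?_⟩
    have h3 : algebraMap S.O S.K (algebraMap ℂ S.O (1 / 2)) * 2 = 1 := by
      rw [S.algebraMap_half, ← map_ofNat (algebraMap Lz S.K) 2, ← map_mul,
        inv_mul_cancel₀ two_ne_zero, map_one]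
    rw [map_mul, ← h2]
    linear_combination (-(algebraMap S.O S.K S.zt * S.logFactor * algebraMap S.O S.K S.zt)) * h3
  -- Regularity in `dz̃`: `logFactor * z̃²` is half the derivative of the discriminant, so each
  -- coefficient of `e` has at most a simple pole in `z̃` relative to `dz`.
  have hreg : ∀ n, algebraMap S.O S.K S.zt * PowerSeries.coeff n e
      = algebraMap S.O S.K (h * PowerSeries.coeff n c') := by
    intro n
    have h3 : PowerSeries.coeff n e = S.logFactor * algebraMap S.O S.K S.zt
        * algebraMap S.O S.K (PowerSeries.coeff n c') := by
      rw [← coeff_algebraMap]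
      exact PowerSeries.coeff_C_mul n _ _
    rw [h3, map_mul, ← hh]
    ring
  have h0 := hreg 0
  rw [PowerSeries.coeff_zero_eq_constantCoeff_apply] at h0
  obtain ⟨u, v, hv, hu, hue⟩ := S.exists_gauge e h0 (fun n => S.exists_ddzS_eq (hreg (n + 1)))
  let β := b.baseChange S.K⟦X⟧
  let k : Module.Basis (Fin 1) S.K⟦X⟧ S.K⟦X⟧ := Module.Basis.singleton (Fin 1) S.K⟦X⟧
  let ψ := k.equiv β (Equiv.refl _)
  have hψ : ∀ x, ψ x = x • ((1 : S.K⟦X⟧) ⊗ₜ[S.O⟦X⟧] b 0) := by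
    intro x
    have h1 : ψ 1 = (1 : S.K⟦X⟧) ⊗ₜ[S.O⟦X⟧] b 0 := by
      have := k.equiv_apply 0 β (Equiv.refl _)
      rw [Module.Basis.singleton_apply] at this
      refine this.trans ?_
      simp [β]
    rw [← h1, ← map_smul, smul_eq_mul, mul_one]
  let f : LatMod.Hom (S.rankOne a S.stdLattice S.stdLattice_isLattice) (S.tConnToTCC.obj M).obj :=
    { equiv := ψ
      comm := by
        refine LambdaConnection.comm_of_basis k (rankOneConn S.ddzS a)
          (extendConn S.logFactor S.ddzS_algebraMap_O M.obj.conn) ψ.toLinearMap fun i => ?_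
        rw [Module.Basis.singleton_apply, rankOneConn_apply, coeffDeriv_one, mul_zero, zero_add,
          mul_one, LinearEquiv.coe_coe, hψ, hψ, one_smul]
        exact (extendConn_one_tmul _ _ _ hc).symm
      map_lattice := by
        change (Submodule.span S.O {Red.mk S.K S.K⟦X⟧ 1}).map (Red.map S.O ψ.toLinearMap)
          = LinearMap.range (redExtend S.O S.K M.obj.carrier)
        have h1 : Red.map S.O ψ.toLinearMap (Red.mk S.K S.K⟦X⟧ 1)
            = redExtend S.O S.K M.obj.carrier (Red.basis b 0) := by
          rw [Red.map_mk, LinearEquiv.coe_coe, hψ, one_smul, Red.basis_apply, redExtend_mk]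
        rw [Submodule.map_span, Set.image_singleton, h1, LinearMap.range_eq_map,
          ← (Red.basis b).span_eq, Submodule.map_span, Set.range_unique, Set.image_singleton]
        rfl }
  obtain ⟨g⟩ := S.nonempty_gaugeHom hv hu (by rw [hue, ← mul_assoc, he])
  let g' : S.rankOne a S.stdLattice S.stdLattice_isLattice ⟶ S.normalObj.obj := g
  let f' : S.rankOne a S.stdLattice S.stdLattice_isLattice ⟶ (S.tConnToTCC.obj M).obj := f
  exact ⟨S.IsTCC.isoMk ((asIso f').symm ≪≫ asIso g')⟩

theorem nonempty_tConn : Nonempty S.TConn := by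
  let w := S.ddzt (algebraMap ℂ⟦X⟧ S.O PowerSeries.X) * S.xi
  let M : LamMod S.theta 1 :=
    { carrier := S.O⟦X⟧
      free := ⟨Module.Basis.singleton (Fin 1) S.O⟦X⟧⟩
      conn := rankOneConn S.theta (PowerSeries.C (S.zt * w)
        - PowerSeries.C (algebraMap ℂ S.O (1 / 2)) * PowerSeries.X) }
  refine ⟨M, fun x => ?_, fun s => ?_⟩
  · refine (rankOneConn_red S.theta _ x).trans ?_
    simp [w, mul_assoc]
  · refine ⟨PowerSeries.X * coeffDeriv S.ddzt s + PowerSeries.C w * s, ?_⟩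
    have h : coeffDeriv S.theta s = PowerSeries.C S.zt * coeffDeriv S.ddzt s := by
      refine PowerSeries.ext fun n => ?_
      simp [theta, PowerSeries.coeff_C_mul]
    change PowerSeries.X * coeffDeriv S.theta s + _ * s = -(_ * s) + PowerSeries.C S.zt * _
    rw [h, map_mul]
    ring

/-- The companion matrix of the equation of the curve gives an object. -/
theorem nonempty_conn : Nonempty S.Conn := by
  let c : LambdaConnection ddz (Fin 2 → ℂ⟦X⟧⟦X⟧) :=
    { toFun := AddMonoidHom.mk' (fun s => ![PowerSeries.X * coeffDeriv ddz (s 0)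
          - PowerSeries.C S.d * s 1,
          PowerSeries.X * coeffDeriv ddz (s 1) + s 0 + PowerSeries.C S.t * s 1]) (by
        intro s s'
        ext1 i
        fin_cases i <;> simp <;> ring)
      leibniz := by
        intro f s
        ext1 i
        fin_cases i <;> simp [coeffDeriv_mul] <;> ring }
  let b : Module.Basis (Fin 2) ℂ⟦X⟧⟦X⟧ (Fin 2 → ℂ⟦X⟧⟦X⟧) := Pi.basisFun _ _
  have h : IsCompanion c b (-PowerSeries.C S.d) (PowerSeries.C S.t) := by
    constructor
    · ext1 i
      fin_cases i <;> simp [b, c]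
    · ext1 i
      fin_cases i <;> simp [b, c]
  exact ⟨⟨⟨_, ⟨b⟩, c⟩, ⟨by simpa using h.trace, by simpa using h.det⟩⟩⟩

/-- Both sides are the one-element set containing the direct image of `normalObj`. The existence of
objects on each side rules out the empty set. -/
theorem image_isoClasses :
    IsoClasses.map S.push '' Set.range (IsoClasses.map S.tConnToTCC) =
      Set.range (IsoClasses.map S.connToCC) := by
  have h1 : ∀ x, IsoClasses.map S.push (IsoClasses.map S.tConnToTCC x)
      = Quotient.mk (isIsomorphicSetoid S.CC) (S.push.obj S.normalObj) := by
    rintro ⟨M⟩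
    obtain ⟨e⟩ := S.nonempty_iso_normalObj_of_tConn M
    exact Quotient.sound (s := isIsomorphicSetoid S.CC) ⟨S.push.mapIso e⟩
  have h2 : ∀ x, IsoClasses.map S.connToCC x
      = Quotient.mk (isIsomorphicSetoid S.CC) (S.push.obj S.normalObj) := by
    rintro ⟨M⟩
    exact Quotient.sound (s := isIsomorphicSetoid S.CC) (S.nonempty_iso_normalObj_of_conn M)
  obtain ⟨M⟩ := S.nonempty_tConn
  obtain ⟨N⟩ := S.nonempty_conn
  ext y
  constructor
  · rintro ⟨_, ⟨x, rfl⟩, rfl⟩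
    exact ⟨Quotient.mk _ N, (h2 _).trans (h1 x).symm⟩
  · rintro ⟨x, rfl⟩
    exact ⟨_, ⟨Quotient.mk _ M, rfl⟩, (h1 _).trans (h2 x).symm⟩

end SpectralCurve

end LambdaConn

end

theorem mainTheorem4 (S : LambdaConn.SpectralCurve) :
    (S.connToCC.Full ∧ S.connToCC.Faithful) ∧
    (S.tConnToTCC.Full ∧ S.tConnToTCC.Faithful) ∧
    S.push.IsEquivalence ∧
    Function.Bijective (LambdaConn.IsoClasses.map S.push) ∧
    LambdaConn.IsoClasses.map S.push '' Set.range (LambdaConn.IsoClasses.map S.tConnToTCC) =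
      Set.range (LambdaConn.IsoClasses.map S.connToCC) :=
  haveI := S.push_isEquivalence
  ⟨⟨S.connToCC_full, S.connToCC_faithful⟩, ⟨S.tConnToTCC_full, S.tConnToTCC_faithful⟩,
    S.push_isEquivalence, LambdaConn.bijective_isoClasses_map S.push, S.image_isoClasses⟩
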